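/- **Setting.** Let $N=\mathbb Z^2$, $M=N^*$, $N_{\mathbb R}=N\otimes\mathbb R$, let $\Lambda\subset N_{\mathbb R}$ be a lattice of rank $2$ and $\mathbb TA=N_{\mathbb R}/\Lambda$, so that $H_1(\mathbb TA,\mathbb Z)=\Lambda$. Let $\mathcal L$ be a line bundle on $\mathbb TA$ whose Chern class is a polarization: it is given by a linear map $c:\Lambda\to M$ and a function $\beta:\Lambda\to\mathbb R$ with $\beta_{\lambda+\mu}=\beta_\lambda+\beta_\mu+\langle c(\lambda),\mu\rangle$ and $\langle c(\lambda),\lambda\rangle>0$ for $\lambda\neq0$. A theta function of $\mathcal L$ is a convex piecewise affine function $\Theta$ on $N_{\mathbb R}$ with slopes in $M$ such that $\Theta(x+\lambda)=\Theta(x)+\langle c(\lambda),x\rangle+\beta_\lambda$ for all $x\in N_{\mathbb R}$, $\lambda\in\Lambda$. A (parametrized, irreducible) tropical curve $h:\Gamma\to\mathbb TA$ is a continuous map from a finite connected metric graph which is affine on each edge $e$ with slope $w_eu_e$, where $w_e\geqslant 1$ is an integer (the weight) and $u_e\in N$ is primitive, and such that the outgoing slopes at each vertex sum to $0$. Its genus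 is $b_1(\Gamma)$. It is simple if $\Gamma$ is trivalent and $h$ is an immersion. It belongs to the linear system $|\mathcal L|$ if its preimage in $N_{\mathbb R}$, with its weights, is the corner locus of a theta function of $\mathcal L$. Let $g\geqslant2$, and let $h:\Gamma\to\mathbb TA$ be a simple tropical curve of genus $g$ with $g-2$ marked points on $\Gamma$, whose images form the configuration $\mathcal P\subset\mathbb TA$; the set of marked points of $\Gamma$ is also denoted by $\mathcal P$. Let $\Gamma'$ be $\Gamma$ subdivided at the marked points, and write $N_e=\mathbb Zu_e$ for an edge $e$. Consider $$\Psi:\bigoplus_{V\in V(\Gamma')}N\to\bigoplus_{e\in E(\Gamma')}N/N_e\oplus\bigoplus_{i=1}^{g-2}N\oplus\Lambda^*,$$ which maps $(\phi_V)_V$ to the differences $\phi_{\partial^+e}-\phi_{\partial^-e}$, to the values $\phi_{V_i}$ at the marked points $V_i$, and to the element of $\Lambda^*$ defined as follows. For each $\lambda_k$ in a basis $(\lambda_1,\lambda_2)$ of $\Lambda$, choose a straight loop $s\mapsto q_k+s\lambda_k$ ($0\leqslant s\leqslant 1$) in $\mathbb TA$ that meets no vertex of $\Gamma'$ (it is then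 transverse to $\Gamma'$). The value on $\lambda_k$ is $\sum_j\det(v_j,\phi_{V_j})$, where the sum is over the intersection points of this loop with the edges of $\Gamma'$, the edge met at the $j$-th point being oriented so as to have slope $v_j$ with $\det(v_j,\lambda_k)>0$, and $V_j$ being its source for this orientation. The complex multiplicity is $$m^{\mathbb C}_\Gamma=\bigl|\ker(\Psi\otimes_{\mathbb Z}\mathbb C^*)\bigr|\prod_{e\in E(\Gamma')}w_e .$$ Let $\delta_\Gamma$ be the gcd of the weights of the edges, and let $m_\Gamma=\prod_Vm_V$, where the product is over the trivalent vertices $V$ and $m_V=|\det(a_V,b_V)|$ for two of the three outgoing slopes at $V$. For a subgraph $\Sigma\subset\Gamma$, let $\Lambda^\Sigma_\Gamma$ be the index in $\Lambda=H_1(\mathbb TA,\mathbb Z)$ of the image of $H_1(\Sigma,\mathbb Z)$. **Theorem.** Let $\Lambda$, $\mathcal L$ and $g\geqslant2$ be as above. For every generic configuration $\mathcal P\in(\mathbb TA)^{g-2}$, that is, for every $\mathcal P$ in some dense open subset of $(\mathbb TA)^{g-2}$ depending only on $\Lambda$, $\mathcal L$, $g$, the following holds for every simple tropical curve $h:\Gamma\to\mathbb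 TA$ of genus $g$ in the linear system $|\mathcal L|$ that passes through $\mathcal P$. The complement $\Gamma\setminus\mathcal P$ of the marked points is connected and retracts onto a subgraph $\Sigma\subset\Gamma$. Every such $\Sigma$ has genus $2$, its index $\Lambda^\Sigma_\Gamma$ is finite, and, for every choice of the basis of $\Lambda$ and of the straight loops in the definition of $\Psi$, $$m^{\mathbb C}_\Gamma=\delta_\Gamma\,\Lambda^\Sigma_\Gamma\,m_\Gamma .$$ -/

import Mathlib

open scoped TensorProduct Topology
open Filter

noncomputable section

/-! ### The lattice `N = ℤ²`, its real span, and tropical line bundles -/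

/-- The rank two lattice `N`, with a chosen basis. The dual lattice `M` is written in the dual
basis, so it has the same underlying type. -/
abbrev LatN := Fin 2 → ℤ

/-- The real plane `N ⊗ ℝ`. -/
abbrev RealN := Fin 2 → ℝ

/-- The inclusion of `N` in `N ⊗ ℝ`. -/
def realify (n : LatN) : RealN := fun i => (n i : ℝ)

/-- The determinant of two vectors of the plane. -/
def det2 {R : Type*} [CommRing R] (x y : Fin 2 → R) : R := x 0 * y 1 - x 1 * y 0

/-- The linear form `det(v, ·)` on `N`. -/
def detForm (v : LatN) : LatN →ₗ[ℤ] ℤ where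
  toFun y := det2 v y
  map_add' y z := by simp only [det2, Pi.add_apply]; ring
  map_smul' a y := by simp only [det2, Pi.smul_apply, smul_eq_mul, RingHom.id_apply]; ring

/-- The pairing of `m ∈ M` with a point of `N ⊗ ℝ`. -/
def pairing (m : LatN) (x : RealN) : ℝ := ∑ i, (m i : ℝ) * x i

/-- The tropical torus `(N ⊗ ℝ) / Λ`. -/
abbrev TropTorus (Λ : Submodule ℤ RealN) := RealN ⧸ Λ

/-- The class of a point of `N ⊗ ℝ` in the tropical torus. -/
abbrev toTorus (Λ : Submodule ℤ RealN) (x : RealN) : TropTorus Λ := Submodule.Quotient.mk x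

/-- A line bundle on the tropical torus whose Chern class `c : Λ → M` is a polarization: the
quotient of the trivial bundle by the action `l • (x, ξ) = (x + l, ξ + c(l)(x) + β(l))`. The
relation on `β` says that this is an action; it makes the form `c(l)(m)` symmetric. -/
structure PolarizedLineBundle (Λ : Submodule ℤ RealN) where
  chern : Λ →ₗ[ℤ] LatN
  shift : Λ → ℝ
  shift_add : ∀ l m : Λ, shift (l + m) = shift l + shift m + pairing (chern l) m
  chern_pos : ∀ l : Λ, l ≠ 0 → 0 < pairing (chern l) l

/-- Tropical theta functions: the sections of the line bundle, that is, convex piecewise affine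
functions with integer slopes that are quasi-periodic. -/
structure PolarizedLineBundle.IsTheta {Λ : Submodule ℤ RealN} (L : PolarizedLineBundle Λ)
    (θ : RealN → ℝ) : Prop where
  convex : ConvexOn ℝ Set.univ θ
  piecewise_affine : ∀ x : RealN, ∃ F : Finset (LatN × ℝ),
    ∀ᶠ y in 𝓝 x, ∃ a ∈ F, θ y = pairing a.1 y + a.2
  quasi_periodic : ∀ (x : RealN) (l : Λ),
    θ (x + l) = θ x + pairing (L.chern l) x + L.shift l

/-! ### Parametrized tropical curves -/

/-- An irreducible parametrized tropical curve in the tropical torus: a finite connected metric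
graph (loops and multiple edges are allowed) and a continuous map to the torus, affine with
slope in `N` on each edge, and balanced at each vertex. The edge `e` is parametrized by
`[0, length e]` from `src e` to `tgt e`, and `slope e` is the (not necessarily primitive) slope in
that direction. -/
structure TropCurve (Λ : Submodule ℤ RealN) where
  V : Type
  E : Type
  [fintypeV : Fintype V]
  [fintypeE : Fintype E]
  src : E → V
  tgt : E → V
  length : E → ℝ
  length_pos : ∀ e, 0 < length e
  slope : E → LatN
  pos : V → TropTorus Λ
  pos_tgt : ∀ e, pos (tgt e) = pos (src e) + toTorus Λ (length e • realify (slope e))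
  connected : (SimpleGraph.fromRel fun v w : V => ∃ e, src e = v ∧ tgt e = w).Connected
  balanced : ∀ v, open Classical in
    ∑ e, ((if src e = v then slope e else 0) - (if tgt e = v then slope e else 0)) = 0

namespace TropCurve

attribute [instance] TropCurve.fintypeV TropCurve.fintypeE

variable {Λ : Submodule ℤ RealN} (Γ : TropCurve Λ)

/-- The half-edges: `(e, false)` is the beginning of `e` and `(e, true)` is its end. -/
abbrev Flag := Γ.E × Bool

/-- The vertex of a half-edge. -/
def Flag.vertex {Γ : TropCurve Λ} (f : Γ.Flag) : Γ.V := if f.2 then Γ.tgt f.1 else Γ.src f.1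

/-- The other half of the same edge. -/
def Flag.opp {Γ : TropCurve Λ} (f : Γ.Flag) : Γ.Flag := (f.1, !f.2)

/-- The slope of a half-edge, pointing out of its vertex. -/
def Flag.outSlope {Γ : TropCurve Λ} (f : Γ.Flag) : LatN :=
  if f.2 then -Γ.slope f.1 else Γ.slope f.1

/-- The number of half-edges at a vertex. -/
def valence (v : Γ.V) : ℕ := Nat.card {f : Γ.Flag // f.vertex = v}

/-- The point of the torus with parameter `t` on the edge `e`. -/
def edgePoint (e : Γ.E) (t : ℝ) : TropTorus Λ :=
  Γ.pos (Γ.src e) + toTorus Λ (t • realify (Γ.slope e))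

/-- The map to the torus is an immersion: no edge is contracted, and different half-edges at a
vertex leave in different directions. -/
structure IsImmersion : Prop where
  slope_ne_zero : ∀ e, Γ.slope e ≠ 0
  not_sameRay : ∀ f f' : Γ.Flag, f ≠ f' → f.vertex = f'.vertex →
    ¬ SameRay ℤ f.outSlope f'.outSlope

/-- A simple tropical curve (an immersed trivalent curve) with marked points `p`. The graph is
already subdivided at the marked points: its vertices are the trivalent vertices, and bivalent
vertices at the marked points that are not trivalent vertices. -/
structure IsSimpleMarked {n : ℕ} (p : Fin n → Γ.V) : Prop where
  immersion : Γ.IsImmersion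
  valence_eq : ∀ v, Γ.valence v = 3 ∨ (Γ.valence v = 2 ∧ v ∈ Set.range p)

/-- The curve belongs to the linear system of `L`: its preimage in `N ⊗ ℝ`, with the weights of
its edges, is the corner locus of a theta function of `L`. Near a point `q` that does not lie over
a vertex, the theta function is the sum of an affine function and of one function
`max(0, det(slope, · - q))` for each branch of the curve through `q`. -/
def InLinearSystem (L : PolarizedLineBundle Λ) : Prop :=
  ∃ θ : RealN → ℝ, L.IsTheta θ ∧
    ∀ q : RealN, (∀ v, Γ.pos v ≠ toTorus Λ q) →
      ∃ (a : RealN) (b : ℝ), ∀ᶠ y in 𝓝 q,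
        θ y = ∑ i, a i * y i + b +
          ∑ e, ({t : ℝ | 0 < t ∧ t < Γ.length e ∧ Γ.edgePoint e t = toTorus Λ q}.ncard : ℝ) *
            max 0 (det2 (realify (Γ.slope e)) (y - q))

/-! ### Homology -/

open Classical in
/-- The boundary map from `1`-chains to `0`-chains of the graph. -/
def boundary : (Γ.E → ℤ) →ₗ[ℤ] (Γ.V → ℤ) :=
  Fintype.linearCombination ℤ fun e =>
    (Pi.single (Γ.tgt e) 1 - Pi.single (Γ.src e) 1 : Γ.V → ℤ)

/-- The first homology group of the subgraph with edge set `F`: the `1`-cycles supported on `F`. -/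
def H1 (F : Set Γ.E) : Submodule ℤ (Γ.E → ℤ) where
  carrier := {z | Γ.boundary z = 0 ∧ ∀ e, e ∉ F → z e = 0}
  zero_mem' := ⟨map_zero _, fun _ _ => rfl⟩
  add_mem' := by
    rintro x y ⟨hx, hx'⟩ ⟨hy, hy'⟩
    refine ⟨by rw [map_add, hx, hy, add_zero], fun e he => ?_⟩
    rw [Pi.add_apply, hx' e he, hy' e he, add_zero]
  smul_mem' := by
    rintro a x ⟨hx, hx'⟩
    refine ⟨by rw [map_smul, hx, smul_zero], fun e he => ?_⟩
    rw [Pi.smul_apply, hx' e he, smul_zero]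

/-- The genus (first Betti number) of the subgraph with edge set `F`. -/
def genusOn (F : Set Γ.E) : ℕ := Module.finrank ℤ (Γ.H1 F)

/-- The genus of the curve. -/
def genus : ℕ := Γ.genusOn Set.univ

/-- The total displacement in `N ⊗ ℝ` along a `1`-chain. -/
def period : (Γ.E → ℤ) →ₗ[ℤ] RealN :=
  Fintype.linearCombination ℤ fun e => Γ.length e • realify (Γ.slope e)

theorem period_mem {z : Γ.E → ℤ} (hz : Γ.boundary z = 0) : Γ.period z ∈ Λ := by
  classical
  rw [← Submodule.Quotient.mk_eq_zero]
  have h1 : ∀ e, toTorus Λ (Γ.length e • realify (Γ.slope e)) =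
      Γ.pos (Γ.tgt e) - Γ.pos (Γ.src e) := fun e => by rw [Γ.pos_tgt e]; abel
  have h2 := congrArg (Fintype.linearCombination ℤ Γ.pos) hz
  rw [map_zero] at h2
  rw [← h2]
  simp only [period, boundary, Fintype.linearCombination_apply, map_sum, map_smul, map_sub]
  change Λ.mkQ _ = _
  rw [map_sum]
  refine Finset.sum_congr rfl fun e _ => ?_
  rw [map_smul]
  change z e • toTorus Λ _ = _
  rw [h1, ← Fintype.linearCombination_apply ℤ Γ.pos (Pi.single (Γ.src e) 1)]
  simp [Fintype.linearCombination_apply_single]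

/-- The map `H₁(Σ, ℤ) → H₁((N ⊗ ℝ) / Λ, ℤ) = Λ` induced by the parametrization: the element of
`Λ` attached to a cycle is its displacement in the universal cover. -/
def homologyMap (F : Set Γ.E) : Γ.H1 F →ₗ[ℤ] Λ :=
  (Γ.period ∘ₗ (Γ.H1 F).subtype).codRestrict Λ fun z => Γ.period_mem z.2.1

/-- The index of `H₁(Σ, ℤ)` in `Λ`, for the subgraph `Σ` with edge set `F`. It is `0` if the index
is infinite. -/
def homologyIndex (F : Set Γ.E) : ℕ := (LinearMap.range (Γ.homologyMap F)).toAddSubgroup.index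

/-! ### The complement of the marked points -/

/-- The complement of the marked points is connected. Its cells are the unmarked vertices and all
the open edges. -/
def ComplementConnected {n : ℕ} (p : Fin n → Γ.V) : Prop :=
  (SimpleGraph.fromRel fun x y : {v : Γ.V // v ∉ Set.range p} ⊕ Γ.E =>
    ∃ v e, x = Sum.inl v ∧ y = Sum.inr e ∧ (Γ.src e = v ∨ Γ.tgt e = v)).Connected

/-- Elementary retractions between unions of vertices (first component) and open edges (second
component) of the graph: an edge with exactly one end left is retracted on that end, or a leaf is
retracted, with its edge, on the other end of that edge. -/
inductive Retraction : Set Γ.V × Set Γ.E → Set Γ.V × Set Γ.E → Prop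
  | openEdge (W : Set Γ.V) (F : Set Γ.E) (f : Γ.Flag) (hf : f.1 ∈ F)
      (hv : f.vertex ∈ W) (ho : f.opp.vertex ∉ W) : Retraction (W, F) (W, F \ {f.1})
  | leaf (W : Set Γ.V) (F : Set Γ.E) (f : Γ.Flag) (hf : f.1 ∈ F)
      (hv : f.vertex ∈ W) (ho : f.opp.vertex ∈ W)
      (hleaf : ∀ f' : Γ.Flag, f'.1 ∈ F → f'.vertex = f.vertex → f' = f) :
      Retraction (W, F) (W \ {f.vertex}, F \ {f.1})

/-- The complement of the marked points `p` retracts on the subgraph with vertex set `W` and edge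
set `F`. -/
structure ComplementRetractsOn {n : ℕ} (p : Fin n → Γ.V) (W : Set Γ.V) (F : Set Γ.E) : Prop where
  src_mem : ∀ e ∈ F, Γ.src e ∈ W
  tgt_mem : ∀ e ∈ F, Γ.tgt e ∈ W
  retracts : Relation.ReflTransGen Γ.Retraction ((Set.range p)ᶜ, Set.univ) (W, F)

/-! ### Multiplicities -/

/-- The weight of an edge: the lattice length of its slope. -/
def weight (e : Γ.E) : ℕ := Int.gcd (Γ.slope e 0) (Γ.slope e 1)

/-- The gcd of the weights of the edges. -/
def weightGcd : ℕ := Finset.univ.gcd Γ.weight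

open Classical in
/-- The multiplicity of a trivalent vertex: the common value of `|det(a, b)|` for two different
outgoing slopes `a` and `b`. -/
def vertexMult (v : Γ.V) : ℕ :=
  Finset.univ.sup fun f : Γ.Flag × Γ.Flag =>
    if f.1.vertex = v ∧ f.2.vertex = v then (det2 f.1.outSlope f.2.outSlope).natAbs else 0

open Classical in
/-- The usual multiplicity of a simple tropical curve: the product of the multiplicities of its
trivalent vertices. -/
def usualMult : ℕ := ∏ v ∈ Finset.univ.filter (fun v => Γ.valence v = 3), Γ.vertexMult v

/-- The straight loop `s ↦ q + s l`, `s ∈ [0, 1]`, of class `l ∈ Λ` meets no vertex. Such a loop is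
transverse to the curve: it would meet the ends of any parallel edge that it meets. -/
def LoopTransverse (q : RealN) (l : Λ) : Prop :=
  ∀ (v : Γ.V) (s : ℝ), 0 ≤ s → s ≤ 1 → toTorus Λ (q + s • (l : RealN)) ≠ Γ.pos v

/-- The number of intersection points of the straight loop based at `q` of class `l` with the
edge `e`. -/
def crossings (q : RealN) (l : Λ) (e : Γ.E) : ℕ :=
  {st : ℝ × ℝ | 0 ≤ st.1 ∧ st.1 < 1 ∧ 0 < st.2 ∧ st.2 < Γ.length e ∧
    toTorus Λ (q + st.1 • (l : RealN)) = Γ.edgePoint e st.2}.ncard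

open Classical in
/-- The moment `det(u, φ)` of the edge `e`, oriented so that it crosses the direction `l`
positively, computed at its source for that orientation. -/
def momentForm (l : Λ) (e : Γ.E) : (Γ.V → LatN) →ₗ[ℤ] ℤ :=
  if 0 < det2 (realify (Γ.slope e)) (l : RealN)
  then detForm (Γ.slope e) ∘ₗ LinearMap.proj (Γ.src e)
  else detForm (-Γ.slope e) ∘ₗ LinearMap.proj (Γ.tgt e)

/-- The sum of the moments of the edges met by the straight loop based at `q` of class `l`. -/
def momentSum (q : RealN) (l : Λ) : (Γ.V → LatN) →ₗ[ℤ] ℤ :=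
  ∑ e, Γ.crossings q l e • Γ.momentForm l e

/-- The rank one sublattice `N_e` of the lattice vectors parallel to the edge `e`. -/
def edgeLattice (e : Γ.E) : Submodule ℤ LatN := LinearMap.ker (detForm (Γ.slope e))

/-- The evaluation map `Ψ : ⨁_V N → (⨁_e N / N_e) ⊕ (⨁_i N) ⊕ Λ*` of a curve with marked points `p`,
computed with straight loops based at `q k` in the classes of a basis `b` of `Λ`. -/
def evalMap {n : ℕ} (p : Fin n → Γ.V) (b : Module.Basis (Fin 2) ℤ Λ) (q : Fin 2 → RealN) :
    (Γ.V → LatN) →ₗ[ℤ]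
      ((e : Γ.E) → LatN ⧸ Γ.edgeLattice e) × (Fin n → LatN) × (Λ →ₗ[ℤ] ℤ) :=
  LinearMap.prod
    (LinearMap.pi fun e =>
      (Γ.edgeLattice e).mkQ ∘ₗ (LinearMap.proj (R := ℤ) (φ := fun _ : Γ.V => LatN) (Γ.tgt e) -
        LinearMap.proj (Γ.src e)))
    (LinearMap.prod
      (LinearMap.pi fun i => LinearMap.proj (p i))
      ((b.constr ℤ).toLinearMap ∘ₗ LinearMap.pi fun k => Γ.momentSum (q k) (b k)))

/-- The complex multiplicity `|ker (Ψ ⊗ ℂˣ)| ∏_e w_e`. -/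
def complexMult {n : ℕ} (p : Fin n → Γ.V) (b : Module.Basis (Fin 2) ℤ Λ) (q : Fin 2 → RealN) :
    ℕ :=
  Nat.card (LinearMap.ker (LinearMap.rTensor (Additive ℂˣ) (Γ.evalMap p b q))) *
    ∏ e, Γ.weight e

end TropCurve

end

/-! ### Boundary maps of finite graphs -/

section GraphBoundary

/-! The proof has an algebraic half, an index computation for `Ψ`, and a geometric half, a
genericity argument.

Index computation (`complexMult_eq`). If an injective map has image of finite index in a direct
summand of its free target, Smith normal form identifies the kernel after tensoring with `ℂˣ` with a
product of groups of roots of unity, so its order is that index. Replacing the class of a vector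
modulo `N_e` by its determinant with the slope of `e` embeds the target of `Ψ` with index `∏ w_e`.
In the new target the sum of the edge coordinates vanishes on the image of `Ψ`, by balancing, while
on the old target this sum takes exactly the multiples of `δ`. Comparing indices
(`relIndex_ker_comp_mul_index`), the complex multiplicity is `δ` times the index of the image in the
sum-zero hyperplane. Now replace the displacement of each trivalent vertex by its moments along two
half-edges: this has determinant `± m_V` and accounts for `m_Γ`. The remaining map only sees moments
of half-edges. If `Γ ∖ P` is connected, its edge and mark coordinates fill the hyperplane; what
these coordinates kill is the space of flows of cycles avoiding the marks; and the `Λ*` coordinate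
of such a flow consists of the intersection numbers of its class with the basis. As the intersection
pairing is unimodular, the last index is that of `H₁(Σ)` in `Λ` (`relIndex_range_coordEval`).

Genericity (`exists_generic_configurations`). Following a theta function along a straight loop and
comparing with quasi-periodicity gives two identities (`theta_relations`): the slopes crossed add up
to the Chern class, and the moments crossed add up to a constant depending only on the bundle and on
an integral slope. These bound all discrete data (`exists_finite_types`), so the curves with lifted
vertices in a fundamental box are solutions of finitely many real affine systems. If within one
system the marks cannot be moved arbitrarily, their positions lie in a proper affine subspace; such
positions and their lattice translates are discarded.

For the other systems a dimension count (`IsSimpleMarked.of_isRegularMarking`) shows that the marks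
are distinct bivalent vertices and that the marked curve is rigid in its linear system. A cycle
avoiding the marks with period zero would be the moment flow of a nontrivial deformation, so `H₁` of
the complement embeds in `Λ` and has rank at most `2`. The complement has Euler characteristic `-1`,
hence it is connected of genus exactly `2`, and the index in `Λ` is finite
(`IsSimpleMarked.complementConnected`). -/

theorem finrank_range_add_finrank_ker' {R M N : Type*} [CommRing R] [IsDomain R] [AddCommGroup M]
    [Module R M] [Module.Finite R M] [AddCommGroup N] [Module R N] (f : M →ₗ[R] N) :
    Module.finrank R (LinearMap.range f) + Module.finrank R (LinearMap.ker f) =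
      Module.finrank R M := by
  rw [← f.quotKerEquivRange.finrank_eq, Submodule.finrank_quotient_add_finrank]

variable (R : Type*) [CommRing R] {X I : Type*} [Fintype I] (s t : I → X)

open Classical in
/-- The boundary map of the graph with edges `I` from `s i` to `t i`. -/
noncomputable def graphBoundary : (I → R) →ₗ[R] (X → R) :=
  Fintype.linearCombination R fun i => (Pi.single (t i) 1 - Pi.single (s i) 1 : X → R)

/-- The sum of the coordinates. -/
def coordSum (X : Type*) [Fintype X] : (X → R) →ₗ[R] R := ∑ x, LinearMap.proj x

variable {R}

theorem coordSum_apply [Fintype X] (c : X → R) : coordSum R X c = ∑ x, c x := by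
  simp [coordSum]

open Classical in
theorem graphBoundary_apply (z : I → R) (x : X) :
    graphBoundary R s t z x =
      ∑ i, ((if t i = x then z i else 0) - (if s i = x then z i else 0)) := by
  simp only [graphBoundary, Fintype.linearCombination_apply, Finset.sum_apply, Pi.smul_apply,
    Pi.sub_apply, Pi.single_apply, smul_eq_mul, mul_sub, mul_ite, mul_one, mul_zero]
  refine Finset.sum_congr rfl fun i _ => ?_
  simp only [eq_comm]

theorem coordSum_graphBoundary [Fintype X] (z : I → R) : coordSum R X (graphBoundary R s t z) = 0 := by
  classical
  rw [coordSum_apply]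
  simp only [graphBoundary_apply]
  rw [Finset.sum_comm]
  simp

/-- Along a path the boundaries of edges add up to the difference of the end vertices, and such
differences span the kernel of the sum. -/
theorem range_graphBoundary_of_connected [Fintype X]
    (h : (SimpleGraph.fromRel fun v w : X => ∃ i, s i = v ∧ t i = w).Connected) :
    LinearMap.range (graphBoundary R s t) = LinearMap.ker (coordSum R X) := by
  classical
  refine le_antisymm ?_ ?_
  · rintro _ ⟨z, rfl⟩
    exact coordSum_graphBoundary s t z
  · have key : ∀ v w : X, (Pi.single w 1 - Pi.single v 1 : X → R) ∈
        LinearMap.range (graphBoundary R s t) := by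
      have hi : ∀ i, (Pi.single (t i) 1 - Pi.single (s i) 1 : X → R) ∈
          LinearMap.range (graphBoundary R s t) := fun i =>
        ⟨Pi.single i 1, by simp [graphBoundary, Fintype.linearCombination_apply_single]⟩
      intro v w
      obtain ⟨p⟩ := h.preconnected v w
      induction p with
      | nil => simp
      | @cons a b c hab p ih =>
        have h1 : (Pi.single b 1 - Pi.single a 1 : X → R) ∈
            LinearMap.range (graphBoundary R s t) := by
          rw [SimpleGraph.fromRel_adj] at hab
          rcases hab with ⟨-, ⟨i, rfl, rfl⟩ | ⟨i, rfl, rfl⟩⟩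
          · exact hi i
          · rw [← neg_sub]; exact neg_mem (hi i)
        have := add_mem ih h1
        rwa [sub_add_sub_cancel] at this
    intro c hc
    rw [LinearMap.mem_ker, coordSum_apply] at hc
    obtain ⟨x₀⟩ := h.nonempty
    have : c = ∑ x, c x • (Pi.single x 1 - Pi.single x₀ 1 : X → R) := by
      simp only [smul_sub, Finset.sum_sub_distrib, ← Finset.sum_smul, hc, zero_smul, sub_zero]
      ext y
      simp [Pi.single_apply]
    rw [this]
    exact sum_mem fun x _ => Submodule.smul_mem _ _ (key _ _)

theorem finrank_ker_graphBoundary_of_connected [Fintype X] [IsDomain R]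
    (h : (SimpleGraph.fromRel fun v w : X => ∃ i, s i = v ∧ t i = w).Connected) :
    Module.finrank R (LinearMap.ker (graphBoundary R s t)) + Fintype.card X =
      Fintype.card I + 1 := by
  classical
  have h1 := finrank_range_add_finrank_ker' (graphBoundary R s t)
  have h2 := finrank_range_add_finrank_ker' (coordSum R X)
  obtain ⟨x₀⟩ := h.nonempty
  have h3 : LinearMap.range (coordSum R X) = ⊤ := LinearMap.range_eq_top.2 fun a =>
    ⟨Pi.single x₀ a, by simp [coordSum_apply]⟩
  rw [range_graphBoundary_of_connected s t h] at h1
  rw [h3, finrank_top, Module.finrank_self] at h2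
  simp only [Module.finrank_fintype_fun_eq_card] at h1 h2
  omega

/-- The sums over one component and over its complement are independent forms vanishing on
boundaries, so the image has corank at least two. Against the connected case, this lets the Betti
number detect connectedness. -/
theorem card_add_two_le_of_not_preconnected [Fintype X] [IsDomain R] [IsNoetherianRing R]
    (h : ¬ (SimpleGraph.fromRel fun v w : X => ∃ i, s i = v ∧ t i = w).Preconnected) :
    Fintype.card I + 2 ≤
      Module.finrank R (LinearMap.ker (graphBoundary R s t)) + Fintype.card X := by
  classical
  set G := SimpleGraph.fromRel fun v w : X => ∃ i, s i = v ∧ t i = w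
  simp only [SimpleGraph.Preconnected, not_forall] at h
  obtain ⟨a, b, hab⟩ := h
  have hst : ∀ i, (G.Reachable a (t i) ↔ G.Reachable a (s i)) := fun i => by
    rcases eq_or_ne (s i) (t i) with h | h
    · rw [h]
    · have : G.Adj (s i) (t i) := (SimpleGraph.fromRel_adj _ _ _).2 ⟨h, Or.inl ⟨i, rfl, rfl⟩⟩
      exact ⟨fun h => h.trans this.symm.reachable, fun h => h.trans this.reachable⟩
  let f : (X → R) →ₗ[R] R × R :=
    LinearMap.prod (∑ x, if G.Reachable a x then LinearMap.proj x else 0)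
      (∑ x, if G.Reachable a x then 0 else LinearMap.proj x)
  have hf : ∀ c, f c = (∑ x, if G.Reachable a x then c x else 0,
      ∑ x, if G.Reachable a x then 0 else c x) := fun c => by
    refine Prod.ext ?_ ?_
    · change (∑ x, if G.Reachable a x then LinearMap.proj x else 0 : (X → R) →ₗ[R] R) c = _
      rw [LinearMap.sum_apply]
      exact Finset.sum_congr rfl fun x _ => by split_ifs <;> simp
    · change (∑ x, if G.Reachable a x then 0 else LinearMap.proj x : (X → R) →ₗ[R] R) c = _
      rw [LinearMap.sum_apply]
      exact Finset.sum_congr rfl fun x _ => by split_ifs <;> simp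
  have hsurj : LinearMap.range f = ⊤ := LinearMap.range_eq_top.2 fun ⟨x, y⟩ => by
    refine ⟨Pi.single a x + Pi.single b y, ?_⟩
    rw [map_add, hf, hf]
    have hx : ∀ (u : X) (r : R) (P : X → Prop) [DecidablePred P],
        (∑ x, if P x then (Pi.single u r : X → R) x else 0) = if P u then r else 0 := by
      intro u r P _
      rw [Finset.sum_eq_single u]
      · simp
      · intro y _ hy; simp [hy]
      · simp
    have hx' : ∀ (u : X) (r : R) (P : X → Prop) [DecidablePred P],
        (∑ x, if P x then 0 else (Pi.single u r : X → R) x) = if P u then 0 else r := by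
      intro u r P _
      rw [Finset.sum_eq_single u]
      · simp
      · intro y _ hy; simp [hy]
      · simp
    rw [hx, hx, hx', hx']
    simp [hab]
  have hle : LinearMap.range (graphBoundary R s t) ≤ LinearMap.ker f := by
    rintro _ ⟨z, rfl⟩
    rw [LinearMap.mem_ker]
    suffices h : f ∘ₗ graphBoundary R s t = 0 by exact LinearMap.congr_fun h z
    refine LinearMap.pi_ext' fun i => LinearMap.ext_ring ?_
    have : graphBoundary R s t (Pi.single i 1) = Pi.single (t i) 1 - Pi.single (s i) 1 := by
      simp [graphBoundary, Fintype.linearCombination_apply_single]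
    have hx : ∀ (u : X), f (Pi.single u 1) = if G.Reachable a u then (1, 0) else (0, 1) := by
      intro u
      rw [hf, Finset.sum_eq_single u, Finset.sum_eq_single u]
      · split_ifs <;> simp
      · intro y _ hy; simp [hy]
      · simp
      · intro y _ hy; simp [hy]
      · simp
    simp only [LinearMap.comp_apply, LinearMap.coe_single, this, map_sub, hx, hst, sub_self,
      LinearMap.zero_apply]
  have h1 := finrank_range_add_finrank_ker' (graphBoundary R s t)
  have h2 := finrank_range_add_finrank_ker' f
  have h3 := Submodule.finrank_mono hle
  rw [hsurj, finrank_top, Module.finrank_prod, Module.finrank_self] at h2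
  simp only [Module.finrank_fintype_fun_eq_card] at h1 h2
  omega

end GraphBoundary

theorem TropCurve.boundary_eq {Λ : Submodule ℤ RealN} (Γ : TropCurve Λ) :
    Γ.boundary = graphBoundary ℤ Γ.src Γ.tgt := rfl

/-! ### Kernels after tensoring with `ℂˣ`, and indices -/

theorem card_torsion_complex_units {a : ℤ} (ha : a ≠ 0) :
    Nat.card {x : Additive ℂˣ // a • x = 0} = a.natAbs := by
  have : NeZero a.natAbs := ⟨Int.natAbs_ne_zero.2 ha⟩
  rw [← Complex.card_rootsOfUnity a.natAbs]
  refine Nat.card_congr (Equiv.subtypeEquiv Additive.toMul fun x => ?_)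
  rw [mem_rootsOfUnity, ← toMul_nsmul, ← toMul_zero, Additive.toMul.apply_eq_iff_eq]
  rcases Int.natAbs_eq a with h | h
  · conv_lhs => rw [h, natCast_zsmul]
  · conv_lhs => rw [h, neg_smul, natCast_zsmul, neg_eq_zero]

/-- In Smith normal form `f` is diagonal with nonzero entries `a i`. After tensoring, the kernel is
the product of the `a i`-torsion groups of `ℂˣ`, which have `|a i|` elements, and the product of the
`|a i|` is the index. -/
theorem card_ker_rTensor_complex_units {A K : Type*} [AddCommGroup A] [AddCommGroup K]
    [Module.Free ℤ K] [Module.Finite ℤ K] (f : A →ₗ[ℤ] K) (hf : Function.Injective f)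
    (hi : (LinearMap.range f).toAddSubgroup.index ≠ 0) :
    Nat.card (LinearMap.ker (LinearMap.rTensor (Additive ℂˣ) f)) =
      (LinearMap.range f).toAddSubgroup.index := by
  classical
  obtain ⟨n, snf⟩ := (LinearMap.range f).smithNormalForm (Module.Free.chooseBasis ℤ K)
  have hn := snf.toAddSubgroup_index_ne_zero_iff.1 hi
  have hind := snf.toAddSubgroup_index_eq_ite
  rw [if_pos hn] at hind
  have hbij : Function.Bijective snf.f :=
    (Fintype.bijective_iff_injective_and_card _).2 ⟨snf.f.injective, by simpa using hn⟩
  let e : A ≃ₗ[ℤ] LinearMap.range f := LinearEquiv.ofInjective f hf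
  let bA : Module.Basis (Fin n) ℤ A := snf.bN.map e.symm
  have ha : ∀ i, snf.a i ≠ 0 := fun i hi => by
    have h := snf.snf i
    rw [hi, zero_smul] at h
    exact snf.bN.ne_zero i (Subtype.ext h)
  let e₁ := TensorProduct.equivFinsuppOfBasisLeft (N := Additive ℂˣ) bA
  let e₂ := TensorProduct.equivFinsuppOfBasisLeft (N := Additive ℂˣ) snf.bM
  have key : ∀ (x : A ⊗[ℤ] Additive ℂˣ) (i : Fin n),
      e₂ (LinearMap.rTensor _ f x) (snf.f i) = snf.a i • e₁ x i := by
    intro x i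
    induction x with
    | zero => simp
    | add x y hx hy => 
      simp only [map_add, Finsupp.add_apply, hx, hy]
      exact (zsmul_add _ _ _).symm
    | tmul y g =>
      simp only [e₁, e₂, LinearMap.rTensor_tmul,
        TensorProduct.equivFinsuppOfBasisLeft_apply_tmul_apply]
      have : f y = ((e y : LinearMap.range f) : K) := rfl
      rw [this, snf.repr_apply_embedding_eq_repr_smul, smul_smul]
      simp [bA]
  have hker : ∀ x, x ∈ LinearMap.ker (LinearMap.rTensor (Additive ℂˣ) f) ↔
      ∀ i, snf.a i • e₁ x i = 0 := by
    intro x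
    rw [LinearMap.mem_ker, ← e₂.map_eq_zero_iff, Finsupp.ext_iff]
    simp only [← key]
    exact ⟨fun h i => h _, fun h j => by obtain ⟨i, rfl⟩ := hbij.2 j; exact h i⟩
  have e₃ : LinearMap.ker (LinearMap.rTensor (Additive ℂˣ) f) ≃
      ((i : Fin n) → {x : Additive ℂˣ // snf.a i • x = 0}) :=
    (Equiv.subtypeEquiv (e₁.toEquiv.trans Finsupp.equivFunOnFinite) fun x => hker x).trans
      (Equiv.subtypePiEquivPi (p := fun i (x : Additive ℂˣ) => snf.a i • x = 0))
  rw [Nat.card_congr e₃, Nat.card_pi, hind]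
  refine Finset.prod_congr rfl fun i _ => ?_
  rw [card_torsion_complex_units (ha i), Ideal.span_singleton_toAddSubgroup_eq_zmultiples,
    Int.index_zmultiples]

/-- The kernel of a linear form with values in `ℤ` is a direct summand. -/
theorem exists_leftInverse_subtype_ker {B : Type*} [AddCommGroup B] (r : B →ₗ[ℤ] ℤ) :
    ∃ π : B →ₗ[ℤ] LinearMap.ker r, π ∘ₗ (LinearMap.ker r).subtype = LinearMap.id := by
  obtain ⟨s, hs⟩ := r.rangeRestrict.exists_rightInverse_of_surjective
    (LinearMap.range_rangeRestrict r)
  have hs' : ∀ x, r (s x) = x := fun x => congrArg Subtype.val (LinearMap.congr_fun hs x)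
  refine ⟨LinearMap.codRestrict _ (LinearMap.id - s ∘ₗ r.rangeRestrict) fun x => ?_, ?_⟩
  · simp [hs']
  · ext ⟨x, hx⟩
    have : r.rangeRestrict x = 0 := Subtype.ext hx
    simp [this]

/-- This is the form needed for `Ψ`, whose image has infinite index. Since the kernel of `r` is a
direct summand, its inclusion stays injective after tensoring, and the finite index case applies to
the corestriction of `f`. -/
theorem card_ker_rTensor_of_le_ker {A B : Type*} [AddCommGroup A] [AddCommGroup B]
    [Module.Free ℤ B] [Module.Finite ℤ B] (f : A →ₗ[ℤ] B) (r : B →ₗ[ℤ] ℤ)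
    (hf : Function.Injective f) (hr : r ∘ₗ f = 0)
    (hi : (LinearMap.range f).toAddSubgroup.relIndex (LinearMap.ker r).toAddSubgroup ≠ 0) :
    Nat.card (LinearMap.ker (LinearMap.rTensor (Additive ℂˣ) f)) =
      (LinearMap.range f).toAddSubgroup.relIndex (LinearMap.ker r).toAddSubgroup := by
  let f' : A →ₗ[ℤ] LinearMap.ker r := f.codRestrict _ fun x => LinearMap.congr_fun hr x
  have hff' : f = (LinearMap.ker r).subtype ∘ₗ f' := rfl
  have hind : (LinearMap.range f').toAddSubgroup.index =
      (LinearMap.range f).toAddSubgroup.relIndex (LinearMap.ker r).toAddSubgroup := by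
    rw [AddSubgroup.relIndex]
    refine congrArg AddSubgroup.index ?_
    ext x
    constructor
    · rintro ⟨y, rfl⟩; exact ⟨y, rfl⟩
    · rintro ⟨y, hy⟩; exact ⟨y, Subtype.ext hy⟩
  obtain ⟨π, hπ⟩ := exists_leftInverse_subtype_ker r
  have hinj : Function.Injective (LinearMap.rTensor (Additive ℂˣ) (LinearMap.ker r).subtype) := by
    refine Function.LeftInverse.injective (g := LinearMap.rTensor (Additive ℂˣ) π) fun x => ?_
    rw [← LinearMap.comp_apply, ← LinearMap.rTensor_comp, hπ, LinearMap.rTensor_id]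
    rfl
  rw [← hind, ← card_ker_rTensor_complex_units f' (fun x y h => hf (congrArg Subtype.val h))
    (by rwa [hind])]
  congr 2
  rw [hff', LinearMap.rTensor_comp, LinearMap.ker_comp_of_ker_eq_bot _ (LinearMap.ker_eq_bot.2 hinj)]

theorem index_range_eq_natAbs_det {A : Type*} [AddCommGroup A] [Module.Free ℤ A]
    [Module.Finite ℤ A] (f : A →ₗ[ℤ] A) (hf : Function.Injective f) :
    (LinearMap.range f).toAddSubgroup.index = (LinearMap.det f).natAbs := by
  rw [AddSubgroup.index_eq_card]
  exact (Submodule.natAbs_det_equiv (LinearMap.range f) (LinearEquiv.ofInjective f hf)).symm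

/-- Comparison of the relative indices of a subgroup and of its image under an injective map,
inside the kernels of a surjective map and of its restriction. -/
theorem relIndex_ker_comp_mul_index {B B' C : Type*} [AddCommGroup B] [AddCommGroup B']
    [AddCommGroup C] (D : B →+ B') (hD : Function.Injective D) (r : B' →+ C)
    (hr : Function.Surjective r) (H : AddSubgroup B) (hH : H ≤ (r.comp D).ker) :
    H.relIndex (r.comp D).ker * D.range.index =
      (r.comp D).range.index * (H.map D).relIndex r.ker := by
  have h1 : H.relIndex (r.comp D).ker = (H.map D).relIndex (D.range ⊓ r.ker) := by
    rw [← AddSubgroup.relIndex_map_map_of_injective _ _ hD]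
    congr 1
    ext x
    constructor
    · rintro ⟨y, hy, rfl⟩; exact ⟨⟨y, rfl⟩, hy⟩
    · rintro ⟨⟨y, rfl⟩, hy⟩; exact ⟨y, hy, rfl⟩
  have h2 : (H.map D) ≤ D.range ⊓ r.ker := by
    rintro _ ⟨y, hy, rfl⟩; exact ⟨⟨y, rfl⟩, hH hy⟩
  -- The chain is `H.map D ≤ D.range ⊓ r.ker ≤ r.ker`. The upper step has the same index as
  -- `D.range` in `D.range ⊔ r.ker`, and the index of that sum is read off after applying `r`.
  have h3 := AddSubgroup.relIndex_mul_relIndex _ _ _ h2 inf_le_right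
  have h4 : (D.range ⊔ r.ker).index = (r.comp D).range.index := by
    have := AddSubgroup.index_map D.range r
    rw [AddMonoidHom.range_eq_top.2 hr, AddSubgroup.index_top, mul_one] at this
    rw [← this, AddMonoidHom.map_range]
  have h5 := AddSubgroup.relIndex_mul_index (le_sup_left : D.range ≤ D.range ⊔ r.ker)
  rw [AddSubgroup.relIndex_sup_left] at h5
  rw [← h3, h1, ← h5, h4, AddSubgroup.inf_relIndex_right]
  ring

/-! ### Determinants and the linear forms attached to a basis of the lattice -/

section Det2

variable {R : Type*} [CommRing R]

theorem det2_add_left (x y z : Fin 2 → R) : det2 (x + y) z = det2 x z + det2 y z := by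
  simp only [det2, Pi.add_apply]; ring

theorem det2_add_right (x y z : Fin 2 → R) : det2 z (x + y) = det2 z x + det2 z y := by
  simp only [det2, Pi.add_apply]; ring

theorem det2_sub_left (x y z : Fin 2 → R) : det2 (x - y) z = det2 x z - det2 y z := by
  simp only [det2, Pi.sub_apply]; ring

theorem det2_sub_right (x y z : Fin 2 → R) : det2 z (x - y) = det2 z x - det2 z y := by
  simp only [det2, Pi.sub_apply]; ring

theorem det2_smul_left (a : R) (x z : Fin 2 → R) : det2 (a • x) z = a * det2 x z := by
  simp only [det2, Pi.smul_apply, smul_eq_mul]; ring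

theorem det2_smul_right (a : R) (x z : Fin 2 → R) : det2 z (a • x) = a * det2 z x := by
  simp only [det2, Pi.smul_apply, smul_eq_mul]; ring

theorem det2_neg_left (x z : Fin 2 → R) : det2 (-x) z = -det2 x z := by
  simp only [det2, Pi.neg_apply]; ring

theorem det2_neg_right (x z : Fin 2 → R) : det2 z (-x) = -det2 z x := by
  simp only [det2, Pi.neg_apply]; ring

theorem det2_self (x : Fin 2 → R) : det2 x x = 0 := by
  simp only [det2]; ring

theorem det2_comm (x y : Fin 2 → R) : det2 x y = -det2 y x := by
  simp only [det2]; ring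

theorem det2_zero_left (z : Fin 2 → R) : det2 0 z = 0 := by simp [det2]

theorem det2_zero_right (z : Fin 2 → R) : det2 z 0 = 0 := by simp [det2]

theorem det2_cramer (x y z : Fin 2 → R) :
    det2 y z • x = det2 x z • y - det2 x y • z := by
  ext i
  fin_cases i <;> simp [det2] <;> ring

theorem det2_realify (x y : LatN) : det2 (realify x) (realify y) = (det2 x y : ℤ) := by
  simp [det2, realify]

theorem eq_zero_of_det2_eq_zero [IsDomain R] {x y v : Fin 2 → R} (h : det2 x y ≠ 0)
    (hx : det2 x v = 0) (hy : det2 y v = 0) : v = 0 := by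
  have h1 := det2_cramer v x y
  rw [det2_comm v y, hy, det2_comm v x, hx] at h1
  simpa [h] using h1

end Det2

theorem realify_neg (x : LatN) : realify (-x) = -realify x := by
  ext i; simp [realify]

theorem realify_eq_zero {x : LatN} : realify x = 0 ↔ x = 0 := by
  simp [funext_iff, realify]

section LatticeBasis

variable {Λ : Submodule ℤ RealN} (b : Module.Basis (Fin 2) ℤ Λ)

/-- The determinant of a basis of the lattice. -/
noncomputable def latticeDet : ℝ := det2 (b 0 : RealN) (b 1 : RealN)

/-- The linear form whose values count the signed intersections with the direction `b k`. -/
noncomputable def crossForm (k : Fin 2) : RealN →ₗ[ℝ] ℝ where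
  toFun x := det2 x (b k : RealN) / |latticeDet b|
  map_add' x y := by rw [det2_add_left, add_div]
  map_smul' a x := by rw [det2_smul_left, mul_div_assoc]; rfl

theorem crossForm_apply (k : Fin 2) (x : RealN) :
    crossForm b k x = det2 x (b k : RealN) / |latticeDet b| := rfl

theorem latticeDet_ne_zero [DiscreteTopology Λ] [IsZLattice ℝ Λ] : latticeDet b ≠ 0 := by
  intro h
  have hspan : Submodule.span ℝ (Λ : Set RealN) = ⊤ := IsZLattice.span_top
  let f : RealN →ₗ[ℝ] ℝ :=
    { toFun := fun x => det2 x (b 0 : RealN)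
      map_add' := fun x y => det2_add_left _ _ _
      map_smul' := fun a x => det2_smul_left _ _ _ }
  have hf : ∀ x, f x = 0 := by
    intro x
    have hx : x ∈ Submodule.span ℝ (Λ : Set RealN) := hspan ▸ Submodule.mem_top
    have hle : Submodule.span ℝ (Λ : Set RealN) ≤ LinearMap.ker f := by
      rw [Submodule.span_le]
      intro l hl
      have := b.sum_repr ⟨l, hl⟩
      rw [Fin.sum_univ_two] at this
      have h2 := congrArg (Subtype.val) this
      simp only [Submodule.coe_add, Submodule.coe_smul] at h2
      rw [SetLike.mem_coe, LinearMap.mem_ker, ← h2]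
      change det2 _ _ = 0
      rw [det2_add_left, ← Int.cast_smul_eq_zsmul ℝ, ← Int.cast_smul_eq_zsmul ℝ, det2_smul_left,
        det2_smul_left, det2_self, det2_comm]
      change _ + _ * (- latticeDet b) = 0
      rw [h]; simp
    exact hle hx
  have h0 : (b 0 : RealN) = 0 := by
    ext i
    fin_cases i
    · have := hf ![0, 1]
      simpa [f, det2] using this
    · have := hf ![1, 0]
      simpa [f, det2] using this
  exact b.ne_zero 0 (Subtype.ext h0)

/-- The orientation of a basis of the lattice. -/
noncomputable def latticeSign : ℤ := if 0 < latticeDet b then 1 else -1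

theorem latticeSign_mul_self : latticeSign b * latticeSign b = 1 := by
  unfold latticeSign; split_ifs <;> norm_num

theorem crossForm_self (k : Fin 2) : crossForm b k (b k) = 0 := by
  rw [crossForm_apply, det2_self, zero_div]

variable [DiscreteTopology Λ] [IsZLattice ℝ Λ]

theorem latticeDet_div_abs : latticeDet b / |latticeDet b| = latticeSign b := by
  have h := latticeDet_ne_zero b
  unfold latticeSign
  split_ifs with h1
  · rw [abs_of_pos h1, div_self h]; simp
  · rw [abs_of_neg (lt_of_le_of_ne (not_lt.1 h1) h), div_neg, div_self h]; simp

/-- The signed intersection number with `b k`, on the lattice. -/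
noncomputable def crossInt (k : Fin 2) : Λ →ₗ[ℤ] ℤ :=
  if k = 0 then -latticeSign b • b.coord 1 else latticeSign b • b.coord 0

theorem crossForm_coe (k : Fin 2) (l : Λ) : crossForm b k l = crossInt b k l := by
  have h2 : (l : RealN) = (b.repr l 0 : ℝ) • (b 0 : RealN) + (b.repr l 1 : ℝ) • (b 1 : RealN) := by
    conv_lhs => rw [← b.sum_repr l, Fin.sum_univ_two]
    simp only [Submodule.coe_add, Submodule.coe_smul, Int.cast_smul_eq_zsmul]
  have h3 := latticeDet_div_abs b
  rw [crossForm_apply, h2]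
  fin_cases k
  · simp only [Fin.zero_eta, det2_add_left, det2_smul_left, det2_self]
    rw [det2_comm]
    change (_ + _ * (-latticeDet b)) / _ = _
    simp only [crossInt, if_true, LinearMap.smul_apply, Module.Basis.coord_apply, smul_eq_mul]
    push_cast
    rw [← h3]; ring
  · simp only [Fin.mk_one, det2_add_left, det2_smul_left, det2_self]
    change (_ * (latticeDet b) + _) / _ = _
    simp only [crossInt, one_ne_zero, if_false, LinearMap.smul_apply, Module.Basis.coord_apply,
      smul_eq_mul]
    push_cast
    rw [← h3]; ring

theorem eq_crossForm (x : RealN) : x = ((latticeSign b : ℝ) * crossForm b 1 x) • (b 0 : RealN) -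
    ((latticeSign b : ℝ) * crossForm b 0 x) • (b 1 : RealN) := by
  have h := latticeDet_ne_zero b
  have h1 := det2_cramer x (b 0 : RealN) (b 1)
  change latticeDet b • x = _ at h1
  have h2 : x = (latticeDet b)⁻¹ • (latticeDet b • x) := by rw [smul_smul, inv_mul_cancel₀ h, one_smul]
  have h3 := abs_mul_abs_self (latticeDet b)
  have h4 : ∀ d : ℝ, (latticeSign b : ℝ) * (d / |latticeDet b|) = (latticeDet b)⁻¹ * d := by
    intro d
    rw [← latticeDet_div_abs]
    have := abs_ne_zero.2 h
    field_simp
    rw [sq_abs]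
  conv_lhs => rw [h2, h1, smul_sub, smul_smul, smul_smul]
  simp only [crossForm_apply, h4]

/-- Up to sign, `crossForm b k` is the coordinate along the other basis vector; when it is an
integer, only a multiple of `b k` is left modulo `Λ`. Thus the lines of direction `b k` through the
lattice points are the integral level sets of this form. -/
theorem exists_coord_eq_of_crossForm {k : Fin 2} {x : RealN} {m : ℤ} (h : crossForm b k x = m) :
    ∃ (l : Λ) (τ : ℝ), x = l + τ • (b k : RealN) := by
  have hx := eq_crossForm b x
  fin_cases k
  · simp only [Fin.zero_eta] at h ⊢
    rw [h] at hx
    refine ⟨-(latticeSign b * m) • b 1, (latticeSign b : ℝ) * crossForm b 1 x, ?_⟩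
    conv_lhs => rw [hx]
    rw [Submodule.coe_smul, ← Int.cast_smul_eq_zsmul ℝ]
    push_cast
    rw [neg_smul]; abel
  · simp only [Fin.mk_one] at h ⊢
    rw [h] at hx
    refine ⟨(latticeSign b * m) • b 0, -((latticeSign b : ℝ) * crossForm b 0 x), ?_⟩
    conv_lhs => rw [hx]
    rw [Submodule.coe_smul, ← Int.cast_smul_eq_zsmul ℝ]
    push_cast
    rw [neg_smul]; abel

theorem int_of_smul_mem {k : Fin 2} {τ : ℝ} (h : τ • (b k : RealN) ∈ Λ) : ∃ m : ℤ, τ = m := by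
  have h1 := crossForm_coe b (1 - k) ⟨_, h⟩
  simp only [map_smul, smul_eq_mul] at h1
  have h2 := latticeDet_div_abs b
  have h3 : (latticeSign b : ℝ) * latticeSign b = 1 := by exact_mod_cast latticeSign_mul_self b
  fin_cases k
  · have h4 : crossForm b (1 - 0) (b 0) = latticeSign b := h2
    simp only [Fin.zero_eta, h4] at h1
    refine ⟨crossInt b (1 - 0) ⟨_, h⟩ * latticeSign b, ?_⟩
    rw [Int.cast_mul]
    erw [← h1]
    rw [mul_assoc, h3, mul_one]
  · have h4 : crossForm b (1 - 1) (b 1) = -latticeSign b := by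
      rw [← h2, crossForm_apply, det2_comm, neg_div]; rfl
    simp only [Fin.mk_one, h4] at h1
    refine ⟨-crossInt b (1 - 1) ⟨_, h⟩ * latticeSign b, ?_⟩
    rw [Int.cast_mul, Int.cast_neg]
    erw [← h1]
    rw [mul_neg, neg_neg, mul_assoc, h3, mul_one]

/-- The intersection pairing is unimodular. -/
noncomputable def crossEquiv : Λ ≃ₗ[ℤ] (Fin 2 → ℤ) :=
  LinearEquiv.ofBijective (LinearMap.pi fun k => crossInt b k) (by
    have hs := latticeSign_mul_self b
    constructor
    · rw [← LinearMap.ker_eq_bot, LinearMap.ker_eq_bot']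
      intro l hl
      have h0 := congrFun hl 0
      have h1 := congrFun hl 1
      simp only [LinearMap.pi_apply, crossInt, if_true, one_ne_zero, if_false,
        LinearMap.smul_apply, Module.Basis.coord_apply, smul_eq_mul, Pi.zero_apply] at h0 h1
      rw [← b.repr.map_eq_zero_iff]
      ext i
      fin_cases i
      · have : latticeSign b * (latticeSign b * b.repr l 0) = 0 := by rw [h1, mul_zero]
        simpa [← mul_assoc, hs] using this
      · have : -latticeSign b * (-latticeSign b * b.repr l 1) = 0 := by rw [h0, mul_zero]
        simpa [← mul_assoc, hs] using this
    · intro y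
      refine ⟨(latticeSign b * y 1) • b 0 + (-latticeSign b * y 0) • b 1, ?_⟩
      ext k
      fin_cases k
      · simp [crossInt, ← mul_assoc, hs]
      · simp [crossInt, ← mul_assoc, hs])

end LatticeBasis

/-! ### Counting integers in an affine progression -/

/-- As neither end value is an integer, the values to count are the integers between the two floors,
with no boundary case. For `v = 0` both sides are zero. -/
theorem ncard_affine_int (α v len : ℝ) (hlen : 0 < len) (h0 : ∀ m : ℤ, α ≠ m)
    (h1 : ∀ m : ℤ, α + len * v ≠ m) :
    {t : ℝ | 0 < t ∧ t < len ∧ ∃ m : ℤ, α + t * v = m}.Finite ∧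
    (({t : ℝ | 0 < t ∧ t < len ∧ ∃ m : ℤ, α + t * v = m}.ncard : ℕ) : ℤ) =
      if 0 < v then ⌊α + len * v⌋ - ⌊α⌋ else -(⌊α + len * v⌋ - ⌊α⌋) := by
  have lt_of : ∀ (β : ℝ), (∀ m : ℤ, β ≠ m) → ∀ m : ℤ, (m ≤ ⌊β⌋ ↔ (m : ℝ) < β) := fun β hβ m => by
    rw [Int.le_floor]
    exact ⟨fun h => lt_of_le_of_ne h (hβ m).symm, le_of_lt⟩
  have key : ∀ (S : Finset ℤ), v ≠ 0 →
      (∀ m : ℤ, m ∈ S ↔ 0 < ((m : ℝ) - α) / v ∧ ((m : ℝ) - α) / v < len) →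
      {t : ℝ | 0 < t ∧ t < len ∧ ∃ m : ℤ, α + t * v = m} =
        (S.image fun m : ℤ => ((m : ℝ) - α) / v : Finset ℝ) ∧
      (S.image fun m : ℤ => ((m : ℝ) - α) / v : Finset ℝ).card = S.card := by
    intro S hv hS
    refine ⟨?_, Finset.card_image_of_injective _ fun m m' h => ?_⟩
    · ext t
      simp only [Set.mem_ofPred_eq, Finset.coe_image, Set.mem_image, Finset.mem_coe]
      constructor
      · rintro ⟨ht0, ht1, m, hm⟩
        have : ((m : ℝ) - α) / v = t := by rw [← hm]; field_simp; ring
        exact ⟨m, (hS m).2 (by rw [this]; exact ⟨ht0, ht1⟩), this⟩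
      · rintro ⟨m, hm, rfl⟩
        have := (hS m).1 hm
        exact ⟨this.1, this.2, m, by field_simp; ring⟩
    · rw [div_left_inj' hv, sub_left_inj] at h
      exact_mod_cast h
  rcases lt_trichotomy v 0 with hv | hv | hv
  · obtain ⟨h2, h3⟩ := key (Finset.Ioc ⌊α + len * v⌋ ⌊α⌋) hv.ne fun m => by
      rw [Finset.mem_Ioc, lt_of α h0, ← not_le, lt_of _ h1, not_lt, div_lt_iff_of_neg hv,
        div_pos_iff]
      constructor
      · rintro ⟨h2, h3⟩
        exact ⟨Or.inr ⟨by linarith, hv⟩,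
          lt_of_le_of_ne (by linarith) fun h => h1 m (by linarith)⟩
      · rintro ⟨⟨-, h2⟩ | ⟨h2, -⟩, h3⟩
        · exact absurd h2 hv.not_gt
        · exact ⟨by linarith, by linarith⟩
    rw [h2, if_neg hv.not_gt, Set.ncard_coe_finset, h3, Int.card_Ioc]
    refine ⟨Finset.finite_toSet _, ?_⟩
    rw [Int.toNat_of_nonneg]
    · ring
    · have : ⌊α + len * v⌋ ≤ ⌊α⌋ := Int.floor_le_floor (by nlinarith)
      linarith
  · subst hv
    have : {t : ℝ | 0 < t ∧ t < len ∧ ∃ m : ℤ, α + t * 0 = m} = ∅ := by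
      ext t
      simp [h0]
    rw [this]
    simp
  · obtain ⟨h2, h3⟩ := key (Finset.Ioc ⌊α⌋ ⌊α + len * v⌋) hv.ne' fun m => by
      rw [Finset.mem_Ioc, lt_of _ h1, ← not_le, lt_of α h0, not_lt, div_lt_iff₀ hv,
        div_pos_iff]
      constructor
      · rintro ⟨h2, h3⟩
        exact ⟨Or.inl ⟨sub_pos.2 (lt_of_le_of_ne h2 (h0 m)), hv⟩, by linarith⟩
      · rintro ⟨⟨h2, -⟩ | ⟨-, h2⟩, h3⟩
        · exact ⟨by linarith, by linarith⟩
        · exact absurd h2 hv.not_gt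
    rw [h2, if_pos hv, Set.ncard_coe_finset, h3, Int.card_Ioc]
    refine ⟨Finset.finite_toSet _, ?_⟩
    rw [Int.toNat_of_nonneg]
    have : ⌊α⌋ ≤ ⌊α + len * v⌋ := Int.floor_le_floor (by nlinarith)
    linarith

/-! ### Intersections of straight loops with the curve -/

namespace TropCurve

variable {Λ : Submodule ℤ RealN} (Γ : TropCurve Λ)

/-- The signed number of integers met by the form `χ - χ q` along the edge `e`. -/
noncomputable def signedCross (χ : RealN →ₗ[ℝ] ℝ) (x : Γ.V → RealN) (q : RealN) (e : Γ.E) : ℤ :=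
  ⌊χ (x (Γ.src e)) - χ q + Γ.length e * χ (realify (Γ.slope e))⌋ - ⌊χ (x (Γ.src e)) - χ q⌋

/-- The set of intersections of a straight loop with an edge. -/
def crossSet (q : RealN) (l : Λ) (e : Γ.E) : Set (ℝ × ℝ) :=
  {st : ℝ × ℝ | 0 ≤ st.1 ∧ st.1 < 1 ∧ 0 < st.2 ∧ st.2 < Γ.length e ∧
    toTorus Λ (q + st.1 • (l : RealN)) = Γ.edgePoint e st.2}

theorem crossings_eq (q : RealN) (l : Λ) (e : Γ.E) : Γ.crossings q l e = (Γ.crossSet q l e).ncard :=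
  rfl

theorem toTorus_eq_iff {x y : RealN} : toTorus Λ x = toTorus Λ y ↔ x - y ∈ Λ :=
  Submodule.Quotient.eq Λ

variable {Γ} in
theorem edgePoint_eq {x : Γ.V → RealN} (hx : ∀ v, toTorus Λ (x v) = Γ.pos v) (e : Γ.E) (t : ℝ) :
    Γ.edgePoint e t = toTorus Λ (x (Γ.src e) + t • realify (Γ.slope e)) := by
  rw [edgePoint, ← hx]; rfl

variable {Γ} in
theorem lift_tgt_sub_mem {x : Γ.V → RealN} (hx : ∀ v, toTorus Λ (x v) = Γ.pos v) (e : Γ.E) :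
    x (Γ.tgt e) - (x (Γ.src e) + Γ.length e • realify (Γ.slope e)) ∈ Λ := by
  rw [← toTorus_eq_iff, hx, Γ.pos_tgt, ← hx]; rfl

variable {Γ}

theorem sum_cycle {M : Type*} [AddCommGroup M] {z : Γ.E → ℤ} (hz : Γ.boundary z = 0)
    (h : Γ.V → M) : ∑ e, z e • (h (Γ.tgt e) - h (Γ.src e)) = 0 := by
  classical
  have h2 := congrArg (Fintype.linearCombination ℤ h) hz
  have h3 : Γ.boundary z = ∑ e, z e • (Pi.single (Γ.tgt e) 1 - Pi.single (Γ.src e) 1 : Γ.V → ℤ) := by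
    rw [boundary, Fintype.linearCombination_apply]
  rw [map_zero, h3, map_sum] at h2
  rw [← h2]
  refine Finset.sum_congr rfl fun e _ => ?_
  rw [map_smul, map_sub, Fintype.linearCombination_apply_single,
    Fintype.linearCombination_apply_single, one_smul, one_smul]

variable [DiscreteTopology Λ] [IsZLattice ℝ Λ] {b : Module.Basis (Fin 2) ℤ Λ}

/-- A vertex at an integral level would lie modulo `Λ` on the line of direction `b k` through `q`;
the fractional part of its parameter would put it on the loop itself. -/
theorem crossForm_sub_ne_int {x : Γ.V → RealN} (hx : ∀ v, toTorus Λ (x v) = Γ.pos v)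
    {q : RealN} {k : Fin 2} (hq : Γ.LoopTransverse q (b k)) (v : Γ.V) (m : ℤ) :
    crossForm b k (x v) - crossForm b k q ≠ m := by
  intro h
  rw [← map_sub] at h
  obtain ⟨l, τ, hl⟩ := exists_coord_eq_of_crossForm b h
  refine hq v (Int.fract τ) (Int.fract_nonneg _) (Int.fract_lt_one _).le ?_
  rw [← hx, toTorus_eq_iff]
  have : q + Int.fract τ • (b k : RealN) - x v = ((-l - ⌊τ⌋ • b k : Λ) : RealN) := by
    push_cast
    rw [← Int.cast_smul_eq_zsmul ℝ, ← sub_eq_zero, Int.fract, sub_smul]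
    have : x v = q + (l + τ • (b k : RealN)) := by rw [← hl]; abel
    rw [this]; abel
  rw [this]
  exact Submodule.coe_mem _

theorem crossForm_tgt_ne_int {x : Γ.V → RealN} (hx : ∀ v, toTorus Λ (x v) = Γ.pos v)
    {q : RealN} {k : Fin 2} (hq : Γ.LoopTransverse q (b k)) (e : Γ.E) (m : ℤ) :
    crossForm b k (x (Γ.src e)) - crossForm b k q +
      Γ.length e * crossForm b k (realify (Γ.slope e)) ≠ m := by
  intro h
  have h1 := crossForm_coe b k ⟨_, lift_tgt_sub_mem hx e⟩
  simp only [map_sub, map_add, map_smul, smul_eq_mul] at h1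
  refine crossForm_sub_ne_int hx hq (Γ.tgt e) (crossInt b k ⟨_, lift_tgt_sub_mem hx e⟩ + m) ?_
  push_cast
  rw [← h, ← h1]
  ring

/-- The point of the edge determines the parameter on the loop modulo `ℤ`, and that parameter ranges
over a half-open interval of length one. Hence intersections correspond to integral levels met along
the edge. -/
theorem crossSet_projection {x : Γ.V → RealN} (hx : ∀ v, toTorus Λ (x v) = Γ.pos v)
    (q : RealN) (k : Fin 2) (e : Γ.E) :
    Set.BijOn Prod.snd (Γ.crossSet q (b k) e)
      {t : ℝ | 0 < t ∧ t < Γ.length e ∧ ∃ m : ℤ, crossForm b k (x (Γ.src e)) - crossForm b k q +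
        t * crossForm b k (realify (Γ.slope e)) = m} := by
  refine ⟨?_, ?_, ?_⟩
  · rintro ⟨σ, t⟩ ⟨h0, h1, ht0, ht1, h⟩
    rw [edgePoint_eq hx, toTorus_eq_iff] at h
    have h2 := crossForm_coe b k ⟨_, h⟩
    simp only [map_sub, map_add, map_smul, smul_eq_mul, crossForm_self, mul_zero, add_zero] at h2
    refine ⟨ht0, ht1, -crossInt b k ⟨_, h⟩, ?_⟩
    push_cast
    rw [← h2]; ring
  · rintro ⟨σ, t⟩ ⟨h0, h1, -, -, h⟩ ⟨σ', t'⟩ ⟨h0', h1', -, -, h'⟩ htt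
    obtain rfl : t = t' := htt
    simp only at h h' h0 h1 h0' h1'
    rw [← h', toTorus_eq_iff, add_sub_add_left_eq_sub, ← sub_smul] at h
    obtain ⟨m, hm⟩ := int_of_smul_mem b h
    have hm1 : (m : ℝ) < 1 := by linarith
    have hm2 : (-1 : ℝ) < m := by linarith
    have : m = 0 := by
      have : m < 1 := by exact_mod_cast hm1
      have : -1 < m := by exact_mod_cast hm2
      omega
    rw [this] at hm
    have : σ = σ' := by simpa [sub_eq_zero] using hm
    rw [this]
  · rintro t ⟨ht0, ht1, m, hm⟩
    have h : crossForm b k (x (Γ.src e) + t • realify (Γ.slope e) - q) = m := by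
      rw [← hm]; simp only [map_sub, map_add, map_smul, smul_eq_mul]; ring
    obtain ⟨l, τ, hl⟩ := exists_coord_eq_of_crossForm b h
    refine ⟨(Int.fract τ, t), ⟨Int.fract_nonneg _, Int.fract_lt_one _, ht0, ht1, ?_⟩, rfl⟩
    rw [edgePoint_eq hx, toTorus_eq_iff]
    have : q + Int.fract τ • (b k : RealN) - (x (Γ.src e) + t • realify (Γ.slope e)) =
        ((-l - ⌊τ⌋ • b k : Λ) : RealN) := by
      push_cast
      rw [← Int.cast_smul_eq_zsmul ℝ, Int.fract, sub_smul]
      have : x (Γ.src e) + t • realify (Γ.slope e) = q + (l + τ • (b k : RealN)) := by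
        rw [← hl]; abel
      rw [this]; abel
    simp only [this]
    exact Submodule.coe_mem _

theorem crossSet_finite {q : RealN} {k : Fin 2} (hq : Γ.LoopTransverse q (b k)) (e : Γ.E) :
    (Γ.crossSet q (b k) e).Finite := by
  choose x hx using fun v => Submodule.Quotient.mk_surjective Λ (Γ.pos v)
  have h := crossSet_projection (b := b) hx q k e
  exact Set.Finite.of_finite_image ((ncard_affine_int _ _ _ (Γ.length_pos e)
    (crossForm_sub_ne_int hx hq _) (crossForm_tgt_ne_int hx hq e)).1.subset h.mapsTo.image_subset)
    h.injOn

theorem crossForm_pos_iff (k : Fin 2) (s : RealN) :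
    0 < crossForm b k s ↔ 0 < det2 s (b k : RealN) := by
  rw [crossForm_apply, div_pos_iff_of_pos_right (abs_pos.2 (latticeDet_ne_zero b))]

theorem crossings_eq_signedCross {x : Γ.V → RealN} (hx : ∀ v, toTorus Λ (x v) = Γ.pos v)
    {q : RealN} {k : Fin 2} (hq : Γ.LoopTransverse q (b k)) (e : Γ.E) :
    (Γ.crossings q (b k) e : ℤ) =
      if 0 < det2 (realify (Γ.slope e)) (b k : RealN) then Γ.signedCross (crossForm b k) x q e
      else -Γ.signedCross (crossForm b k) x q e := by
  have h := crossSet_projection (b := b) hx q k e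
  have h2 := (ncard_affine_int _ _ _ (Γ.length_pos e)
    (crossForm_sub_ne_int hx hq (Γ.src e)) (crossForm_tgt_ne_int hx hq e)).2
  simp only [crossForm_pos_iff] at h2
  rw [crossings_eq, h.ncard_eq]
  exact h2

/-- On each edge the signed crossing number is the increment of `crossForm b k` minus the increment
of the fractional part of its shifted values at the vertices. The second increment is a coboundary
and sums to zero over a cycle. So crossings with the loop compute the intersection number of
homology classes. -/
theorem sum_signedCross {x : Γ.V → RealN} (hx : ∀ v, toTorus Λ (x v) = Γ.pos v)
    (q : RealN) (k : Fin 2) {z : Γ.E → ℤ} (hz : Γ.boundary z = 0) :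
    ((∑ e, Γ.signedCross (crossForm b k) x q e * z e : ℤ) : ℝ) =
      crossForm b k (Γ.period z) := by
  have h0 := sum_cycle hz fun v => Int.fract (crossForm b k (x v) - crossForm b k q)
  have h1 : ∀ e, (Γ.signedCross (crossForm b k) x q e : ℝ) =
      Γ.length e * crossForm b k (realify (Γ.slope e)) -
        (Int.fract (crossForm b k (x (Γ.tgt e)) - crossForm b k q) -
          Int.fract (crossForm b k (x (Γ.src e)) - crossForm b k q)) := by
    intro e
    have h1 := crossForm_coe b k ⟨_, lift_tgt_sub_mem hx e⟩
    simp only [map_sub, map_add, map_smul, smul_eq_mul] at h1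
    have h2 : crossForm b k (x (Γ.tgt e)) - crossForm b k q = (crossForm b k (x (Γ.src e)) -
        crossForm b k q + Γ.length e * crossForm b k (realify (Γ.slope e))) +
          (crossInt b k ⟨_, lift_tgt_sub_mem hx e⟩ : ℤ) := by
      rw [← h1]; ring
    rw [h2, Int.fract_add_intCast, signedCross, Int.fract, Int.fract]
    push_cast
    ring
  push_cast
  simp only [h1, sub_mul, Finset.sum_sub_distrib]
  simp only [zsmul_eq_mul, mul_sub, Finset.sum_sub_distrib, mul_comm (_ : ℝ) (Int.fract _)] at h0
  rw [← Finset.sum_sub_distrib, ← Finset.sum_sub_distrib] at *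
  simp only [period, Fintype.linearCombination_apply, map_sum, map_zsmul, map_smul]
  rw [← sub_eq_zero, ← neg_eq_zero, ← h0, ← Finset.sum_sub_distrib, ← Finset.sum_neg_distrib]
  refine Finset.sum_congr rfl fun e _ => ?_
  simp only [smul_eq_mul, zsmul_eq_mul]
  ring

end TropCurve

/-! ### Local structure at the vertices -/

theorem sameRay_of_det2_eq_zero {a b : LatN} (h : det2 a b = 0) (hpos : 0 < a 0 * b 0 + a 1 * b 1) :
    SameRay ℤ a b := by
  simp only [det2] at h
  have ha : 0 < a 0 * a 0 + a 1 * a 1 := by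
    rcases eq_or_ne (a 0) 0 with h0 | h0
    · rcases eq_or_ne (a 1) 0 with h1 | h1
      · simp [h0, h1] at hpos
      · nlinarith [mul_self_pos.2 h1, mul_self_nonneg (a 0)]
    · nlinarith [mul_self_pos.2 h0, mul_self_nonneg (a 1)]
  refine Or.inr (Or.inr ⟨_, _, hpos, ha, ?_⟩)
  ext i
  fin_cases i
  · simp only [Fin.zero_eta, Pi.smul_apply, smul_eq_mul]
    linear_combination (a 1) * h
  · simp only [Fin.mk_one, Pi.smul_apply, smul_eq_mul]
    linear_combination (-a 0) * h

theorem det2_ne_zero_of_sum_eq_zero {a b c : LatN} (hsum : a + b + c = 0) (ha : a ≠ 0) (hb : b ≠ 0)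
    (hc : c ≠ 0) (hab : ¬ SameRay ℤ a b) (hac : ¬ SameRay ℤ a c) (hbc : ¬ SameRay ℤ b c) :
    det2 a b ≠ 0 := by
  intro h
  have pos : ∀ {x : LatN}, x ≠ 0 → 0 < x 0 * x 0 + x 1 * x 1 := by
    intro x hx
    by_contra hn
    refine hx ?_
    have h0 : x 0 * x 0 = 0 := by nlinarith [mul_self_nonneg (x 0), mul_self_nonneg (x 1)]
    have h1 : x 1 * x 1 = 0 := by nlinarith [mul_self_nonneg (x 0), mul_self_nonneg (x 1)]
    ext i
    fin_cases i
    · simpa using h0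
    · simpa using h1
  have hc' : c = -(a + b) := by rw [eq_neg_iff_add_eq_zero, add_comm]; exact hsum
  have h1 : det2 a c = 0 := by rw [hc', det2_neg_right, det2_add_right, det2_self, h]; simp
  have h2 : det2 b c = 0 := by
    rw [hc', det2_neg_right, det2_add_right, det2_self, det2_comm, h]; simp
  have k1 : a 0 * b 0 + a 1 * b 1 ≤ 0 := by
    by_contra hn; exact hab (sameRay_of_det2_eq_zero h (by linarith))
  have k2 : a 0 * c 0 + a 1 * c 1 ≤ 0 := by
    by_contra hn; exact hac (sameRay_of_det2_eq_zero h1 (by linarith))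
  have k3 : b 0 * c 0 + b 1 * c 1 ≤ 0 := by
    by_contra hn; exact hbc (sameRay_of_det2_eq_zero h2 (by linarith))
  have e0 : c 0 = -(a 0 + b 0) := by rw [hc']; rfl
  have e1 : c 1 = -(a 1 + b 1) := by rw [hc']; rfl
  have := pos hc
  have ha' := pos ha
  have hb' := pos hb
  rw [e0, e1] at this k2 k3
  simp only [det2] at h
  -- Put `A = |a|²`, `B = |b|²`, `t = -a·b`. Collinearity gives `A * B = t²`; the three rays being
  -- different gives `t ≥ 0`, `A ≥ t`, `B ≥ t`. Then `(A - t) * (B - t) ≥ 0` reads `t * |c|² ≤ 0`,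
  -- so `t = 0` and `A * B = 0`, a contradiction.
  obtain ⟨A, hA⟩ : ∃ A, A = a 0 * a 0 + a 1 * a 1 := ⟨_, rfl⟩
  obtain ⟨B, hB⟩ : ∃ B, B = b 0 * b 0 + b 1 * b 1 := ⟨_, rfl⟩
  obtain ⟨t, ht⟩ : ∃ t, t = -(a 0 * b 0 + a 1 * b 1) := ⟨_, rfl⟩
  have hAB : A * B = t * t := by
    rw [hA, hB, ht]; linear_combination (a 0 * b 1 - a 1 * b 0) * h
  have hA0 : 0 < A := by rw [hA]; exact ha'
  have hB0 : 0 < B := by rw [hB]; exact hb'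
  have ht0 : 0 ≤ t := by linarith
  have hAt : 0 ≤ A - t := by rw [hA, ht]; linarith
  have hBt : 0 ≤ B - t := by rw [hB, ht]; linarith
  have hc0 : 0 < A + B - 2 * t := by rw [hA, hB, ht]; linarith
  have h4 := mul_nonneg hAt hBt
  have h5 : t * (A + B - 2 * t) ≤ 0 := by linarith [mul_comm A t, mul_comm B t]
  rcases ht0.eq_or_lt with h6 | h6
  · rw [← h6] at hAB
    have := mul_pos hA0 hB0
    simp at hAB
    omega
  · have := mul_pos h6 hc0
    linarith

namespace TropCurve

variable {Λ : Submodule ℤ RealN} {Γ : TropCurve Λ}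

/-- The flow through a half-edge, pointing out of its vertex, of a `1`-chain. -/
def flagFlow {M : Type*} [Neg M] (z : Γ.E → M) (f : Γ.Flag) : M := if f.2 then -z f.1 else z f.1

theorem sum_flag {M : Type*} [AddCommMonoid M] (h : Γ.Flag → M) :
    ∑ f, h f = ∑ e, (h (e, false) + h (e, true)) := by
  rw [Fintype.sum_prod_type]
  exact Finset.sum_congr rfl fun e _ => by rw [Fintype.sum_bool, add_comm]

theorem vertex_false (e : Γ.E) : Flag.vertex (Γ := Γ) (e, false) = Γ.src e := rfl

theorem vertex_true (e : Γ.E) : Flag.vertex (Γ := Γ) (e, true) = Γ.tgt e := rfl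

theorem outSlope_false (e : Γ.E) : Flag.outSlope (Γ := Γ) (e, false) = Γ.slope e := rfl

theorem outSlope_true (e : Γ.E) : Flag.outSlope (Γ := Γ) (e, true) = -Γ.slope e := rfl

open Classical in
theorem sum_outSlope (v : Γ.V) : ∑ f : Γ.Flag, (if f.vertex = v then f.outSlope else 0) = 0 := by
  refine Eq.trans ?_ (Γ.balanced v)
  rw [sum_flag]
  refine Finset.sum_congr rfl fun e _ => ?_
  rw [vertex_false, vertex_true, outSlope_false, outSlope_true, sub_eq_add_neg]
  congr 1
  split_ifs <;> simp

open Classical in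
theorem graphBoundary_eq_neg_sum {R : Type*} [CommRing R] (z : Γ.E → R) (v : Γ.V) :
    graphBoundary R Γ.src Γ.tgt z v =
      -∑ f : Γ.Flag, (if f.vertex = v then flagFlow z f else 0) := by
  rw [graphBoundary_apply, sum_flag, ← Finset.sum_neg_distrib]
  refine Finset.sum_congr rfl fun e _ => ?_
  rw [vertex_false, vertex_true]
  simp only [flagFlow, if_true, Bool.false_eq_true, if_false]
  split_ifs <;> simp

/-- The half-edges at a trivalent vertex. -/
structure IsTripod (v : Γ.V) (f₁ f₂ f₃ : Γ.Flag) : Prop where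
  vertex_eq_iff : ∀ f : Γ.Flag, f.vertex = v ↔ f = f₁ ∨ f = f₂ ∨ f = f₃
  ne₁₂ : f₁ ≠ f₂
  ne₁₃ : f₁ ≠ f₃
  ne₂₃ : f₂ ≠ f₃
  det_ne_zero : det2 f₁.outSlope f₂.outSlope ≠ 0

theorem card_filter_vertex (v : Γ.V) [DecidablePred fun f : Γ.Flag => f.vertex = v] :
    (Finset.univ.filter fun f : Γ.Flag => f.vertex = v).card = Γ.valence v := by
  classical
  rw [valence, Nat.card_eq_fintype_card, Fintype.card_subtype]

theorem sum_at_of_vertex_eq_iff {M : Type*} [AddCommMonoid M] {v : Γ.V} {f₁ f₂ f₃ : Γ.Flag}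
    (h : ∀ f : Γ.Flag, f.vertex = v ↔ f = f₁ ∨ f = f₂ ∨ f = f₃)
    (ne₁₂ : f₁ ≠ f₂) (ne₁₃ : f₁ ≠ f₃) (ne₂₃ : f₂ ≠ f₃) (w : Γ.Flag → M)
    [DecidablePred fun f : Γ.Flag => f.vertex = v] :
    ∑ f : Γ.Flag, (if f.vertex = v then w f else 0) = w f₁ + w f₂ + w f₃ := by
  classical
  rw [← Finset.sum_filter]
  have : (Finset.univ.filter fun f : Γ.Flag => f.vertex = v) = {f₁, f₂, f₃} := by
    ext f; simp [h]
  rw [this, Finset.sum_insert (by simp [ne₁₂, ne₁₃]), Finset.sum_pair ne₂₃, add_assoc]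

theorem IsTripod.sum_eq {M : Type*} [AddCommMonoid M] {v : Γ.V} {f₁ f₂ f₃ : Γ.Flag}
    (h : IsTripod v f₁ f₂ f₃) (w : Γ.Flag → M) [DecidablePred fun f : Γ.Flag => f.vertex = v] :
    ∑ f : Γ.Flag, (if f.vertex = v then w f else 0) = w f₁ + w f₂ + w f₃ :=
  sum_at_of_vertex_eq_iff h.vertex_eq_iff h.ne₁₂ h.ne₁₃ h.ne₂₃ w

theorem IsTripod.sum_outSlope {v : Γ.V} {f₁ f₂ f₃ : Γ.Flag} (h : IsTripod v f₁ f₂ f₃) :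
    f₁.outSlope + f₂.outSlope + f₃.outSlope = 0 := by
  classical
  rw [← h.sum_eq, TropCurve.sum_outSlope]

theorem IsImmersion.outSlope_ne_zero (hΓ : Γ.IsImmersion) (f : Γ.Flag) : f.outSlope ≠ 0 := by
  have := hΓ.slope_ne_zero f.1
  unfold Flag.outSlope
  split_ifs
  · exact neg_ne_zero.2 this
  · exact this

theorem IsImmersion.exists_isTripod (hΓ : Γ.IsImmersion) {v : Γ.V} (hv : Γ.valence v = 3) :
    ∃ f₁ f₂ f₃, IsTripod v f₁ f₂ f₃ := by
  classical
  rw [← card_filter_vertex, Finset.card_eq_three] at hv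
  obtain ⟨f₁, f₂, f₃, h12, h13, h23, h⟩ := hv
  have hmem : ∀ f : Γ.Flag, f.vertex = v ↔ f = f₁ ∨ f = f₂ ∨ f = f₃ := fun f => by
    simpa using Finset.ext_iff.1 h f
  have e1 := (hmem f₁).2 (by simp)
  have e2 := (hmem f₂).2 (by simp)
  have e3 := (hmem f₃).2 (by simp)
  have hs := sum_at_of_vertex_eq_iff hmem h12 h13 h23 Flag.outSlope
  rw [TropCurve.sum_outSlope] at hs
  exact ⟨f₁, f₂, f₃, hmem, h12, h13, h23, det2_ne_zero_of_sum_eq_zero hs.symm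
    (hΓ.outSlope_ne_zero _) (hΓ.outSlope_ne_zero _) (hΓ.outSlope_ne_zero _)
    (hΓ.not_sameRay _ _ h12 (e1.trans e2.symm)) (hΓ.not_sameRay _ _ h13 (e1.trans e3.symm))
    (hΓ.not_sameRay _ _ h23 (e2.trans e3.symm))⟩

theorem IsTripod.vertexMult_eq {v : Γ.V} {f₁ f₂ f₃ : Γ.Flag} (h : IsTripod v f₁ f₂ f₃) :
    Γ.vertexMult v = (det2 f₁.outSlope f₂.outSlope).natAbs := by
  classical
  have h3 : f₃.outSlope = -(f₁.outSlope + f₂.outSlope) := by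
    rw [eq_neg_iff_add_eq_zero, add_comm]; exact h.sum_outSlope
  refine le_antisymm (Finset.sup_le fun f _ => ?_) ?_
  · split_ifs with hf
    · obtain ⟨h1, h2⟩ := hf
      rw [h.vertex_eq_iff] at h1 h2
      have := det2_comm f₁.outSlope f₂.outSlope
      rcases h1 with h1 | h1 | h1 <;> rcases h2 with h2 | h2 | h2 <;> rw [h1, h2] <;>
        (try simp only [h3, det2_neg_left, det2_neg_right, det2_add_left, det2_add_right, det2_self]) <;>
        omega
    · exact Nat.zero_le _
  · refine le_trans (le_of_eq ?_) (Finset.le_sup (f := fun f : Γ.Flag × Γ.Flag =>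
      if f.1.vertex = v ∧ f.2.vertex = v then (det2 f.1.outSlope f.2.outSlope).natAbs else 0)
      (Finset.mem_univ (f₁, f₂)))
    rw [if_pos ⟨(h.vertex_eq_iff _).2 (by simp), (h.vertex_eq_iff _).2 (by simp)⟩]

/-! ### Counting vertices and edges -/

theorem two_mul_card_edges : 2 * Fintype.card Γ.E = ∑ v, Γ.valence v := by
  classical
  have h1 : Fintype.card Γ.Flag = 2 * Fintype.card Γ.E := by
    rw [Fintype.card_prod, Fintype.card_bool, mul_comm]
  rw [← h1, ← Finset.card_univ, Finset.card_eq_sum_card_fiberwise (f := fun f : Γ.Flag => f.vertex)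
    (t := Finset.univ) (fun _ _ => Finset.mem_univ _)]
  exact Finset.sum_congr rfl fun v _ => card_filter_vertex v

theorem card_vertices_add_genus : Fintype.card Γ.V + Γ.genus = Fintype.card Γ.E + 1 := by
  have h := finrank_ker_graphBoundary_of_connected (R := ℤ) Γ.src Γ.tgt Γ.connected
  have h2 : Γ.H1 Set.univ = LinearMap.ker (graphBoundary ℤ Γ.src Γ.tgt) := by
    ext z
    exact ⟨fun hz => hz.1, fun hz => ⟨hz, fun e he => absurd (Set.mem_univ e) he⟩⟩
  rw [← h, genus, genusOn, h2, add_comm]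

open Classical in
/-- The vertices of valence two. -/
noncomputable def bivalent (Γ : TropCurve Λ) : Finset Γ.V :=
  Finset.univ.filter fun v => Γ.valence v = 2

theorem mem_bivalent {v : Γ.V} : v ∈ Γ.bivalent ↔ Γ.valence v = 2 := by simp [bivalent]

theorem IsSimpleMarked.card_vertices {n : ℕ} {p : Fin n → Γ.V} (h : Γ.IsSimpleMarked p) :
    Fintype.card Γ.V + 2 = 2 * Γ.genus + Γ.bivalent.card ∧
      Fintype.card Γ.E + 3 = 3 * Γ.genus + Γ.bivalent.card := by
  classical
  have h1 := two_mul_card_edges (Γ := Γ)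
  have h2 := card_vertices_add_genus (Γ := Γ)
  have h3 : ∑ v, Γ.valence v + Γ.bivalent.card = 3 * Fintype.card Γ.V := by
    rw [bivalent, Finset.card_filter, ← Finset.sum_add_distrib, mul_comm, ← smul_eq_mul,
      ← Finset.card_univ, ← Finset.sum_const]
    refine Finset.sum_congr rfl fun v _ => ?_
    rcases h.valence_eq v with h | ⟨h, -⟩ <;> simp [h]
  omega

/-! ### Retractions of the complement of the marked points -/

/-- The edges whose two ends are not marked. -/
def innerEdges {n : ℕ} (p : Fin n → Γ.V) : Set Γ.E :=
  {e | Γ.src e ∉ Set.range p ∧ Γ.tgt e ∉ Set.range p}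

/-- The cycles supported on the edges of `S.2` with both ends in `S.1`. -/
def closedCycles (S : Set Γ.V × Set Γ.E) : Set (Γ.E → ℤ) :=
  {z | Γ.boundary z = 0 ∧ ∀ e, ¬ (e ∈ S.2 ∧ Γ.src e ∈ S.1 ∧ Γ.tgt e ∈ S.1) → z e = 0}

theorem ends_mem_iff (W : Set Γ.V) (f : Γ.Flag) :
    (Γ.src f.1 ∈ W ∧ Γ.tgt f.1 ∈ W) ↔ (f.vertex ∈ W ∧ f.opp.vertex ∈ W) := by
  obtain ⟨e, i⟩ := f
  cases i
  · exact Iff.rfl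
  · exact and_comm

/-- Intermediate stages may contain open edges, so cycles are tested on edges with both ends
present. Removing an open edge does not affect these, and at a leaf the boundary is, up to sign, the
coefficient of the only edge left there, which must vanish. -/
theorem Retraction.closedCycles_eq {S T : Set Γ.V × Set Γ.E} (h : Γ.Retraction S T) :
    closedCycles S = closedCycles T := by
  classical
  cases h with
  | openEdge W F f hf hv ho =>
    ext z
    refine and_congr_right fun _ => forall_congr' fun e => imp_congr_left (not_congr ?_)
    simp only [Set.mem_sdiff, Set.mem_singleton_iff]
    constructor
    · rintro ⟨h1, h2⟩
      refine ⟨⟨h1, ?_⟩, h2⟩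
      rintro rfl
      exact ho ((ends_mem_iff W f).1 h2).2
    · rintro ⟨⟨h1, -⟩, h2⟩
      exact ⟨h1, h2⟩
  | leaf W F f hf hv ho hleaf =>
    ext z
    refine and_congr_right fun hz => ?_
    constructor
    · intro hF e he
      by_cases h1 : e ∈ F ∧ Γ.src e ∈ W ∧ Γ.tgt e ∈ W
      swap
      · exact hF e h1
      have hfz : z f.1 = 0 := by
        have h2 := congrFun hz f.vertex
        rw [boundary_eq, graphBoundary_eq_neg_sum, Pi.zero_apply, neg_eq_zero,
          Finset.sum_eq_single f] at h2
        · rw [if_pos rfl, flagFlow] at h2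
          split_ifs at h2
          · exact neg_eq_zero.1 h2
          · exact h2
        · intro f' _ hf'
          split_ifs with h3
          · have : z f'.1 = 0 := by
              by_contra h4
              have h5 := not_imp_comm.1 (hF f'.1) h4
              exact hf' (hleaf f' h5.1 h3)
            simp [flagFlow, this]
          · rfl
        · simp
      by_cases hef : e = f.1
      · rw [hef, hfz]
      · exfalso
        refine he ⟨⟨h1.1, hef⟩, ⟨h1.2.1, ?_⟩, ⟨h1.2.2, ?_⟩⟩
        · intro h2
          exact hef (congrArg Prod.fst (hleaf (e, false) h1.1 h2))
        · intro h2
          exact hef (congrArg Prod.fst (hleaf (e, true) h1.1 h2))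
    · intro hF e he
      exact hF e fun h => he ⟨h.1.1, h.2.1.1, h.2.2.1⟩

theorem ComplementRetractsOn.H1_eq {n : ℕ} {p : Fin n → Γ.V} {W : Set Γ.V} {F : Set Γ.E}
    (h : Γ.ComplementRetractsOn p W F) : Γ.H1 F = Γ.H1 (innerEdges p) := by
  have key : ∀ {S T}, Relation.ReflTransGen Γ.Retraction S T →
      closedCycles S = closedCycles T := by
    intro S T hST
    induction hST with
    | refl => rfl
    | tail _ h ih => exact ih.trans h.closedCycles_eq
  have h1 := key h.retracts
  refine SetLike.coe_injective ?_
  have h2 : (Γ.H1 F : Set (Γ.E → ℤ)) = closedCycles (W, F) := by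
    ext z
    refine and_congr_right fun _ => forall_congr' fun e => imp_congr_left (not_congr ?_)
    exact ⟨fun he => ⟨he, h.src_mem e he, h.tgt_mem e he⟩, fun he => he.1⟩
  rw [h2, ← h1]
  ext z
  refine and_congr_right fun _ => forall_congr' fun e => imp_congr_left (not_congr ?_)
  exact ⟨fun he => he.2, fun he => ⟨trivial, he⟩⟩

theorem homologyIndex_congr {F F' : Set Γ.E} (h : Γ.H1 F = Γ.H1 F') :
    Γ.homologyIndex F = Γ.homologyIndex F' := by
  unfold homologyIndex
  congr 2
  ext l
  constructor
  · rintro ⟨z, rfl⟩; exact ⟨⟨z.1, by rw [← h]; exact z.2⟩, rfl⟩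
  · rintro ⟨z, rfl⟩; exact ⟨⟨z.1, by rw [h]; exact z.2⟩, rfl⟩

theorem genusOn_congr {F F' : Set Γ.E} (h : Γ.H1 F = Γ.H1 F') : Γ.genusOn F = Γ.genusOn F' := by
  unfold genusOn
  rw [h]

/-- An edge with a marked end retracts on its other, unmarked end. The hypothesis excludes an edge
with two marked ends, whose interior would be a component without vertex. -/
theorem exists_complementRetractsOn {n : ℕ} {p : Fin n → Γ.V}
    (h : ∀ e, Γ.src e ∉ Set.range p ∨ Γ.tgt e ∉ Set.range p) :
    ∃ W F, Γ.ComplementRetractsOn p W F := by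
  classical
  refine ⟨(Set.range p)ᶜ, innerEdges p, fun e he => he.1, fun e he => he.2, ?_⟩
  have key : ∀ S : Finset Γ.E, (∀ e ∈ S, e ∉ innerEdges p) →
      Relation.ReflTransGen Γ.Retraction ((Set.range p)ᶜ, Set.univ)
        ((Set.range p)ᶜ, (S : Set Γ.E)ᶜ) := by
    intro S
    induction S using Finset.induction_on with
    | empty => intro _; simpa using Relation.ReflTransGen.refl
    | insert e S he ih =>
      intro hS
      have h1 := ih fun e' he' => hS e' (Finset.mem_insert_of_mem he')
      have h2 : (((insert e S : Finset Γ.E) : Set Γ.E))ᶜ = (S : Set Γ.E)ᶜ \ {e} := by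
        ext x; simp [and_comm, not_or]
      have h3 : ∃ i : Bool, Flag.vertex (Γ := Γ) (e, i) ∈ (Set.range p)ᶜ ∧
          Flag.vertex (Γ := Γ) (Flag.opp (Γ := Γ) (e, i)) ∉ (Set.range p)ᶜ := by
        have h4 := hS e (Finset.mem_insert_self _ _)
        rcases h e with h5 | h5
        · exact ⟨false, h5, fun h6 => h4 ⟨h5, h6⟩⟩
        · exact ⟨true, h5, fun h6 => h4 ⟨h6, h5⟩⟩
      obtain ⟨i, hi, hi'⟩ := h3
      rw [h2]
      exact h1.tail (Retraction.openEdge _ _ (e, i) (by simpa using he) hi hi')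
  have := key (Finset.univ.filter fun e => e ∉ innerEdges p) (by simp)
  convert! this
  ext e
  simp

end TropCurve

/-! ### Indices of the images of linear forms -/

theorem detForm_apply (v y : LatN) : detForm v y = det2 v y := rfl

theorem range_detForm (s : LatN) :
    (LinearMap.range (detForm s)).toAddSubgroup = AddSubgroup.zmultiples (Int.gcd (s 0) (s 1) : ℤ) := by
  ext m
  rw [Int.mem_zmultiples_iff]
  constructor
  · rintro ⟨y, rfl⟩
    exact dvd_sub ((Int.gcd_dvd_left _ _).mul_right _) ((Int.gcd_dvd_right _ _).mul_right _)
  · rintro ⟨m, rfl⟩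
    refine ⟨![-Int.gcdB (s 0) (s 1) * m, Int.gcdA (s 0) (s 1) * m], ?_⟩
    rw [Int.gcd_eq_gcd_ab, detForm_apply]
    simp only [det2, Matrix.cons_val_zero, Matrix.cons_val_one]
    ring

/-- The image is generated by one integer; the two hypotheses say that `d` has the universal
property of the gcd of the values. -/
theorem index_range_toAddSubgroup_int {M : Type*} [AddCommGroup M] (f : M →ₗ[ℤ] ℤ) {d : ℕ}
    (h1 : ∀ x, (d : ℤ) ∣ f x) (h2 : ∀ m : ℤ, (∀ x, m ∣ f x) → m ∣ d) :
    (LinearMap.range f).toAddSubgroup.index = d := by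
  obtain ⟨m, hm⟩ := (IsPrincipalIdealRing.principal (LinearMap.range f : Ideal ℤ)).principal
  have h3 : (LinearMap.range f).toAddSubgroup = AddSubgroup.zmultiples m := by
    rw [← Ideal.span_singleton_toAddSubgroup_eq_zmultiples]
    exact congrArg Submodule.toAddSubgroup hm
  rw [h3, Int.index_zmultiples]
  have h4 : m ∣ d := h2 m fun x => by
    have : f x ∈ (LinearMap.range f).toAddSubgroup := ⟨x, rfl⟩
    rwa [h3, Int.mem_zmultiples_iff] at this
  have h5 : (d : ℤ) ∣ m := by
    have : m ∈ (LinearMap.range f).toAddSubgroup := by rw [h3, Int.mem_zmultiples_iff]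
    obtain ⟨x, rfl⟩ := this
    exact h1 x
  have := Int.natAbs_eq_of_dvd_dvd h4 h5
  simpa using this

theorem det_pi_detForm (x y : LatN) :
    LinearMap.det (LinearMap.pi ![detForm x, detForm y] : LatN →ₗ[ℤ] LatN) = det2 x y := by
  rw [← LinearMap.det_toMatrix', Matrix.det_fin_two]
  simp [LinearMap.toMatrix'_apply, detForm_apply, det2]
  ring

namespace TropCurve

variable {Λ : Submodule ℤ RealN} {Γ : TropCurve Λ}

theorem sum_flag_fiberwise {M : Type*} [AddCommMonoid M] [DecidableEq Γ.V] (h : Γ.Flag → M) :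
    ∑ f, h f = ∑ v, ∑ f : Γ.Flag, if f.vertex = v then h f else 0 := by
  rw [Finset.sum_comm]
  simp

/-! ### Moments as coordinates at the vertices -/

section Moments

variable {n : ℕ} (p : Fin n → Γ.V) (a c : Γ.V → Γ.Flag)

/-- The coordinate forms of the plane lattice. -/
abbrev latProj (i : Fin 2) : LatN →ₗ[ℤ] ℤ := LinearMap.proj i

open Classical in
/-- The coordinates at a vertex: the moments of two half-edges at an unmarked vertex. -/
noncomputable def vertexMap (v : Γ.V) : LatN →ₗ[ℤ] LatN :=
  if v ∈ Set.range p then LinearMap.id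
  else LinearMap.pi ![detForm (a v).outSlope, detForm (c v).outSlope]

open Classical in
/-- The moment of a half-edge in the coordinates `vertexMap`. -/
noncomputable def flagForm (f : Γ.Flag) : LatN →ₗ[ℤ] ℤ :=
  if f.vertex ∈ Set.range p then detForm f.outSlope
  else if f = a f.vertex then latProj 0
  else if f = c f.vertex then latProj 1
  else -(latProj 0 + latProj 1)

/-- The moments of all the half-edges. -/
noncomputable def flagMap : (Γ.V → LatN) →ₗ[ℤ] (Γ.Flag → ℤ) :=
  LinearMap.pi fun f => flagForm p a c f ∘ₗ LinearMap.proj f.vertex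

/-- The change of coordinates at all the vertices. -/
noncomputable def coordMap : (Γ.V → LatN) →ₗ[ℤ] (Γ.V → LatN) :=
  LinearMap.pi fun v => vertexMap p a c v ∘ₗ LinearMap.proj v

/-- The coordinate forms of the space of functions on the half-edges. -/
abbrev flagProj (f : Γ.Flag) : (Γ.Flag → ℤ) →ₗ[ℤ] ℤ := LinearMap.proj f

open Classical in
/-- The moment of an edge at its source, for the orientation crossing `l` positively, in terms of
the moments of the half-edges. -/
noncomputable def flagMoment (l : Λ) (e : Γ.E) : (Γ.Flag → ℤ) →ₗ[ℤ] ℤ :=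
  if 0 < det2 (realify (Γ.slope e)) (l : RealN) then flagProj (e, false) else flagProj (e, true)

/-- The map on the moments of half-edges induced by the evaluation map. -/
noncomputable def flagEval (b : Module.Basis (Fin 2) ℤ Λ) (q : Fin 2 → RealN) :
    (Γ.Flag → ℤ) →ₗ[ℤ] ((Γ.E → ℤ) × (Λ →ₗ[ℤ] ℤ)) :=
  LinearMap.prod
    (LinearMap.pi fun e => -(flagProj (e, true) + flagProj (e, false)))
    ((b.constr ℤ).toLinearMap ∘ₗ
      LinearMap.pi fun k => ∑ e, Γ.crossings (q k) (b k) e • flagMoment (b k) e)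

/-- The evaluation map in the coordinates `coordMap`. -/
noncomputable def coordEval (b : Module.Basis (Fin 2) ℤ Λ) (q : Fin 2 → RealN) :
    (Γ.V → LatN) →ₗ[ℤ] ((Γ.E → ℤ) × (Fin n → LatN) × (Λ →ₗ[ℤ] ℤ)) :=
  LinearMap.prod (LinearMap.fst ℤ _ _ ∘ₗ flagEval b q ∘ₗ flagMap p a c)
    (LinearMap.prod (LinearMap.pi fun i => LinearMap.proj (p i))
      (LinearMap.snd ℤ _ _ ∘ₗ flagEval b q ∘ₗ flagMap p a c))

/-- The determinant with the slope of an edge, on the quotient by the lattice of that edge. -/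
noncomputable def edgeDet (e : Γ.E) : (LatN ⧸ Γ.edgeLattice e) →ₗ[ℤ] ℤ :=
  (Γ.edgeLattice e).liftQ (detForm (Γ.slope e)) le_rfl

variable (Γ) (n) in
/-- The map replacing the class of a vector modulo an edge by its determinant with the slope of
the edge. -/
noncomputable def targetDet :
    (((e : Γ.E) → LatN ⧸ Γ.edgeLattice e) × (Fin n → LatN) × (Λ →ₗ[ℤ] ℤ)) →ₗ[ℤ]
      ((Γ.E → ℤ) × (Fin n → LatN) × (Λ →ₗ[ℤ] ℤ)) :=
  LinearMap.prodMap (LinearMap.pi fun e => edgeDet e ∘ₗ LinearMap.proj e) LinearMap.id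

variable (Γ) (n) in
/-- The sum of the coordinates attached to the edges. -/
noncomputable def edgeSum : ((Γ.E → ℤ) × (Fin n → LatN) × (Λ →ₗ[ℤ] ℤ)) →ₗ[ℤ] ℤ :=
  coordSum ℤ Γ.E ∘ₗ LinearMap.fst ℤ _ _

variable {p a c} {d : Γ.V → Γ.Flag}

/-- By balancing, the moment of the third half-edge at a trivalent vertex is minus the sum of the
other two. Hence all moments are integral forms in the coordinates `vertexMap`, although that map is
not unimodular. -/
theorem flagForm_comp_vertexMap (ht : ∀ v, v ∉ Set.range p → IsTripod v (a v) (c v) (d v))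
    (f : Γ.Flag) (y : LatN) :
    flagForm p a c f (vertexMap p a c f.vertex y) = detForm f.outSlope y := by
  unfold flagForm vertexMap
  split_ifs with h1 h2 h3
  · rfl
  · simp [← h2]
  · simp [← h3]
  · have h := ht _ h1
    have h4 : f = d f.vertex := by
      rcases (h.vertex_eq_iff f).1 rfl with h5 | h5 | h5
      · exact absurd h5 h2
      · exact absurd h5 h3
      · exact h5
    have h5 : f.outSlope = -((a f.vertex).outSlope + (c f.vertex).outSlope) := by
      rw [eq_neg_iff_add_eq_zero, add_comm]
      have := h.sum_outSlope
      rwa [← h4] at this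
    rw [h5]
    simp [detForm_apply, det2_neg_left, det2_add_left]

theorem flagMap_coordMap (ht : ∀ v, v ∉ Set.range p → IsTripod v (a v) (c v) (d v))
    (φ : Γ.V → LatN) (f : Γ.Flag) :
    flagMap p a c (coordMap p a c φ) f = detForm f.outSlope (φ f.vertex) :=
  flagForm_comp_vertexMap ht f (φ f.vertex)

theorem flagMap_apply_of_marked {f : Γ.Flag} (hf : f.vertex ∈ Set.range p) (y : Γ.V → LatN) :
    flagMap p a c y f = detForm f.outSlope (y f.vertex) := by
  change flagForm p a c f (y f.vertex) = _
  rw [flagForm, if_pos hf]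

theorem flagMap_of_tripod {v : Γ.V} (hv : v ∉ Set.range p) (h : IsTripod v (a v) (c v) (d v))
    (y : Γ.V → LatN) : flagMap p a c y (a v) = y v 0 ∧ flagMap p a c y (c v) = y v 1 ∧
      flagMap p a c y (d v) = -(y v 0 + y v 1) := by
  have h1 := (h.vertex_eq_iff (a v)).2 (by simp)
  have h2 := (h.vertex_eq_iff (c v)).2 (by simp)
  have h3 := (h.vertex_eq_iff (d v)).2 (by simp)
  refine ⟨?_, ?_, ?_⟩
  · change flagForm p a c (a v) (y (a v).vertex) = _
    rw [flagForm, h1, if_neg hv, if_pos rfl]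
    rfl
  · change flagForm p a c (c v) (y (c v).vertex) = _
    rw [flagForm, h2, if_neg hv, if_neg h.ne₁₂.symm, if_pos rfl]
    rfl
  · change flagForm p a c (d v) (y (d v).vertex) = _
    rw [flagForm, h3, if_neg hv, if_neg h.ne₁₃.symm, if_neg h.ne₂₃.symm]
    rfl

open Classical in
theorem sum_flagMap_at (ht : ∀ v, v ∉ Set.range p → IsTripod v (a v) (c v) (d v))
    (y : Γ.V → LatN) (v : Γ.V) :
    ∑ f : Γ.Flag, (if f.vertex = v then flagMap p a c y f else 0) = 0 := by
  by_cases hv : v ∈ Set.range p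
  · have h1 : ∀ f : Γ.Flag, (if f.vertex = v then flagMap p a c y f else 0) =
        det2 (if f.vertex = v then f.outSlope else 0) (y v) := by
      intro f
      split_ifs with h
      · rw [flagMap_apply_of_marked (h ▸ hv), h]; rfl
      · rw [det2_zero_left]
    have h2 : ∀ g : Γ.Flag → LatN, ∑ f, det2 (g f) (y v) = det2 (∑ f, g f) (y v) := by
      intro g
      simp only [det2, Finset.sum_sub_distrib, Finset.sum_mul, Finset.sum_apply]
    simp only [h1]
    rw [h2, sum_outSlope, det2_zero_left]
  · have h := ht v hv
    obtain ⟨h1, h2, h3⟩ := flagMap_of_tripod hv h y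
    rw [h.sum_eq, h1, h2, h3]
    ring

/-- At an unmarked vertex the values on the first two half-edges are taken as coordinates, and the
sum condition forces the third. -/
theorem exists_flagMap_eq (ht : ∀ v, v ∉ Set.range p → IsTripod v (a v) (c v) (d v))
    (w : Γ.Flag → ℤ) (h0 : ∀ f : Γ.Flag, f.vertex ∈ Set.range p → w f = 0)
    (h1 : ∀ v, v ∉ Set.range p → w (a v) + w (c v) + w (d v) = 0) :
    ∃ y : Γ.V → LatN, (∀ i, y (p i) = 0) ∧ flagMap p a c y = w := by
  classical
  refine ⟨fun v => if v ∈ Set.range p then 0 else ![w (a v), w (c v)], fun i => ?_, ?_⟩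
  · simp
  · ext f
    by_cases hf : f.vertex ∈ Set.range p
    · rw [flagMap_apply_of_marked hf, if_pos hf, h0 f hf, map_zero]
    · have h := ht _ hf
      obtain ⟨h2, h3, h4⟩ := flagMap_of_tripod hf h
        (fun v => if v ∈ Set.range p then 0 else ![w (a v), w (c v)])
      simp only [if_neg hf, Matrix.cons_val_zero, Matrix.cons_val_one] at h2 h3 h4
      rcases (h.vertex_eq_iff f).1 rfl with h5 | h5 | h5
      · rw [h5, ← h5, h5, h2]
      · rw [h5, ← h5, h5, h3]
      · rw [h5, ← h5, h5, h4]
        linarith [h1 _ hf]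

theorem eq_zero_of_flagMap_eq_zero (ht : ∀ v, v ∉ Set.range p → IsTripod v (a v) (c v) (d v))
    {y : Γ.V → LatN} (h0 : ∀ i, y (p i) = 0) (h : flagMap p a c y = 0) : y = 0 := by
  ext v i
  by_cases hv : v ∈ Set.range p
  · obtain ⟨j, rfl⟩ := hv
    rw [h0]
    rfl
  · obtain ⟨h1, h2, -⟩ := flagMap_of_tripod hv (ht v hv) y
    rw [h] at h1 h2
    fin_cases i
    · exact h1.symm
    · exact h2.symm

/-- This factorization separates the three sources of the multiplicity: `targetDet` carries the
weights, `coordMap` the vertex multiplicities, and `coordEval` the homology. -/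
theorem targetDet_evalMap (ht : ∀ v, v ∉ Set.range p → IsTripod v (a v) (c v) (d v))
    (b : Module.Basis (Fin 2) ℤ Λ) (q : Fin 2 → RealN) :
    targetDet Γ n ∘ₗ Γ.evalMap p b q = coordEval p a c b q ∘ₗ coordMap p a c := by
  refine LinearMap.ext fun φ => Prod.ext ?_ (Prod.ext ?_ ?_)
  · ext e
    change detForm (Γ.slope e) (φ (Γ.tgt e) - φ (Γ.src e)) =
      -(flagMap p a c (coordMap p a c φ) (e, true) + flagMap p a c (coordMap p a c φ) (e, false))
    rw [flagMap_coordMap ht, flagMap_coordMap ht, vertex_true, vertex_false, outSlope_true,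
      outSlope_false]
    simp only [detForm_apply, det2_neg_left, det2_sub_right]
    ring
  · ext i : 1
    change φ (p i) = vertexMap p a c (p i) (φ (p i))
    rw [vertexMap, if_pos (Set.mem_range_self i)]
    rfl
  · change (b.constr ℤ) (fun k => Γ.momentSum (q k) (b k) φ) =
      (b.constr ℤ) (fun k => (∑ e, Γ.crossings (q k) (b k) e • flagMoment (b k) e)
        (flagMap p a c (coordMap p a c φ)))
    congr 1
    ext k
    rw [momentSum, LinearMap.sum_apply, LinearMap.sum_apply]
    refine Finset.sum_congr rfl fun e _ => ?_
    rw [LinearMap.smul_apply, LinearMap.smul_apply, momentForm, flagMoment]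
    congr 1
    split_ifs
    · exact (flagMap_coordMap ht φ (e, false)).symm
    · exact (flagMap_coordMap ht φ (e, true)).symm

/-- Each edge coordinate is minus the sum of the moments of its two halves. Regrouped by vertices,
the total is zero because the moments at each vertex sum to zero. -/
theorem edgeSum_coordEval (ht : ∀ v, v ∉ Set.range p → IsTripod v (a v) (c v) (d v))
    (b : Module.Basis (Fin 2) ℤ Λ) (q : Fin 2 → RealN) (y : Γ.V → LatN) :
    edgeSum Γ n (coordEval p a c b q y) = 0 := by
  classical
  change coordSum ℤ Γ.E (fun e => -(flagMap p a c y (e, true) + flagMap p a c y (e, false))) = 0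
  rw [coordSum_apply, Finset.sum_neg_distrib, neg_eq_zero]
  simp only [add_comm (flagMap p a c y (_, true))]
  rw [← sum_flag, sum_flag_fiberwise]
  exact Finset.sum_eq_zero fun v _ => sum_flagMap_at ht y v

theorem injective_edgeDet (e : Γ.E) : Function.Injective (edgeDet e) := by
  rw [← LinearMap.ker_eq_bot]
  exact Submodule.ker_liftQ_eq_bot' _ _ rfl

theorem injective_targetDet : Function.Injective (targetDet Γ n) := by
  rintro ⟨x, x'⟩ ⟨y, y'⟩ h
  have h1 := congrArg Prod.fst h
  have h2 := congrArg Prod.snd h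
  refine Prod.ext (funext fun e => injective_edgeDet e ?_) h2
  exact congrFun h1 e

theorem index_range_targetDet :
    (LinearMap.range (targetDet Γ n)).toAddSubgroup.index = ∏ e, Γ.weight e := by
  have h : (LinearMap.range (targetDet Γ n)).toAddSubgroup =
      (AddSubgroup.pi Set.univ fun e => (LinearMap.range (detForm (Γ.slope e))).toAddSubgroup).prod
        (⊤ : AddSubgroup ((Fin n → LatN) × (Λ →ₗ[ℤ] ℤ))) := by
    ext ⟨x, x'⟩
    constructor
    · rintro ⟨⟨y, y'⟩, h⟩
      refine ⟨fun e _ => ?_, trivial⟩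
      obtain ⟨z, hz⟩ := Submodule.mkQ_surjective _ (y e)
      refine ⟨z, ?_⟩
      rw [← congrFun (congrArg Prod.fst h) e]
      change _ = edgeDet e (y e)
      rw [← hz]
      rfl
    · rintro ⟨h, -⟩
      choose y hy using fun e => h e trivial
      exact ⟨(fun e => Submodule.Quotient.mk (y e), x'), Prod.ext (funext hy) rfl⟩
  rw [h, AddSubgroup.index_prod, AddSubgroup.index_pi, AddSubgroup.index_top, mul_one]
  refine Finset.prod_congr rfl fun e _ => ?_
  rw [range_detForm, Int.index_zmultiples]
  rfl

/-- The coordinate of an edge takes exactly the multiples of its weight, so the sum takes the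
multiples of the gcd. The factor `weightGcd` has no other origin. -/
theorem index_range_edgeSum_targetDet :
    (LinearMap.range (edgeSum Γ n ∘ₗ targetDet Γ n)).toAddSubgroup.index = Γ.weightGcd := by
  classical
  have hval : ∀ x, (edgeSum Γ n ∘ₗ targetDet Γ n) x = ∑ e, edgeDet e (x.1 e) := fun x =>
    coordSum_apply _
  have hw : ∀ e (y : LatN ⧸ Γ.edgeLattice e), (Γ.weight e : ℤ) ∣ edgeDet e y := by
    intro e y
    obtain ⟨z, rfl⟩ := Submodule.mkQ_surjective _ y
    rw [← Int.mem_zmultiples_iff]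
    have := range_detForm (Γ.slope e)
    rw [weight, ← this]
    exact ⟨z, rfl⟩
  refine index_range_toAddSubgroup_int _ (fun x => ?_) fun m hm => ?_
  · rw [hval]
    exact Finset.dvd_sum fun e _ => (Int.natCast_dvd_natCast.2
      (Finset.gcd_dvd (Finset.mem_univ e))).trans (hw e _)
  · rw [← Int.natAbs_dvd, Int.natCast_dvd_natCast]
    refine Finset.dvd_gcd fun e _ => ?_
    rw [← Int.natCast_dvd_natCast, Int.natAbs_dvd]
    have h : (Γ.weight e : ℤ) ∈ (LinearMap.range (detForm (Γ.slope e))).toAddSubgroup := by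
      rw [range_detForm, Int.mem_zmultiples_iff]; rfl
    obtain ⟨y, hy⟩ := h
    have h2 := hm (Pi.single e (Submodule.Quotient.mk y), 0)
    rw [hval, Finset.sum_eq_single e] at h2
    · dsimp only at h2
      rw [Pi.single_eq_same] at h2
      rw [← hy]
      exact h2
    · intro e' _ he'
      simp [Pi.single_eq_of_ne he']
    · simp

theorem det_coordMap : (LinearMap.det (coordMap p a c)) = ∏ v, LinearMap.det (vertexMap p a c v) :=
  LinearMap.det_pi _

theorem natAbs_det_coordMap (ht : ∀ v, v ∉ Set.range p → IsTripod v (a v) (c v) (d v))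
    (hval : ∀ v, Γ.valence v = 3 ↔ v ∉ Set.range p) :
    (LinearMap.det (coordMap p a c)).natAbs = Γ.usualMult := by
  classical
  have h : (∏ v, LinearMap.det (vertexMap p a c v)).natAbs =
      ∏ v, (LinearMap.det (vertexMap p a c v)).natAbs := map_prod Int.natAbsHom _ _
  rw [det_coordMap, h, usualMult, Finset.prod_filter]
  refine Finset.prod_congr rfl fun v _ => ?_
  by_cases hv : v ∈ Set.range p
  · rw [if_neg (fun h => (hval v).1 h hv), vertexMap, if_pos hv, LinearMap.det_id]
    rfl
  · rw [if_pos ((hval v).2 hv), vertexMap, if_neg hv, det_pi_detForm, (ht v hv).vertexMult_eq]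

theorem usualMult_ne_zero (ht : ∀ v, v ∉ Set.range p → IsTripod v (a v) (c v) (d v))
    (hval : ∀ v, Γ.valence v = 3 ↔ v ∉ Set.range p) : Γ.usualMult ≠ 0 := by
  classical
  rw [usualMult, Finset.prod_ne_zero_iff]
  intro v hv
  have h := ht v ((hval v).1 (Finset.mem_filter.1 hv).2)
  rw [h.vertexMult_eq]
  exact Int.natAbs_ne_zero.2 h.det_ne_zero

end Moments

end TropCurve

/-! ### Cycles avoiding the marked points and the index of the evaluation map -/

namespace TropCurve

variable {Λ : Submodule ℤ RealN} {Γ : TropCurve Λ} {n : ℕ} {p : Fin n → Γ.V}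
  {a c d : Γ.V → Γ.Flag}

/-- Opposite moments on the two halves of every edge define a chain. It is a cycle because moments
sum to zero at each vertex, and it vanishes on edges touching a marked point because the moments
there are zero. -/
theorem mem_H1_of_flagMap (ht : ∀ v, v ∉ Set.range p → IsTripod v (a v) (c v) (d v))
    {y : Γ.V → LatN} (h0 : ∀ i, y (p i) = 0)
    (h1 : ∀ e, flagMap p a c y (e, true) + flagMap p a c y (e, false) = 0) :
    ∃ z ∈ Γ.H1 (innerEdges p), flagFlow z = flagMap p a c y := by
  classical
  have hz : flagFlow (fun e => flagMap p a c y (e, false)) = flagMap p a c y := by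
    ext ⟨e, i⟩
    cases i
    · rfl
    · exact (eq_neg_of_add_eq_zero_left (h1 e)).symm
  have hm : ∀ f : Γ.Flag, f.vertex ∈ Set.range p → flagMap p a c y f = 0 := by
    intro f hf
    rw [flagMap_apply_of_marked hf]
    obtain ⟨i, hi⟩ := hf
    rw [← hi, h0, map_zero]
  refine ⟨fun e => flagMap p a c y (e, false), ⟨?_, fun e he => ?_⟩, hz⟩
  · ext v
    rw [boundary_eq, graphBoundary_eq_neg_sum, hz, sum_flagMap_at ht]
    rfl
  · rw [innerEdges, Set.mem_ofPred_eq, not_and_or, not_not, not_not] at he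
    rcases he with he | he
    · exact hm (e, false) he
    · have := h1 e
      rwa [hm (e, true) he, zero_add] at this

theorem flagFlow_eq_zero_of_marked {z : Γ.E → ℤ} (hz : z ∈ Γ.H1 (innerEdges p)) {f : Γ.Flag}
    (hf : f.vertex ∈ Set.range p) : flagFlow z f = 0 := by
  have : z f.1 = 0 := hz.2 _ fun h => by
    obtain ⟨e, i⟩ := f
    cases i
    · exact h.1 hf
    · exact h.2 hf
  simp [flagFlow, this]

theorem exists_flagMap_eq_flagFlow (ht : ∀ v, v ∉ Set.range p → IsTripod v (a v) (c v) (d v))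
    {z : Γ.E → ℤ} (hz : z ∈ Γ.H1 (innerEdges p)) :
    ∃ y : Γ.V → LatN, (∀ i, y (p i) = 0) ∧ flagMap p a c y = flagFlow z := by
  classical
  refine exists_flagMap_eq ht _ (fun f hf => flagFlow_eq_zero_of_marked hz hf) fun v hv => ?_
  have := congrFun hz.1 v
  rwa [boundary_eq, graphBoundary_eq_neg_sum, (ht v hv).sum_eq, Pi.zero_apply, neg_eq_zero] at this

/-- For the flow of a cycle, the orientation convention in the moment sum produces the signs of the
crossings, so the sum is the intersection number of the cycle with the loop. -/
theorem flagEval_flagFlow [DiscreteTopology Λ] [IsZLattice ℝ Λ] {b : Module.Basis (Fin 2) ℤ Λ}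
    {q : Fin 2 → RealN} (hq : ∀ k, Γ.LoopTransverse (q k) (b k)) {z : Γ.E → ℤ}
    (hz : Γ.boundary z = 0) : flagEval b q (flagFlow z) =
      (0, b.constr ℤ fun k => crossInt b k ⟨Γ.period z, Γ.period_mem hz⟩) := by
  classical
  refine Prod.ext ?_ ?_
  · ext e
    change -(-z e + z e) = 0
    ring
  · change (b.constr ℤ) (fun k => (∑ e, Γ.crossings (q k) (b k) e • flagMoment (b k) e)
        (flagFlow z)) = _
    congr 1
    ext k
    choose x hx using fun v => Submodule.Quotient.mk_surjective Λ (Γ.pos v)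
    have h1 := sum_signedCross (b := b) hx (q k) k hz
    rw [crossForm_coe b k ⟨Γ.period z, Γ.period_mem hz⟩, Int.cast_inj] at h1
    rw [← h1, LinearMap.sum_apply]
    refine Finset.sum_congr rfl fun e _ => ?_
    have h2 := crossings_eq_signedCross hx (hq k) e
    rw [LinearMap.smul_apply, nsmul_eq_mul]
    change (Γ.crossings (q k) (b k) e : ℤ) * _ = _
    rw [h2, flagMoment]
    split_ifs
    · rfl
    · change -_ * -z e = _
      ring

/-- The adjacency of cells is rewritten with one edge for each half-edge at an unmarked vertex, so
that the results on `graphBoundary` apply. -/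
theorem complementGraph_rel (p : Fin n → Γ.V) :
    (fun x y : {v : Γ.V // v ∉ Set.range p} ⊕ Γ.E =>
      ∃ v e, x = Sum.inl v ∧ y = Sum.inr e ∧ (Γ.src e = v ∨ Γ.tgt e = v)) =
    fun x y => ∃ f : {f : Γ.Flag // f.vertex ∉ Set.range p},
      (Sum.inl ⟨f.1.vertex, f.2⟩ : {v : Γ.V // v ∉ Set.range p} ⊕ Γ.E) = x ∧
        Sum.inr f.1.1 = y := by
  ext x y
  constructor
  · rintro ⟨v, e, rfl, rfl, h | h⟩
    · exact ⟨⟨(e, false), by rw [vertex_false, h]; exact v.2⟩, congrArg Sum.inl (Subtype.ext h), rfl⟩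
    · exact ⟨⟨(e, true), by rw [vertex_true, h]; exact v.2⟩, congrArg Sum.inl (Subtype.ext h), rfl⟩
  · rintro ⟨⟨⟨e, i⟩, hf⟩, rfl, rfl⟩
    refine ⟨_, _, rfl, rfl, ?_⟩
    cases i
    · exact Or.inl rfl
    · exact Or.inr rfl

/-- Start from any vector with the prescribed values at the marks. The defect on the edges has sum
zero, so, the complement being connected, it is the divergence of a function on the half-edges at
unmarked vertices. Such a function is realized without moving the marks. -/
theorem exists_coordEval_eq (ht : ∀ v, v ∉ Set.range p → IsTripod v (a v) (c v) (d v))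
    (hp : Function.Injective p) (hconn : Γ.ComplementConnected p)
    (b : Module.Basis (Fin 2) ℤ Λ) (q : Fin 2 → RealN) (β : Γ.E → ℤ) (hβ : ∑ e, β e = 0)
    (ν : Fin n → LatN) : ∃ y ℓ, coordEval p a c b q y = (β, ν, ℓ) := by
  classical
  obtain ⟨y₁, hy₁⟩ : ∃ y : Γ.V → LatN, ∀ i, y (p i) = ν i :=
    ⟨fun v => if h : v ∈ Set.range p then ν h.choose else 0, fun i => by
      have h : p i ∈ Set.range p := ⟨i, rfl⟩
      simp only [dif_pos h]
      rw [hp h.choose_spec]⟩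
  have hS := edgeSum_coordEval ht b q y₁
  set β₁ := (coordEval p a c b q y₁).1 with hβ₁
  have hS' : ∑ e, β₁ e = 0 := by rw [← coordSum_apply]; exact hS
  rw [ComplementConnected, complementGraph_rel] at hconn
  have hr := range_graphBoundary_of_connected (R := ℤ)
    (fun f : {f : Γ.Flag // f.vertex ∉ Set.range p} =>
      (Sum.inl ⟨f.1.vertex, f.2⟩ : {v : Γ.V // v ∉ Set.range p} ⊕ Γ.E))
    (fun f => Sum.inr f.1.1) hconn
  -- The divergence is zero at the unmarked vertices, as required of moments, and corrects the
  -- defect on the edges.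
  have hmem : (Sum.elim 0 (β₁ - β) : {v : Γ.V // v ∉ Set.range p} ⊕ Γ.E → ℤ) ∈
      LinearMap.ker (coordSum ℤ ({v : Γ.V // v ∉ Set.range p} ⊕ Γ.E)) := by
    rw [LinearMap.mem_ker, coordSum_apply, Fintype.sum_sum_type]
    simp [hβ, hS']
  rw [← hr] at hmem
  obtain ⟨w, hw⟩ := hmem
  let w' : Γ.Flag → ℤ := fun f => if h : f.vertex ∉ Set.range p then w ⟨f, h⟩ else 0
  have hsum : ∀ P : Γ.Flag → Prop, (∑ f : {f : Γ.Flag // f.vertex ∉ Set.range p},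
      if P f.1 then w f else 0) = ∑ f : Γ.Flag, if P f then w' f else 0 := by
    intro P
    have h1 : ∀ f : {f : Γ.Flag // f.vertex ∉ Set.range p}, w f = w' f.1 := fun f => by
      simp only [w', dif_pos f.2]
    simp only [h1]
    rw [← Finset.sum_subtype (Finset.univ.filter fun f : Γ.Flag => f.vertex ∉ Set.range p)
      (by simp) (fun f => if P f then w' f else 0), Finset.sum_filter]
    refine Finset.sum_congr rfl fun f _ => ?_
    by_cases hf : f.vertex ∉ Set.range p
    · rw [if_pos hf]
    · rw [if_neg hf]
      have : w' f = 0 := dif_neg hf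
      rw [this, ite_self]
  obtain ⟨y₂, hy₂, hy₂'⟩ := exists_flagMap_eq ht w' (fun f hf => dif_neg (not_not.2 hf))
    (fun v hv => by
      have h1 := congrFun hw (Sum.inl ⟨v, hv⟩)
      rw [graphBoundary_apply] at h1
      simp only [Sum.elim_inl, Pi.zero_apply, reduceCtorEq, if_false, zero_sub,
        Finset.sum_neg_distrib, neg_eq_zero, Sum.inl.injEq, Subtype.mk.injEq] at h1
      rw [hsum fun f => f.vertex = v, (ht v hv).sum_eq] at h1
      exact h1)
  refine ⟨y₁ + y₂, _, Prod.ext ?_ (Prod.ext ?_ rfl)⟩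
  · ext e
    rw [map_add]
    change β₁ e + -(flagMap p a c y₂ (e, true) + flagMap p a c y₂ (e, false)) = β e
    have h1 := congrFun hw (Sum.inr e)
    rw [graphBoundary_apply] at h1
    simp only [Sum.elim_inr, Pi.sub_apply, reduceCtorEq, if_false, sub_zero,
      Sum.inr.injEq] at h1
    rw [hsum fun f => f.1 = e, sum_flag] at h1
    simp only [Finset.sum_add_distrib, Finset.sum_ite_eq', Finset.mem_univ, if_true] at h1
    rw [hy₂']
    linarith
  · ext i : 1
    change y₁ (p i) + y₂ (p i) = ν i
    rw [hy₁, hy₂, add_zero]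

section Index

variable [DiscreteTopology Λ] [IsZLattice ℝ Λ] {b : Module.Basis (Fin 2) ℤ Λ} {q : Fin 2 → RealN}

theorem injective_coordEval (ht : ∀ v, v ∉ Set.range p → IsTripod v (a v) (c v) (d v))
    (hq : ∀ k, Γ.LoopTransverse (q k) (b k))
    (hinj : ∀ z ∈ Γ.H1 (innerEdges p), Γ.period z = 0 → z = 0) :
    Function.Injective (coordEval p a c b q) := by
  rw [← LinearMap.ker_eq_bot, LinearMap.ker_eq_bot']
  intro y hy
  have h0 : ∀ i, y (p i) = 0 := fun i => congrFun (congrArg (fun x => x.2.1) hy) i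
  have h1 : ∀ e, flagMap p a c y (e, true) + flagMap p a c y (e, false) = 0 := fun e =>
    neg_eq_zero.1 (congrFun (congrArg (fun x => x.1) hy) e)
  obtain ⟨z, hz, hzy⟩ := mem_H1_of_flagMap ht h0 h1
  have h2 : (flagEval b q (flagMap p a c y)).2 = 0 := congrArg (fun x => x.2.2) hy
  rw [← hzy, flagEval_flagFlow hq hz.1] at h2
  have h3 : (fun k => crossInt b k ⟨Γ.period z, Γ.period_mem hz.1⟩) = 0 :=
    (b.constr ℤ).map_eq_zero_iff.1 h2
  have h4 : (⟨Γ.period z, Γ.period_mem hz.1⟩ : Λ) = 0 := (crossEquiv b).map_eq_zero_iff.1 h3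
  have h5 := hinj z hz (congrArg Subtype.val h4)
  refine eq_zero_of_flagMap_eq_zero ht h0 ?_
  rw [← hzy, h5]
  ext f
  simp [flagFlow]

/-- The image together with the factor `Λ*` is the whole hyperplane, so the index is that of the
intersection of the image with `Λ*`. Elements of this intersection come from flows of cycles on the
inner edges, and the unimodular pairing `j` turns it into the image of `H₁` in `Λ`. -/
theorem relIndex_range_coordEval (ht : ∀ v, v ∉ Set.range p → IsTripod v (a v) (c v) (d v))
    (hp : Function.Injective p) (hconn : Γ.ComplementConnected p)
    (hq : ∀ k, Γ.LoopTransverse (q k) (b k)) :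
    (LinearMap.range (coordEval p a c b q)).toAddSubgroup.relIndex
      (LinearMap.ker (edgeSum Γ n)).toAddSubgroup = Γ.homologyIndex (innerEdges p) := by
  let ι : (Λ →ₗ[ℤ] ℤ) →+ ((Γ.E → ℤ) × (Fin n → LatN) × (Λ →ₗ[ℤ] ℤ)) :=
    (LinearMap.inr ℤ _ _ ∘ₗ LinearMap.inr ℤ _ _).toAddMonoidHom
  let j : Λ ≃ₗ[ℤ] (Λ →ₗ[ℤ] ℤ) := (crossEquiv b).trans (b.constr ℤ)
  set T := (LinearMap.range (coordEval p a c b q)).toAddSubgroup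
  have h1 : (LinearMap.ker (edgeSum Γ n)).toAddSubgroup = T ⊔ (⊤ : AddSubgroup _).map ι := by
    refine le_antisymm ?_ (sup_le ?_ ?_)
    · rintro ⟨β, ν, ℓ⟩ h
      have hβ : ∑ e, β e = 0 := by rw [← coordSum_apply]; exact h
      obtain ⟨y, ℓ', hy⟩ := exists_coordEval_eq ht hp hconn b q β hβ ν
      refine AddSubgroup.mem_sup.2 ⟨_, ⟨y, rfl⟩, ι (ℓ - ℓ'), ⟨_, trivial, rfl⟩, ?_⟩
      rw [hy]
      exact Prod.ext (add_zero _) (Prod.ext (add_zero _) (add_sub_cancel _ _))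
    · rintro _ ⟨y, rfl⟩
      exact edgeSum_coordEval ht b q y
    · rintro _ ⟨ℓ, -, rfl⟩
      exact map_zero (coordSum ℤ Γ.E)
  rw [h1, AddSubgroup.relIndex_sup_left, ← AddSubgroup.relIndex_comap, AddSubgroup.relIndex_top_right,
    homologyIndex, ← AddSubgroup.index_comap_of_surjective (f := j.toLinearMap.toAddMonoidHom) _
      j.surjective]
  congr 1
  ext l
  constructor
  · rintro ⟨y, hy⟩
    have h0 : ∀ i, y (p i) = 0 := fun i => congrFun (congrArg (fun x => x.2.1) hy) i
    have h1 : ∀ e, flagMap p a c y (e, true) + flagMap p a c y (e, false) = 0 := fun e =>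
      neg_eq_zero.1 (congrFun (congrArg (fun x => x.1) hy) e)
    obtain ⟨z, hz, hzy⟩ := mem_H1_of_flagMap ht h0 h1
    have h2 : (flagEval b q (flagMap p a c y)).2 = j l := congrArg (fun x => x.2.2) hy
    rw [← hzy, flagEval_flagFlow hq hz.1] at h2
    exact ⟨⟨z, hz⟩, (crossEquiv b).injective ((b.constr ℤ).injective h2)⟩
  · rintro ⟨⟨z, hz⟩, rfl⟩
    obtain ⟨y, hy, hyz⟩ := exists_flagMap_eq_flagFlow ht hz
    refine ⟨y, ?_⟩
    have h2 := flagEval_flagFlow hq hz.1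
    rw [← hyz] at h2
    refine Prod.ext ?_ (Prod.ext (funext hy) ?_)
    · have h3 : (flagEval b q (flagMap p a c y)).1 = 0 := congrArg Prod.fst h2
      exact h3
    · have h3 := congrArg Prod.snd h2
      exact h3

theorem complexMult_eq (hΓ : Γ.IsImmersion) (hp : Function.Injective p)
    (hval : ∀ v, Γ.valence v = 3 ↔ v ∉ Set.range p) (hconn : Γ.ComplementConnected p)
    (hinj : ∀ z ∈ Γ.H1 (innerEdges p), Γ.period z = 0 → z = 0)
    (hind : Γ.homologyIndex (innerEdges p) ≠ 0) (hE : Nonempty Γ.E)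
    (hq : ∀ k, Γ.LoopTransverse (q k) (b k)) :
    Γ.complexMult p b q = Γ.weightGcd * Γ.homologyIndex (innerEdges p) * Γ.usualMult := by
  classical
  have hE' : Nonempty Γ.Flag := ⟨(hE.some, false)⟩
  have hex : ∀ v, ∃ f₁ f₂ f₃ : Γ.Flag, v ∉ Set.range p → IsTripod v f₁ f₂ f₃ := by
    intro v
    by_cases hv : v ∈ Set.range p
    · exact ⟨hE'.some, hE'.some, hE'.some, fun h => absurd hv h⟩
    · obtain ⟨f₁, f₂, f₃, h⟩ := hΓ.exists_isTripod ((hval v).2 hv)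
      exact ⟨f₁, f₂, f₃, fun _ => h⟩
  choose a c d ht using hex
  have hdet := natAbs_det_coordMap ht hval
  have hmult := usualMult_ne_zero ht hval
  have hcoord : Function.Injective (coordMap p a c) := by
    rw [← LinearMap.ker_eq_bot, LinearMap.ker_eq_bot']
    intro φ hφ
    ext1 v
    by_cases hv : v ∈ Set.range p
    · have : vertexMap p a c v (φ v) = 0 := congrFun hφ v
      rwa [vertexMap, if_pos hv] at this
    · have h := ht v hv
      have h1 := flagMap_coordMap ht φ (a v)
      have h2 := flagMap_coordMap ht φ (c v)
      rw [hφ, map_zero, (h.vertex_eq_iff (a v)).2 (by simp)] at h1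
      rw [hφ, map_zero, (h.vertex_eq_iff (c v)).2 (by simp)] at h2
      exact eq_zero_of_det2_eq_zero h.det_ne_zero h1.symm h2.symm
  have hceval := injective_coordEval ht hq hinj
  have hcomp := targetDet_evalMap ht b q
  have hinjE : Function.Injective (Γ.evalMap p b q) := by
    have : Function.Injective (targetDet Γ n ∘ₗ Γ.evalMap p b q) := by
      rw [hcomp]; exact hceval.comp hcoord
    exact Function.Injective.of_comp (f := targetDet Γ n) this
  have hmap : ((LinearMap.range (Γ.evalMap p b q)).toAddSubgroup.map
      (targetDet Γ n).toAddMonoidHom) =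
      (LinearMap.range (coordMap p a c)).toAddSubgroup.map
        (coordEval p a c b q).toAddMonoidHom := by
    ext x
    constructor
    · rintro ⟨_, ⟨φ, rfl⟩, rfl⟩
      exact ⟨_, ⟨φ, rfl⟩, (LinearMap.congr_fun hcomp φ).symm⟩
    · rintro ⟨_, ⟨φ, rfl⟩, rfl⟩
      exact ⟨_, ⟨φ, rfl⟩, LinearMap.congr_fun hcomp φ⟩
  have hzero : (edgeSum Γ n ∘ₗ targetDet Γ n) ∘ₗ Γ.evalMap p b q = 0 := by
    rw [LinearMap.comp_assoc, hcomp]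
    exact LinearMap.ext fun φ => edgeSum_coordEval ht b q _
  have hsurj : Function.Surjective (edgeSum Γ n) := fun m =>
    ⟨(Pi.single hE.some m, 0), (coordSum_apply _).trans (by simp)⟩
  have key := relIndex_ker_comp_mul_index (targetDet Γ n).toAddMonoidHom injective_targetDet
    (edgeSum Γ n).toAddMonoidHom hsurj (LinearMap.range (Γ.evalMap p b q)).toAddSubgroup
    (by rintro _ ⟨φ, rfl⟩; exact LinearMap.congr_fun hzero φ)
  have k1 : (targetDet Γ n).toAddMonoidHom.range.index = ∏ e, Γ.weight e := index_range_targetDet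
  have k2 : ((edgeSum Γ n).toAddMonoidHom.comp (targetDet Γ n).toAddMonoidHom).range.index =
    Γ.weightGcd := index_range_edgeSum_targetDet
  have k3 : ((LinearMap.range (Γ.evalMap p b q)).toAddSubgroup.map
      (targetDet Γ n).toAddMonoidHom).relIndex (edgeSum Γ n).toAddMonoidHom.ker =
      Γ.usualMult * Γ.homologyIndex (innerEdges p) := by
    rw [hmap, ← hdet, ← index_range_eq_natAbs_det _ hcoord, ← AddSubgroup.relIndex_top_right,
      ← AddSubgroup.relIndex_map_map_of_injective _ _ (f := (coordEval p a c b q).toAddMonoidHom)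
        hceval, ← relIndex_range_coordEval ht hp hconn hq, ← AddMonoidHom.range_eq_map]
    refine (AddSubgroup.relIndex_mul_relIndex _ _ _ ?_ ?_).symm
    · rintro _ ⟨x, -, rfl⟩
      exact ⟨x, rfl⟩
    · rintro _ ⟨y, rfl⟩
      exact edgeSum_coordEval ht b q y
  rw [k1, k2, k3] at key
  have hgcd : Γ.weightGcd ≠ 0 := by
    rw [weightGcd, Ne, Finset.gcd_eq_zero_iff]
    intro h
    have h1 := h hE.some (Finset.mem_univ _)
    rw [weight, Int.gcd_eq_zero_iff] at h1
    refine hΓ.slope_ne_zero hE.some ?_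
    ext i
    fin_cases i
    · exact h1.1
    · exact h1.2
  -- A zero index means an infinite one: nonvanishing of the product gives the finiteness needed to
  -- count the kernel.
  have hne := mul_ne_zero hgcd (mul_ne_zero hmult hind)
  rw [← key] at hne
  have : Module.Free ℤ Λ := Module.Free.of_basis b
  have : Module.Finite ℤ Λ := Module.Finite.of_basis b
  have : Module.Free ℤ (((e : Γ.E) → LatN ⧸ Γ.edgeLattice e) × (Fin n → LatN) × (Λ →ₗ[ℤ] ℤ)) :=
    Module.Free.of_equiv (LinearEquiv.ofInjective (targetDet Γ n) injective_targetDet).symm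
  have hcard := card_ker_rTensor_of_le_ker (Γ.evalMap p b q) (edgeSum Γ n ∘ₗ targetDet Γ n) hinjE
    hzero (left_ne_zero_of_mul hne)
  rw [complexMult, hcard]
  refine key.trans ?_
  ring

end Index

end TropCurve

/-! ### Locally affine functions -/

/-- The function is affine in a neighbourhood of the point. -/
def IsAffineNear (h : RealN → ℝ) (x : RealN) : Prop :=
  ∃ (a : RealN) (c : ℝ), ∀ᶠ y in 𝓝 x, h y = ∑ i, a i * y i + c

theorem IsAffineNear.add {h h' : RealN → ℝ} {x : RealN} (H : IsAffineNear h x)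
    (H' : IsAffineNear h' x) : IsAffineNear (fun y => h y + h' y) x := by
  obtain ⟨a, c, H⟩ := H
  obtain ⟨a', c', H'⟩ := H'
  refine ⟨a + a', c + c', ?_⟩
  filter_upwards [H, H'] with y h1 h2
  rw [h1, h2]
  simp only [Pi.add_apply, add_mul, Finset.sum_add_distrib]
  ring

theorem IsAffineNear.const_mul {h : RealN → ℝ} {x : RealN} (H : IsAffineNear h x) (r : ℝ) :
    IsAffineNear (fun y => r * h y) x := by
  obtain ⟨a, c, H⟩ := H
  refine ⟨r • a, r * c, ?_⟩
  filter_upwards [H] with y h1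
  rw [h1]
  simp only [Pi.smul_apply, smul_eq_mul, mul_add, Finset.mul_sum, mul_assoc]

theorem IsAffineNear.congr {h h' : RealN → ℝ} {x : RealN} (H : IsAffineNear h x)
    (H' : h' =ᶠ[𝓝 x] h) : IsAffineNear h' x := by
  obtain ⟨a, c, H⟩ := H
  exact ⟨a, c, (H'.and H).mono fun y hy => hy.1.trans hy.2⟩

theorem isAffineNear_zero (x : RealN) : IsAffineNear (fun _ => 0) x :=
  ⟨0, 0, Eventually.of_forall fun y => by simp⟩

theorem IsAffineNear.sum {ι : Type*} {s : Finset ι} {h : ι → RealN → ℝ} {x : RealN}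
    (H : ∀ i ∈ s, IsAffineNear (h i) x) : IsAffineNear (fun y => ∑ i ∈ s, h i y) x := by
  classical
  induction s using Finset.induction_on with
  | empty => simpa using isAffineNear_zero x
  | insert i s hi ih =>
    simp only [Finset.sum_insert hi]
    exact (H i (Finset.mem_insert_self _ _)).add
      (ih fun j hj => H j (Finset.mem_insert_of_mem hj))

theorem isAffineNear_det2 (s z x : RealN) : IsAffineNear (fun y => det2 s (y - z)) x :=
  ⟨![-s 1, s 0], -det2 s z, Eventually.of_forall fun y => by
    rw [Fin.sum_univ_two]
    simp only [det2, Pi.sub_apply, Matrix.cons_val_zero, Matrix.cons_val_one]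
    ring⟩

theorem continuous_det2 (s z : RealN) : Continuous fun y => det2 s (y - z) := by
  unfold det2
  fun_prop

theorem eventually_max_eq (r : ℝ) (s z : RealN) {x : RealN} (h : 0 < r * det2 s (x - z)) :
    ∀ᶠ y in 𝓝 x, max 0 (r * det2 s (y - z)) = r * det2 s (y - z) := by
  have : Continuous fun y => r * det2 s (y - z) := (continuous_det2 s z).const_mul r
  filter_upwards [this.continuousAt.eventually (lt_mem_nhds h)] with y hy
  exact max_eq_right hy.le

theorem eventually_max_eq_zero (r : ℝ) (s z : RealN) {x : RealN} (h : r * det2 s (x - z) < 0) :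
    ∀ᶠ y in 𝓝 x, max 0 (r * det2 s (y - z)) = 0 := by
  have : Continuous fun y => r * det2 s (y - z) := (continuous_det2 s z).const_mul r
  filter_upwards [this.continuousAt.eventually (gt_mem_nhds h)] with y hy
  exact max_eq_left hy.le

theorem affine_unique {a a' x : RealN} {c c' : ℝ}
    (h : ∀ᶠ y in 𝓝 x, ∑ i, a i * y i + c = ∑ i, a' i * y i + c') : a = a' ∧ c = c' := by
  have h0 := h.self_of_nhds
  have ha : a = a' := by
    ext j
    have hcont : Tendsto (fun t : ℝ => x + t • (Pi.single j 1 : RealN)) (𝓝 0) (𝓝 x) := by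
      have : Continuous fun t : ℝ => x + t • (Pi.single j 1 : RealN) := by fun_prop
      simpa using this.tendsto 0
    have h1 := (hcont.eventually h).filter_mono (nhdsWithin_le_nhds (s := {0}ᶜ))
    obtain ⟨t, ht, ht0⟩ := (h1.and self_mem_nhdsWithin).exists
    have ht0 : t ≠ 0 := ht0
    simp only [Pi.add_apply, Pi.smul_apply, smul_eq_mul, mul_add, Finset.sum_add_distrib,
      Pi.single_apply, mul_ite, mul_one, mul_zero, Finset.sum_ite_eq', Finset.mem_univ,
      if_true] at ht
    have : a j * t = a' j * t := by linarith
    exact mul_right_cancel₀ ht0 this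
  refine ⟨ha, ?_⟩
  rw [ha] at h0
  linarith

/-- A function which is affine near each point of a segment is given by the same affine
function near its two ends. -/
theorem affine_along_segment {h : RealN → ℝ} {q l : RealN}
    (H : ∀ σ : ℝ, 0 ≤ σ → σ ≤ 1 → IsAffineNear h (q + σ • l)) :
    ∃ (a : RealN) (c : ℝ), (∀ᶠ y in 𝓝 q, h y = ∑ i, a i * y i + c) ∧
      ∀ᶠ y in 𝓝 (q + l), h y = ∑ i, a i * y i + c := by
  choose a c hac using fun σ : Set.Icc (0 : ℝ) 1 => H σ σ.2.1 σ.2.2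
  let F : Set.Icc (0 : ℝ) 1 → RealN × ℝ := fun σ => (a σ, c σ)
  have hF : IsLocallyConstant F := by
    rw [IsLocallyConstant.iff_eventually_eq]
    intro σ
    have h1 := eventually_eventually_nhds.2 (hac σ)
    have hcont : Continuous fun σ : Set.Icc (0 : ℝ) 1 => q + (σ : ℝ) • l := by fun_prop
    filter_upwards [hcont.continuousAt.eventually h1] with τ hτ
    have h2 : ∀ᶠ y in 𝓝 (q + (τ : ℝ) • l), ∑ i, a τ i * y i + c τ = ∑ i, a σ i * y i + c σ :=
      ((hac τ).and hτ).mono fun y hy => hy.1.symm.trans hy.2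
    obtain ⟨h3, h4⟩ := affine_unique h2
    exact Prod.ext h3 h4
  let σ₀ : Set.Icc (0 : ℝ) 1 := ⟨0, by simp⟩
  let σ₁ : Set.Icc (0 : ℝ) 1 := ⟨1, by simp⟩
  have h01 : F σ₁ = F σ₀ := hF.apply_eq_of_preconnectedSpace _ _
  refine ⟨a σ₀, c σ₀, ?_, ?_⟩
  · simpa [σ₀] using hac σ₀
  · have h3 := hac σ₁
    have h4 : a σ₁ = a σ₀ := congrArg Prod.fst h01
    have h5 : c σ₁ = c σ₀ := congrArg Prod.snd h01
    rw [h4, h5] at h3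
    simpa [σ₁] using h3

/-! ### Theta functions along straight loops -/

namespace TropCurve

variable {Λ : Submodule ℤ RealN} {Γ : TropCurve Λ}

/-- The local description of a theta function defining the curve. -/
def IsLocalEquation (Γ : TropCurve Λ) (θ : RealN → ℝ) : Prop :=
  ∀ q : RealN, (∀ v, Γ.pos v ≠ toTorus Λ q) →
    ∃ (a : RealN) (b : ℝ), ∀ᶠ y in 𝓝 q,
      θ y = ∑ i, a i * y i + b +
        ∑ e, ({t : ℝ | 0 < t ∧ t < Γ.length e ∧ Γ.edgePoint e t = toTorus Λ q}.ncard : ℝ) *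
          max 0 (det2 (realify (Γ.slope e)) (y - q))

/-- The sign of the crossing of an edge by a straight loop. -/
noncomputable def crossSign (Γ : TropCurve Λ) (l : Λ) (e : Γ.E) : ℝ :=
  open Classical in if 0 < det2 (realify (Γ.slope e)) (l : RealN) then 1 else -1

theorem crossSign_eq (l : Λ) (e : Γ.E) : Γ.crossSign l e = 1 ∨ Γ.crossSign l e = -1 := by
  unfold crossSign
  split_ifs <;> simp

variable [DiscreteTopology Λ] [IsZLattice ℝ Λ] {b : Module.Basis (Fin 2) ℤ Λ}

theorem crossSign_mul_det_pos {q : RealN} {k : Fin 2} (hq : Γ.LoopTransverse q (b k)) {e : Γ.E}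
    {st : ℝ × ℝ} (hst : st ∈ Γ.crossSet q (b k) e) :
    0 < Γ.crossSign (b k) e * det2 (realify (Γ.slope e)) (b k : RealN) := by
  choose x hx using fun v => Submodule.Quotient.mk_surjective Λ (Γ.pos v)
  have h0 : det2 (realify (Γ.slope e)) (b k : RealN) ≠ 0 := by
    intro h0
    obtain ⟨-, -, m, hm⟩ := (crossSet_projection (b := b) hx q k e).mapsTo hst
    rw [crossForm_apply _ _ (realify (Γ.slope e)), h0, zero_div, mul_zero, add_zero] at hm
    exact crossForm_sub_ne_int hx hq _ m hm
  unfold crossSign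
  split_ifs with h
  · simpa using h
  · have := lt_of_le_of_ne (not_lt.1 h) h0
    linarith

theorem ncard_edgePoint {q : RealN} {k : Fin 2} (hq : Γ.LoopTransverse q (b k)) (e : Γ.E)
    {σ : ℝ} (h0 : 0 ≤ σ) (h1 : σ < 1) :
    {t : ℝ | 0 < t ∧ t < Γ.length e ∧
      Γ.edgePoint e t = toTorus Λ (q + σ • (b k : RealN))}.ncard =
      ((crossSet_finite hq e).toFinset.filter fun st => st.1 = σ).card := by
  classical
  rw [← Set.ncard_coe_finset]
  refine (Set.BijOn.ncard_eq (f := Prod.snd) ⟨?_, ?_, ?_⟩).symm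
  · rintro ⟨τ, t⟩ h
    simp only [Finset.coe_filter, Set.Finite.mem_toFinset, Set.mem_ofPred_eq] at h
    obtain ⟨⟨-, -, h2, h3, h4⟩, rfl⟩ := h
    exact ⟨h2, h3, h4.symm⟩
  · rintro ⟨τ, t⟩ h ⟨τ', t'⟩ h' htt
    simp only [Finset.coe_filter, Set.Finite.mem_toFinset, Set.mem_ofPred_eq] at h h'
    rw [Prod.mk.injEq]
    exact ⟨h.2.trans h'.2.symm, htt⟩
  · rintro t ⟨h2, h3, h4⟩
    refine ⟨(σ, t), ?_, rfl⟩
    simp only [Finset.coe_filter, Set.Finite.mem_toFinset, Set.mem_ofPred_eq, and_true]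
    exact ⟨h0, h1, h2, h3, h4.symm⟩

/-- For every crossing, a kink along the crossed edge is subtracted from `θ`, oriented so that it is
inactive before the crossing and active after it. Away from its crossing a kink is affine near the
points of the segment; at the crossing it cancels the kink of `θ`. -/
theorem isAffineNear_sub_sum {θ : RealN → ℝ} (hθ : Γ.IsLocalEquation θ) {q : RealN} {k : Fin 2}
    (hq : Γ.LoopTransverse q (b k))
    (hq0 : ∀ e t, 0 < t → t < Γ.length e → Γ.edgePoint e t ≠ toTorus Λ q) {σ : ℝ}
    (h0 : 0 ≤ σ) (h1 : σ ≤ 1) :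
    IsAffineNear (fun y => θ y - ∑ e, ∑ st ∈ (crossSet_finite hq e).toFinset,
      max 0 (Γ.crossSign (b k) e * det2 (realify (Γ.slope e)) (y - (q + st.1 • (b k : RealN)))))
      (q + σ • (b k : RealN)) := by
  classical
  obtain ⟨a, c, hac⟩ := hθ (q + σ • (b k : RealN)) fun v => (hq v σ h0 h1).symm
  have hcard : ∀ e, {t : ℝ | 0 < t ∧ t < Γ.length e ∧
      Γ.edgePoint e t = toTorus Λ (q + σ • (b k : RealN))}.ncard =
      ((crossSet_finite hq e).toFinset.filter fun st => st.1 = σ).card := by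
    intro e
    rcases h1.lt_or_eq with h1 | rfl
    · exact ncard_edgePoint hq e h0 h1
    · have h2 : toTorus Λ (q + (1 : ℝ) • (b k : RealN)) = toTorus Λ q := by
        rw [toTorus_eq_iff, one_smul, add_sub_cancel_left]
        exact (b k).2
      have h3 : {t : ℝ | 0 < t ∧ t < Γ.length e ∧
          Γ.edgePoint e t = toTorus Λ (q + (1 : ℝ) • (b k : RealN))} = ∅ := by
        rw [Set.eq_empty_iff_forall_notMem]
        rintro t ⟨ht0, ht1, ht⟩
        exact hq0 e t ht0 ht1 (ht.trans h2)
      rw [h3, Set.ncard_empty, eq_comm, Finset.card_eq_zero, Finset.filter_eq_empty_iff]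
      intro st hst
      rw [Set.Finite.mem_toFinset] at hst
      exact hst.2.1.ne
  have key : ∀ e, IsAffineNear (fun y =>
      (((crossSet_finite hq e).toFinset.filter fun st => st.1 = σ).card : ℝ) *
        max 0 (det2 (realify (Γ.slope e)) (y - (q + σ • (b k : RealN)))) +
      -1 * ∑ st ∈ (crossSet_finite hq e).toFinset,
        max 0 (Γ.crossSign (b k) e * det2 (realify (Γ.slope e)) (y - (q + st.1 • (b k : RealN)))))
      (q + σ • (b k : RealN)) := by
    intro e
    have e1 : IsAffineNear (fun y => -1 * ∑ st ∈ (crossSet_finite hq e).toFinset.filter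
        (fun st => ¬ st.1 = σ), max 0 (Γ.crossSign (b k) e *
          det2 (realify (Γ.slope e)) (y - (q + st.1 • (b k : RealN)))))
        (q + σ • (b k : RealN)) := by
      refine IsAffineNear.const_mul (IsAffineNear.sum fun st hst => ?_) (-1)
      rw [Finset.mem_filter, Set.Finite.mem_toFinset] at hst
      have hpos := crossSign_mul_det_pos hq hst.1
      have hval : Γ.crossSign (b k) e * det2 (realify (Γ.slope e))
          (q + σ • (b k : RealN) - (q + st.1 • (b k : RealN))) =
          (σ - st.1) * (Γ.crossSign (b k) e * det2 (realify (Γ.slope e)) (b k : RealN)) := by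
        rw [add_sub_add_left_eq_sub, ← sub_smul, det2_smul_right]; ring
      rcases lt_or_gt_of_ne hst.2 with h | h
      · exact ((isAffineNear_det2 _ _ _).const_mul _).congr (eventually_max_eq _ _ _
          (by rw [hval]; exact mul_pos (sub_pos.2 h) hpos))
      · exact (isAffineNear_zero _).congr (eventually_max_eq_zero _ _ _
          (by rw [hval]; exact mul_neg_of_neg_of_pos (sub_neg.2 h) hpos))
    -- Reversing the edge does not matter: `max 0 u - max 0 (-u) = u` is affine.
    have e2 : IsAffineNear (fun y =>
        (((crossSet_finite hq e).toFinset.filter fun st => st.1 = σ).card : ℝ) *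
        (max 0 (det2 (realify (Γ.slope e)) (y - (q + σ • (b k : RealN)))) +
        -1 * max 0 (Γ.crossSign (b k) e *
          det2 (realify (Γ.slope e)) (y - (q + σ • (b k : RealN))))))
        (q + σ • (b k : RealN)) := by
      refine IsAffineNear.const_mul ?_ _
      rcases crossSign_eq (b k) e with h | h
      · exact (isAffineNear_zero _).congr (Eventually.of_forall fun y => by rw [h]; ring_nf)
      · refine (isAffineNear_det2 (realify (Γ.slope e)) (q + σ • (b k : RealN)) _).congr
          (Eventually.of_forall fun y => ?_)
        simp only [h]
        generalize det2 (realify (Γ.slope e)) (y - (q + σ • (b k : RealN))) = u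
        rcases le_total 0 u with hu | hu
        · rw [max_eq_right hu, max_eq_left (by linarith)]; ring
        · rw [max_eq_left hu, max_eq_right (by linarith)]; ring
    refine (e2.add e1).congr (Eventually.of_forall fun y => ?_)
    simp only
    rw [← Finset.sum_filter_add_sum_filter_not (crossSet_finite hq e).toFinset
      (fun st => st.1 = σ)]
    have h3 : ∑ st ∈ (crossSet_finite hq e).toFinset.filter (fun st => st.1 = σ),
        max 0 (Γ.crossSign (b k) e *
          det2 (realify (Γ.slope e)) (y - (q + st.1 • (b k : RealN)))) =
        (((crossSet_finite hq e).toFinset.filter fun st => st.1 = σ).card : ℝ) *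
          max 0 (Γ.crossSign (b k) e *
          det2 (realify (Γ.slope e)) (y - (q + σ • (b k : RealN)))) := by
      rw [← nsmul_eq_mul, ← Finset.sum_const]
      exact Finset.sum_congr rfl fun st hst => by rw [(Finset.mem_filter.1 hst).2]
    rw [h3]
    ring
  have hsum := IsAffineNear.add ⟨a, c, Eventually.of_forall fun y => rfl⟩
    (IsAffineNear.sum (s := Finset.univ) fun e _ => key e)
  refine hsum.congr ?_
  filter_upwards [hac] with y hy
  rw [hy]
  simp only [hcard, Finset.sum_add_distrib, ← Finset.mul_sum]
  ring

/-- After subtraction of the kinks, `θ` is given by one affine function along the whole segment. At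
its beginning all kinks vanish, at its end they are all affine. The end is also described by
quasi-periodicity, and comparing the linear parts and the constants yields the two identities. -/
theorem theta_relations {L : PolarizedLineBundle Λ} {θ : RealN → ℝ} (hL : L.IsTheta θ)
    (hθ : Γ.IsLocalEquation θ) {q : RealN} {k : Fin 2} (hq : Γ.LoopTransverse q (b k))
    (hq0 : ∀ e t, 0 < t → t < Γ.length e → Γ.edgePoint e t ≠ toTorus Λ q) :
    ∃ (a : RealN) (c : ℝ), (∀ᶠ y in 𝓝 q, θ y = ∑ i, a i * y i + c) ∧
      (∀ y, ∑ e, ∑ _st ∈ (crossSet_finite hq e).toFinset,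
        Γ.crossSign (b k) e * det2 (realify (Γ.slope e)) y = pairing (L.chern (b k)) y) ∧
      ∑ e, ∑ st ∈ (crossSet_finite hq e).toFinset,
        Γ.crossSign (b k) e * det2 (realify (Γ.slope e)) (q + st.1 • (b k : RealN)) =
        ∑ i, a i * (b k : RealN) i + pairing (L.chern (b k)) (b k : RealN) - L.shift (b k) := by
  obtain ⟨a, c, h1, h2⟩ := affine_along_segment fun σ h0 h1 => isAffineNear_sub_sum hθ hq hq0 h0 h1
  have hpos : ∀ e, ∀ st ∈ (crossSet_finite hq e).toFinset, 0 < st.1 ∧ st.1 < 1 ∧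
      0 < Γ.crossSign (b k) e * det2 (realify (Γ.slope e)) (b k : RealN) := by
    intro e st hst
    rw [Set.Finite.mem_toFinset] at hst
    refine ⟨lt_of_le_of_ne hst.1 fun h => ?_, hst.2.1, crossSign_mul_det_pos hq hst⟩
    refine hq0 e st.2 hst.2.2.1 hst.2.2.2.1 ?_
    rw [← hst.2.2.2.2, ← h, zero_smul, add_zero]
  have h3 : ∀ᶠ y in 𝓝 q, ∀ e, ∀ st ∈ (crossSet_finite hq e).toFinset, max 0
      (Γ.crossSign (b k) e * det2 (realify (Γ.slope e)) (y - (q + st.1 • (b k : RealN)))) = 0 := by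
    refine eventually_all.2 fun e => (Finset.eventually_all _).2 fun st hst => ?_
    obtain ⟨h4, h5, h6⟩ := hpos e st hst
    refine eventually_max_eq_zero _ _ _ ?_
    rw [sub_add_cancel_left, det2_neg_right, det2_smul_right]
    nlinarith [mul_pos h4 h6]
  have h4 : ∀ᶠ y in 𝓝 (q + (b k : RealN)), ∀ e, ∀ st ∈ (crossSet_finite hq e).toFinset, max 0
      (Γ.crossSign (b k) e * det2 (realify (Γ.slope e)) (y - (q + st.1 • (b k : RealN)))) =
      Γ.crossSign (b k) e * det2 (realify (Γ.slope e)) (y - (q + st.1 • (b k : RealN))) := by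
    refine eventually_all.2 fun e => (Finset.eventually_all _).2 fun st hst => ?_
    obtain ⟨h4, h5, h6⟩ := hpos e st hst
    refine eventually_max_eq _ _ _ ?_
    have : q + (b k : RealN) - (q + st.1 • (b k : RealN)) = (1 - st.1) • (b k : RealN) := by
      rw [sub_smul, one_smul]; abel
    rw [this, det2_smul_right]
    nlinarith [mul_pos (sub_pos.2 h5) h6]
  have h5 : ∀ᶠ y in 𝓝 q, θ y = ∑ i, a i * y i + c := by
    filter_upwards [h1, h3] with y hy hy'
    rw [← hy]
    simp only [Finset.sum_congr rfl fun e _ => Finset.sum_congr rfl (hy' e)]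
    simp
  refine ⟨a, c, h5, ?_⟩
  obtain ⟨S, hS⟩ : ∃ S : RealN → ℝ, S = fun y => ∑ e, ∑ _st ∈ (crossSet_finite hq e).toFinset,
        Γ.crossSign (b k) e * det2 (realify (Γ.slope e)) y := ⟨_, rfl⟩
  obtain ⟨κ, hκ⟩ : ∃ κ : ℝ, κ = ∑ e, ∑ st ∈ (crossSet_finite hq e).toFinset,
        Γ.crossSign (b k) e * det2 (realify (Γ.slope e)) (q + st.1 • (b k : RealN)) := ⟨_, rfl⟩
  have hSaff : ∃ u : RealN, ∀ y, S y = ∑ i, u i * y i := by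
    refine ⟨fun i => S (Pi.single i 1), fun y => ?_⟩
    rw [hS, Fin.sum_univ_two]
    simp only [Finset.sum_mul, ← Finset.sum_add_distrib]
    refine Finset.sum_congr rfl fun e _ => Finset.sum_congr rfl fun st _ => ?_
    simp [det2]
    ring
  obtain ⟨u, hu⟩ := hSaff
  have h6 : ∀ᶠ y in 𝓝 (q + (b k : RealN)),
      ∑ i, (a i + u i) * y i + (c - κ) = ∑ i, (a i + L.chern (b k) i) * y i +
        (c - ∑ i, a i * (b k : RealN) i - pairing (L.chern (b k)) (b k : RealN) +
          L.shift (b k)) := by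
    have h7 : Tendsto (fun y : RealN => y - (b k : RealN)) (𝓝 (q + (b k : RealN))) (𝓝 q) := by
      have : Continuous fun y : RealN => y - (b k : RealN) := by fun_prop
      simpa using this.tendsto (q + (b k : RealN))
    filter_upwards [h2, h4, h7.eventually h5] with y e1 e2 e3
    have e4 := hL.quasi_periodic (y - (b k : RealN)) (b k)
    rw [sub_add_cancel, e3] at e4
    rw [Finset.sum_congr rfl fun e _ => Finset.sum_congr rfl (e2 e)] at e1
    have e5 : ∑ e, ∑ st ∈ (crossSet_finite hq e).toFinset, Γ.crossSign (b k) e *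
        det2 (realify (Γ.slope e)) (y - (q + st.1 • (b k : RealN))) = S y - κ := by
      rw [hS, hκ]
      simp only [← Finset.sum_sub_distrib]
      refine Finset.sum_congr rfl fun e _ => Finset.sum_congr rfl fun st _ => ?_
      rw [det2_sub_right]; ring
    rw [e5, e4, hu] at e1
    simp only [pairing, Fin.sum_univ_two, Pi.sub_apply] at e1 ⊢
    linarith
  obtain ⟨h8, h9⟩ := affine_unique (a := fun i => a i + u i)
    (a' := fun i => a i + L.chern (b k) i) h6
  refine ⟨fun y => ?_, ?_⟩
  · have := congrFun hS y
    rw [← this, hu, pairing]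
    refine Finset.sum_congr rfl fun i _ => ?_
    have := congrFun h8 i
    simp only [add_right_inj] at this
    rw [this]
  · rw [← hκ]
    linarith

end TropCurve

/-! ### Infinitesimal deformations with fixed linear system -/

section Conditions

variable {V E : Type*} [Fintype E] (src tgt : E → V) (s : E → LatN)
  (N : Fin 2 → E → ℤ)

/-- The displacements of the two ends of an edge differ by a vector parallel to the edge. -/
noncomputable def edgeCond : (V → RealN) →ₗ[ℝ] (E → ℝ) where
  toFun φ e := det2 (realify (s e)) (φ (tgt e) - φ (src e))
  map_add' φ ψ := by
    ext e
    simp only [Pi.add_apply, det2_sub_right, det2_add_right]; ring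
  map_smul' r φ := by
    ext e
    simp only [Pi.smul_apply, det2_sub_right, det2_smul_right, RingHom.id_apply, smul_eq_mul]; ring

/-- The variation of the two moments of the curve. -/
noncomputable def momentCond : (V → RealN) →ₗ[ℝ] (Fin 2 → ℝ) where
  toFun φ k := ∑ e, N k e * det2 (realify (s e)) (φ (src e))
  map_add' φ ψ := by
    ext k
    simp only [Pi.add_apply, det2_add_right, mul_add, Finset.sum_add_distrib]
  map_smul' r φ := by
    ext k
    simp only [Pi.smul_apply, det2_smul_right, RingHom.id_apply, smul_eq_mul, Finset.mul_sum]
    exact Finset.sum_congr rfl fun e _ => by ring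

/-- The positions of the marked points can be varied arbitrarily. -/
def IsRegularMarking {n : ℕ} (p : Fin n → V) : Prop :=
  ∀ P : Fin n → RealN, ∃ φ : V → RealN, edgeCond src tgt s φ = 0 ∧ momentCond src s N φ = 0 ∧
    ∀ i, φ (p i) = P i

end Conditions

/-! ### Dimension counts and rigidity of marked curves -/

namespace TropCurve

variable {Λ : Submodule ℤ RealN} {Γ : TropCurve Λ} {n : ℕ} {p : Fin n → Γ.V}

theorem finrank_ker_graphBoundary_real :
    Module.finrank ℝ (LinearMap.ker (graphBoundary ℝ Γ.src Γ.tgt)) = Γ.genus := by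
  have h1 := finrank_ker_graphBoundary_of_connected (R := ℝ) Γ.src Γ.tgt Γ.connected
  have h2 := card_vertices_add_genus (Γ := Γ)
  omega

theorem det2_outSlope_eq_flagFlow {φ : Γ.V → RealN}
    (hφ : edgeCond Γ.src Γ.tgt Γ.slope φ = 0) (f : Γ.Flag) :
    det2 (realify f.outSlope) (φ f.vertex) =
      flagFlow (fun e => det2 (realify (Γ.slope e)) (φ (Γ.src e))) f := by
  obtain ⟨e, i⟩ := f
  cases i
  · rfl
  · have h := congrFun hφ e
    change det2 _ _ = 0 at h
    rw [det2_sub_right] at h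
    rw [outSlope_true, vertex_true, realify_neg, det2_neg_left]
    change _ = -_
    linarith

open Classical in
theorem sum_det2_outSlope (v : Γ.V) (y : RealN) :
    ∑ f : Γ.Flag, (if f.vertex = v then det2 (realify f.outSlope) y else 0) = 0 := by
  have h := sum_outSlope v
  have h0 := congrFun h 0
  have h1 := congrFun h 1
  rw [Finset.sum_apply] at h0 h1
  have h2 : ∀ f : Γ.Flag, (if f.vertex = v then det2 (realify f.outSlope) y else 0) =
      ((if f.vertex = v then f.outSlope else 0 : LatN) 0 : ℝ) * y 1 -
        ((if f.vertex = v then f.outSlope else 0 : LatN) 1 : ℝ) * y 0 := by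
    intro f
    split_ifs <;> simp [det2, realify]
  simp only [h2, Finset.sum_sub_distrib, ← Finset.sum_mul]
  rw [← Int.cast_sum, ← Int.cast_sum, h0, h1]
  simp

theorem graphBoundary_det2 {φ : Γ.V → RealN} (hφ : edgeCond Γ.src Γ.tgt Γ.slope φ = 0) :
    graphBoundary ℝ Γ.src Γ.tgt (fun e => det2 (realify (Γ.slope e)) (φ (Γ.src e))) = 0 := by
  classical
  ext v
  rw [graphBoundary_eq_neg_sum, Pi.zero_apply, neg_eq_zero]
  refine Eq.trans ?_ (sum_det2_outSlope v (φ v))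
  refine Finset.sum_congr rfl fun f _ => ?_
  split_ifs with h
  · rw [← det2_outSlope_eq_flagFlow hφ, h]
  · rfl

theorem eq_zero_of_det2_of_dot {x y : RealN} (hx : x ≠ 0) (h : det2 x y = 0)
    (h' : x 0 * y 0 + x 1 * y 1 = 0) : y = 0 := by
  simp only [det2] at h
  have hpos : x 0 * x 0 + x 1 * x 1 ≠ 0 := by
    intro h0
    refine hx ?_
    have h1 : x 0 * x 0 = 0 := by nlinarith [mul_self_nonneg (x 0), mul_self_nonneg (x 1)]
    have h2 : x 1 * x 1 = 0 := by nlinarith [mul_self_nonneg (x 0), mul_self_nonneg (x 1)]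
    ext i
    fin_cases i
    · simpa using h1
    · simpa using h2
  ext i
  fin_cases i
  · refine (mul_eq_zero.1 ?_).resolve_left hpos
    change _ * y 0 = 0
    linear_combination x 0 * h' - x 1 * h
  · refine (mul_eq_zero.1 ?_).resolve_left hpos
    change _ * y 1 = 0
    linear_combination x 1 * h' + x 0 * h

theorem IsTripod.eq_zero_of_det2 {v : Γ.V} {f₁ f₂ f₃ : Γ.Flag} (h : IsTripod v f₁ f₂ f₃)
    {y : RealN} (h₁ : det2 (realify f₁.outSlope) y = 0) (h₂ : det2 (realify f₂.outSlope) y = 0) :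
    y = 0 :=
  eq_zero_of_det2_eq_zero (by rw [det2_realify]; exact_mod_cast h.det_ne_zero) h₁ h₂

/-- The moments of a deformation form a real cycle, which leaves `genus` parameters. They determine
the displacement of a trivalent vertex; at a bivalent one the displacement along the edge remains
free. -/
theorem IsSimpleMarked.finrank_ker_edgeCond_le (h : Γ.IsSimpleMarked p) :
    Module.finrank ℝ (LinearMap.ker (edgeCond Γ.src Γ.tgt Γ.slope)) ≤
      Γ.genus + Γ.bivalent.card := by
  classical
  have hfl : ∀ v : Γ.bivalent, ∃ f : Γ.Flag, f.vertex = v := by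
    rintro ⟨v, hv⟩
    rw [mem_bivalent, ← card_filter_vertex] at hv
    obtain ⟨f, hf⟩ := Finset.card_pos.1 (by rw [hv]; norm_num)
    exact ⟨f, (Finset.mem_filter.1 hf).2⟩
  choose fl hfl using hfl
  let J₁ : LinearMap.ker (edgeCond Γ.src Γ.tgt Γ.slope) →ₗ[ℝ] (Γ.E → ℝ) :=
    { toFun := fun φ e => det2 (realify (Γ.slope e)) (φ.1 (Γ.src e))
      map_add' := fun φ ψ => funext fun e => det2_add_right _ _ _
      map_smul' := fun r φ => funext fun e => det2_smul_right _ _ _ }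
  let J₂ : LinearMap.ker (edgeCond Γ.src Γ.tgt Γ.slope) →ₗ[ℝ] (Γ.bivalent → ℝ) :=
    { toFun := fun φ v => realify (fl v).outSlope 0 * φ.1 v 0 + realify (fl v).outSlope 1 * φ.1 v 1
      map_add' := fun φ ψ => funext fun v => by
        simp only [Submodule.coe_add, Pi.add_apply]; ring
      map_smul' := fun r φ => funext fun v => by
        simp only [Submodule.coe_smul, Pi.smul_apply, smul_eq_mul, RingHom.id_apply]; ring }
  let J := (J₁.codRestrict (LinearMap.ker (graphBoundary ℝ Γ.src Γ.tgt))
    fun φ => graphBoundary_det2 φ.2).prod J₂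
  have hJ : Function.Injective J := by
    rw [← LinearMap.ker_eq_bot, LinearMap.ker_eq_bot']
    rintro ⟨φ, hφ⟩ hJφ
    have hz : (fun e => det2 (realify (Γ.slope e)) (φ (Γ.src e))) = 0 :=
      congrArg Subtype.val (congrArg Prod.fst hJφ)
    have hc : ∀ v : Γ.bivalent, realify (fl v).outSlope 0 * φ v 0 +
        realify (fl v).outSlope 1 * φ v 1 = 0 := fun v => congrFun (congrArg Prod.snd hJφ) v
    have hf : ∀ f : Γ.Flag, det2 (realify f.outSlope) (φ f.vertex) = 0 := by
      intro f
      rw [det2_outSlope_eq_flagFlow hφ, hz]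
      simp [flagFlow]
    refine Subtype.ext (funext fun v => ?_)
    change φ v = 0
    rcases h.valence_eq v with hv | ⟨hv, -⟩
    · obtain ⟨f₁, f₂, f₃, ht⟩ := h.immersion.exists_isTripod hv
      have h1 := hf f₁
      have h2 := hf f₂
      rw [(ht.vertex_eq_iff f₁).2 (by simp)] at h1
      rw [(ht.vertex_eq_iff f₂).2 (by simp)] at h2
      exact ht.eq_zero_of_det2 h1 h2
    · have hv' := mem_bivalent.2 hv
      have h1 := hf (fl ⟨v, hv'⟩)
      rw [hfl ⟨v, hv'⟩] at h1
      exact eq_zero_of_det2_of_dot (fun h0 => h.immersion.outSlope_ne_zero _ (realify_eq_zero.1 h0))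
        h1 (hc ⟨v, hv'⟩)
  have := LinearMap.finrank_le_finrank_of_injective hJ
  rwa [Module.finrank_prod, finrank_ker_graphBoundary_real, Module.finrank_fintype_fun_eq_card,
    Fintype.card_coe] at this

/-- Consequences of regularity: the marked points are distinct bivalent vertices, and the marked
curve is rigid in its linear system. -/
theorem IsSimpleMarked.of_isRegularMarking (h : Γ.IsSimpleMarked p) (hg : Γ.genus = n + 2)
    {N : Fin 2 → Γ.E → ℤ}
    (hN : ∀ y : RealN, (∀ k, ∑ e, N k e * det2 (realify (Γ.slope e)) y = 0) → y = 0)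
    (hreg : IsRegularMarking Γ.src Γ.tgt Γ.slope N p) :
    Function.Injective p ∧ (∀ i, Γ.valence (p i) = 2) ∧ Γ.bivalent.card = n ∧
      ∀ φ : Γ.V → RealN, edgeCond Γ.src Γ.tgt Γ.slope φ = 0 → momentCond Γ.src Γ.slope N φ = 0 →
        (∀ i, φ (p i) = 0) → φ = 0 := by
  classical
  set K := LinearMap.ker (edgeCond Γ.src Γ.tgt Γ.slope)
  let m : K →ₗ[ℝ] (Fin 2 → ℝ) := momentCond Γ.src Γ.slope N ∘ₗ K.subtype
  -- Translations are deformations, and by `hN` they already realize all variations of the two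
  -- moments. So fixing the moments costs exactly two dimensions.
  let tr : RealN →ₗ[ℝ] K := LinearMap.codRestrict K (LinearMap.pi fun _ => LinearMap.id) fun y => by
    rw [LinearMap.mem_ker]
    ext e
    change det2 _ (y - y) = 0
    rw [sub_self, det2_zero_right]
  have hmtr : Function.Injective (m ∘ₗ tr) := by
    rw [← LinearMap.ker_eq_bot, LinearMap.ker_eq_bot']
    exact fun y hy => hN y fun k => congrFun hy k
  have hmsurj : LinearMap.range m = ⊤ := by
    have h1 : Function.Surjective (m ∘ₗ tr) := LinearMap.injective_iff_surjective.1 hmtr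
    rw [LinearMap.range_eq_top]
    exact Function.Surjective.of_comp (g := tr) h1
  have hdim := finrank_range_add_finrank_ker' m
  rw [hmsurj, finrank_top, Module.finrank_fintype_fun_eq_card, Fintype.card_fin] at hdim
  have hK : Module.finrank ℝ K ≤ _ := h.finrank_ker_edgeCond_le
  let T : LinearMap.ker m →ₗ[ℝ] (Fin n → RealN) :=
    LinearMap.funLeft ℝ RealN p ∘ₗ K.subtype ∘ₗ (LinearMap.ker m).subtype
  have hT : Function.Surjective T := fun P => by
    obtain ⟨φ, h1, h2, h3⟩ := hreg P
    exact ⟨⟨⟨φ, h1⟩, h2⟩, funext h3⟩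
  have hTdim : Module.finrank ℝ (Fin n → RealN) = n * 2 := by
    rw [Module.finrank_pi_fintype]
    simp
  have h1 := LinearMap.finrank_le_finrank_of_surjective hT
  have hsub : Γ.bivalent ⊆ Finset.univ.image p := by
    intro v hv
    rw [mem_bivalent] at hv
    rcases h.valence_eq v with h2 | ⟨-, i, rfl⟩
    · omega
    · exact Finset.mem_image_of_mem _ (Finset.mem_univ _)
  have hle := Finset.card_le_card hsub
  have hle' : (Finset.univ.image p).card ≤ n := by
    simpa using Finset.card_image_le (s := Finset.univ) (f := p)
  -- The deformations with fixed moments have dimension at most `n + #bivalent ≤ 2 * n`, yet they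
  -- surject on a space of dimension `2 * n`. All the inequalities are equalities.
  have hbiv : Γ.bivalent.card = n := by omega
  have himage : Γ.bivalent = Finset.univ.image p := Finset.eq_of_subset_of_card_le hsub (by omega)
  have hinj : Function.Injective p := by
    rw [← Set.injOn_univ, ← Finset.coe_univ, ← Finset.card_image_iff]
    rw [← himage, hbiv, Finset.card_univ, Fintype.card_fin]
  refine ⟨hinj, fun i => mem_bivalent.1 (himage ▸ Finset.mem_image_of_mem _ (Finset.mem_univ _)),
    hbiv, fun φ h2 h3 h4 => ?_⟩
  have hdimT : Module.finrank ℝ (LinearMap.ker m) = Module.finrank ℝ (Fin n → RealN) := by omega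
  have hTinj : Function.Injective T := by
    have h5 := @LinearMap.injective_iff_surjective_of_finrank_eq_finrank ℝ (LinearMap.ker m) _ _ _
      (Fin n → RealN) _ _ inferInstance inferInstance hdimT T
    exact h5.2 hT
  have h5 : (⟨⟨φ, h2⟩, h3⟩ : LinearMap.ker m) = 0 := hTinj (by
    rw [map_zero]; exact funext h4)
  exact congrArg (fun x => x.1.1) h5

/-- A rigid marked curve has no cycle of period zero in the complement of the marked points. -/
theorem IsSimpleMarked.period_injective (h : Γ.IsSimpleMarked p) {N : Fin 2 → Γ.E → ℤ}
    (hper : ∀ z : Γ.E → ℤ, Γ.boundary z = 0 → Γ.period z = 0 → ∀ k, ∑ e, N k e * z e = 0)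
    (hrig : ∀ φ : Γ.V → RealN, edgeCond Γ.src Γ.tgt Γ.slope φ = 0 →
      momentCond Γ.src Γ.slope N φ = 0 → (∀ i, φ (p i) = 0) → φ = 0)
    {z : Γ.E → ℤ} (hz : z ∈ Γ.H1 (innerEdges p)) (hz0 : Γ.period z = 0) : z = 0 := by
  classical
  -- The cycle is realized as the moments of a displacement: two moments determine it at a trivalent
  -- vertex, and the third agrees by balancing and because `z` is a cycle. At a marked vertex the
  -- flow is zero.
  have hex : ∀ v, ∃ y : RealN, (v ∈ Set.range p → y = 0) ∧
      ∀ f : Γ.Flag, f.vertex = v → det2 (realify f.outSlope) y = ((flagFlow z f : ℤ) : ℝ) := by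
    intro v
    by_cases hv : v ∈ Set.range p
    · refine ⟨0, fun _ => rfl, fun f hf => ?_⟩
      rw [det2_zero_right, flagFlow_eq_zero_of_marked hz (hf ▸ hv), Int.cast_zero]
    · have h3 : Γ.valence v = 3 := (h.valence_eq v).resolve_right fun h => hv h.2
      obtain ⟨f₁, f₂, f₃, ht⟩ := h.immersion.exists_isTripod h3
      have hD : det2 (realify f₁.outSlope) (realify f₂.outSlope) ≠ 0 := by
        rw [det2_realify]; exact_mod_cast ht.det_ne_zero
      set x₁ := realify f₁.outSlope
      set x₂ := realify f₂.outSlope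
      refine ⟨(((flagFlow z f₁ : ℤ) : ℝ) / det2 x₁ x₂) • x₂ - (((flagFlow z f₂ : ℤ) : ℝ) / det2 x₁ x₂) • x₁,
        fun h => absurd h hv, ?_⟩
      set y := (((flagFlow z f₁ : ℤ) : ℝ) / det2 x₁ x₂) • x₂ - (((flagFlow z f₂ : ℤ) : ℝ) / det2 x₁ x₂) • x₁
      have e1 : det2 x₁ y = ((flagFlow z f₁ : ℤ) : ℝ) := by
        simp only [y, det2_sub_right, det2_smul_right, det2_self, mul_zero, sub_zero]
        field_simp
      have e2 : det2 x₂ y = ((flagFlow z f₂ : ℤ) : ℝ) := by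
        simp only [y, det2_sub_right, det2_smul_right, det2_self, mul_zero, zero_sub]
        rw [det2_comm x₂ x₁]
        field_simp
      have e3 : det2 (realify f₃.outSlope) y = ((flagFlow z f₃ : ℤ) : ℝ) := by
        have h4 := sum_det2_outSlope v y
        rw [ht.sum_eq fun f : Γ.Flag => det2 (realify f.outSlope) y] at h4
        have h5 := congrFun hz.1 v
        rw [boundary_eq, graphBoundary_eq_neg_sum, ht.sum_eq, Pi.zero_apply, neg_eq_zero] at h5
        have h6 : ((flagFlow z f₁ : ℤ) : ℝ) + ((flagFlow z f₂ : ℤ) : ℝ) + ((flagFlow z f₃ : ℤ) : ℝ) = 0 := by exact_mod_cast h5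
        change det2 x₁ y + det2 x₂ y + _ = 0 at h4
        linarith
      intro f hf
      rcases (ht.vertex_eq_iff f).1 hf with rfl | rfl | rfl
      · exact e1
      · exact e2
      · exact e3
  choose φ hφ0 hφ using hex
  have hsrc : ∀ e, det2 (realify (Γ.slope e)) (φ (Γ.src e)) = z e := fun e =>
    hφ _ (e, false) rfl
  have htgt : ∀ e, det2 (realify (Γ.slope e)) (φ (Γ.tgt e)) = z e := fun e => by
    have := hφ _ (e, true) rfl
    rw [outSlope_true, realify_neg, det2_neg_left] at this
    have h2 : (flagFlow z ((e, true) : Γ.Flag)) = -z e := rfl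
    rw [h2, vertex_true] at this
    push_cast at this
    linarith
  have h0 := hrig φ (funext fun e => by
      change det2 _ (_ - _) = 0
      rw [det2_sub_right, hsrc, htgt, sub_self])
    (funext fun k => by
      change ∑ e, _ * det2 _ _ = 0
      simp only [hsrc]
      exact_mod_cast hper z hz.1 hz0 k)
    (fun i => hφ0 _ ⟨i, rfl⟩)
  ext e
  have := hsrc e
  rw [h0, Pi.zero_apply, det2_zero_right] at this
  exact_mod_cast this.symm

/-! ### The complement of the marked points -/

open Classical in
-- A cycle of the graph of cells takes opposite values on the two halves of an edge, and zero on an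
-- edge with a marked end. It is therefore the flow of a cycle on the inner edges.
theorem finrank_ker_complementGraph_le :
    Module.finrank ℤ (LinearMap.ker (graphBoundary ℤ
      (fun f : {f : Γ.Flag // f.vertex ∉ Set.range p} =>
        (Sum.inl ⟨f.1.vertex, f.2⟩ : {v : Γ.V // v ∉ Set.range p} ⊕ Γ.E))
      (fun f => Sum.inr f.1.1))) ≤ Γ.genusOn (innerEdges p) := by
  set D := graphBoundary ℤ (fun f : {f : Γ.Flag // f.vertex ∉ Set.range p} =>
        (Sum.inl ⟨f.1.vertex, f.2⟩ : {v : Γ.V // v ∉ Set.range p} ⊕ Γ.E)) (fun f => Sum.inr f.1.1)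
    with hD
  let lift₀ (w : {f : Γ.Flag // f.vertex ∉ Set.range p} → ℤ) (f : Γ.Flag) : ℤ :=
    if h : f.vertex ∉ Set.range p then w ⟨f, h⟩ else 0
  have hext : ∀ w (f : {f : Γ.Flag // f.vertex ∉ Set.range p}), lift₀ w f.1 = w f := fun w f => by
    simp only [lift₀, dif_pos f.2]
  have hext0 : ∀ w (f : Γ.Flag), f.vertex ∈ Set.range p → lift₀ w f = 0 := fun w f hf => by
    simp only [lift₀, dif_neg (not_not.2 hf)]
  have hsum : ∀ (w : {f : Γ.Flag // f.vertex ∉ Set.range p} → ℤ) (P : Γ.Flag → Prop),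
      ∑ f : {f : Γ.Flag // f.vertex ∉ Set.range p}, (if P f.1 then w f else 0) =
        ∑ f, if P f then lift₀ w f else 0 := by
    intro w P
    simp only [← hext w]
    rw [← Finset.sum_subtype (Finset.univ.filter fun f : Γ.Flag => f.vertex ∉ Set.range p)
      (by simp) (fun f => if P f then lift₀ w f else 0), Finset.sum_filter]
    refine Finset.sum_congr rfl fun f _ => ?_
    by_cases hf : f.vertex ∉ Set.range p
    · rw [if_pos hf]
    · rw [if_neg hf, hext0 w f (not_not.1 hf), ite_self]
  have hedge : ∀ w ∈ LinearMap.ker D, ∀ e, lift₀ w (e, true) = -lift₀ w (e, false) := by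
    intro w hw e
    have h1 := congrFun (LinearMap.mem_ker.1 hw) (Sum.inr e)
    rw [hD, graphBoundary_apply, Finset.sum_sub_distrib, Pi.zero_apply] at h1
    simp only [Sum.inr.injEq, reduceCtorEq, if_false, Finset.sum_const_zero, sub_zero] at h1
    rw [hsum w fun f => f.1 = e, sum_flag, Finset.sum_add_distrib] at h1
    simp only [Finset.sum_ite_eq', Finset.mem_univ, if_true] at h1
    linarith
  have hflow : ∀ w ∈ LinearMap.ker D, flagFlow (fun e => lift₀ w (e, false)) = lift₀ w := by
    intro w hw
    ext ⟨e, i⟩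
    cases i
    · rfl
    · exact (hedge w hw e).symm
  let J : LinearMap.ker D →ₗ[ℤ] Γ.H1 (innerEdges p) :=
    { toFun := fun w => ⟨fun e => lift₀ w.1 (e, false), by
        refine ⟨?_, fun e he => ?_⟩
        · ext v
          rw [boundary_eq, graphBoundary_eq_neg_sum, hflow w.1 w.2, Pi.zero_apply, neg_eq_zero]
          by_cases hv : v ∈ Set.range p
          · refine Finset.sum_eq_zero fun f _ => ?_
            split_ifs with h
            · exact hext0 _ _ (h ▸ hv)
            · rfl
          · have h1 := (graphBoundary_apply _ _ w.1 _).symm.trans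
              (congrFun (LinearMap.mem_ker.1 w.2) (Sum.inl ⟨v, hv⟩))
            rw [Finset.sum_sub_distrib, Pi.zero_apply] at h1
            simp only [Sum.inl.injEq, reduceCtorEq, if_false, Finset.sum_const_zero, zero_sub,
              Subtype.mk.injEq] at h1
            rw [hsum w.1 fun f => f.vertex = v] at h1
            linarith
        · by_cases h : Γ.src e ∈ Set.range p
          · exact hext0 _ (e, false) h
          · have h2 : Γ.tgt e ∈ Set.range p := by
              by_contra h3
              exact he ⟨h, h3⟩
            have h3 := hedge w.1 w.2 e
            rw [hext0 _ (e, true) h2] at h3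
            linarith⟩
      map_add' := fun w w' => Subtype.ext (funext fun e => by
        change lift₀ (w.1 + w'.1) _ = lift₀ w.1 _ + lift₀ w'.1 _
        by_cases h : Flag.vertex (Γ := Γ) (e, false) ∈ Set.range p
        · simp only [hext0 _ _ h, add_zero]
        · have h1 := fun w => hext w ⟨(e, false), h⟩
          simp only [h1, Pi.add_apply])
      map_smul' := fun r w => Subtype.ext (funext fun e => by
        change lift₀ (r • w.1) _ = r • lift₀ w.1 _
        by_cases h : Flag.vertex (Γ := Γ) (e, false) ∈ Set.range p
        · simp only [hext0 _ _ h, smul_zero]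
        · have h1 := fun w => hext w ⟨(e, false), h⟩
          simp only [h1, Pi.smul_apply]) }
  refine LinearMap.finrank_le_finrank_of_injective (f := J) ?_
  intro w w' h
  refine Subtype.ext (funext fun f => ?_)
  have h1 : (fun e => lift₀ w.1 (e, false)) = fun e => lift₀ w'.1 (e, false) := congrArg Subtype.val h
  rw [← hext w.1, ← hext w'.1, ← hflow w.1 w.2, ← hflow w'.1 w'.2, h1]

/-- If no cycle avoiding the marked points has period zero, the complement of the marked points is
connected and has genus `2`. -/
theorem IsSimpleMarked.complementConnected [DiscreteTopology Λ] [IsZLattice ℝ Λ]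
    (b : Module.Basis (Fin 2) ℤ Λ) (h : Γ.IsSimpleMarked p) (hg : Γ.genus = n + 2)
    (hp : Function.Injective p) (hbiv : Γ.bivalent.card = n)
    (hinj : ∀ z ∈ Γ.H1 (innerEdges p), Γ.period z = 0 → z = 0) :
    Γ.ComplementConnected p ∧ Γ.genusOn (innerEdges p) = 2 ∧
      Γ.homologyIndex (innerEdges p) ≠ 0 := by
  classical
  have : Module.Free ℤ Λ := Module.Free.of_basis b
  have : Module.Finite ℤ Λ := Module.Finite.of_basis b
  have hrank : Module.finrank ℤ Λ = 2 := by
    rw [Module.finrank_eq_card_basis b, Fintype.card_fin]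
  have hJ : Function.Injective (Γ.homologyMap (innerEdges p)) := by
    rw [← LinearMap.ker_eq_bot, LinearMap.ker_eq_bot']
    intro z hz
    exact Subtype.ext (hinj z.1 z.2 (congrArg Subtype.val hz))
  have hle : Γ.genusOn (innerEdges p) ≤ 2 :=
    hrank ▸ LinearMap.finrank_le_finrank_of_injective hJ
  obtain ⟨hV, hE⟩ := h.card_vertices
  have hV0 : Fintype.card {v : Γ.V // v ∉ Set.range p} = 2 * n + 2 := by
    have h1 : Fintype.card {v : Γ.V // v ∈ Set.range p} = n := by
      rw [← Fintype.card_congr (Equiv.ofInjective p hp), Fintype.card_fin]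
    have h2 := Fintype.card_subtype_compl fun v : Γ.V => v ∈ Set.range p
    rw [h1] at h2
    omega
  have hX : Fintype.card ({v : Γ.V // v ∉ Set.range p} ⊕ Γ.E) = 6 * n + 5 := by
    rw [Fintype.card_sum, hV0]
    omega
  have hI : Fintype.card {f : Γ.Flag // f.vertex ∉ Set.range p} = 6 * n + 6 := by
    rw [Fintype.card_subtype, Finset.card_eq_sum_card_fiberwise (f := Flag.vertex)
      (t := Finset.univ.filter fun v : Γ.V => v ∉ Set.range p) (fun f hf => by simpa using hf)]
    have h3 : ∀ v ∈ Finset.univ.filter fun v : Γ.V => v ∉ Set.range p,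
        ((Finset.univ.filter fun f : Γ.Flag => f.vertex ∉ Set.range p).filter
          fun f => f.vertex = v).card = 3 := by
      intro v hv
      have hv' : v ∉ Set.range p := (Finset.mem_filter.1 hv).2
      rw [← (h.valence_eq v).resolve_right fun h => hv' h.2, ← card_filter_vertex,
        Finset.filter_filter]
      congr 1
      ext f
      simp only [Finset.mem_filter, Finset.mem_univ, true_and, and_iff_right_iff_imp]
      rintro rfl
      exact hv'
    rw [Finset.sum_congr rfl h3, Finset.sum_const, ← Fintype.card_subtype, hV0, smul_eq_mul]
    ring
  have hker := finrank_ker_complementGraph_le (Γ := Γ) (p := p)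
  have hconn : Γ.ComplementConnected p := by
    rw [ComplementConnected, complementGraph_rel]
    have : Nonempty {v : Γ.V // v ∉ Set.range p} := Fintype.card_pos_iff.1 (by omega)
    refine (SimpleGraph.connected_iff _).2 ⟨?_, inferInstance⟩
    -- With `6 * n + 5` cells and `6 * n + 6` incidences, a disconnected graph would have Betti
    -- number at least `3`, against the bound `2`.
    by_contra hc
    have := card_add_two_le_of_not_preconnected (R := ℤ) _ _ hc
    omega
  have hconn' := hconn
  rw [ComplementConnected, complementGraph_rel] at hconn'
  have hk := finrank_ker_graphBoundary_of_connected (R := ℤ) _ _ hconn'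
  have hgen : Γ.genusOn (innerEdges p) = 2 := by omega
  refine ⟨hconn, hgen, ?_⟩
  have hr : Module.finrank ℤ (LinearMap.range (Γ.homologyMap (innerEdges p))) =
      Module.finrank ℤ Λ := by
    rw [LinearMap.finrank_range_of_inj hJ, hrank]
    exact hgen
  have := Submodule.finiteQuotientOfFreeOfRankEq _ hr
  rw [homologyIndex]
  have hf : Finite (Λ ⧸ (LinearMap.range (Γ.homologyMap (innerEdges p))).toAddSubgroup) := this
  exact AddSubgroup.index_ne_zero_of_finite

theorem ComplementConnected.exists_retract (hconn : Γ.ComplementConnected p)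
    (hne : ∃ v, v ∉ Set.range p) : ∃ W F, Γ.ComplementRetractsOn p W F := by
  refine exists_complementRetractsOn fun e => ?_
  by_contra! hc
  obtain ⟨v, hv⟩ := hne
  obtain ⟨w⟩ := hconn.preconnected (Sum.inr e) (Sum.inl ⟨v, hv⟩)
  cases w with
  | cons hadj _ =>
    rw [SimpleGraph.fromRel_adj] at hadj
    obtain ⟨-, ⟨v, e', h1, -, -⟩ | ⟨v, e', -, h1, h2⟩⟩ := hadj
    · exact Sum.inr_ne_inl h1
    · obtain rfl := Sum.inr_injective h1
      rcases h2 with h2 | h2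
      · exact v.2 (h2 ▸ hc.1)
      · exact v.2 (h2 ▸ hc.2)

end TropCurve

/-! ### Generic points -/

/-- Proper affine subspaces are null for Haar measure, hence so is a countable union of them. -/
theorem dense_compl_iUnion_translates {E ι : Type*} [NormedAddCommGroup E] [NormedSpace ℝ E]
    [FiniteDimensional ℝ E] [Countable ι] (W : ι → Submodule ℝ E) (hW : ∀ i, W i ≠ ⊤) (z : ι → E) :
    Dense {x : E | ∀ i, x - z i ∉ W i} := by
  borelize E
  let K : TopologicalSpace.PositiveCompacts E := Classical.arbitrary _
  let μ : MeasureTheory.Measure E := MeasureTheory.Measure.addHaarMeasure K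
  refine MeasureTheory.Measure.dense_of_ae (μ := μ) ?_
  rw [MeasureTheory.ae_all_iff]
  intro i
  have h := MeasureTheory.Measure.addHaar_affineSubspace μ (AffineSubspace.mk' (z i) (W i))
    fun h => hW i (by
      rw [← AffineSubspace.direction_mk' (z i) (W i), h, AffineSubspace.direction_top])
  rw [MeasureTheory.ae_iff]
  refine MeasureTheory.measure_mono_null (fun x hx => ?_) h
  simpa [AffineSubspace.mem_mk'] using hx

theorem exists_det2_eq {u : RealN} (hu : u ≠ 0) (r : ℝ) : ∃ z, det2 u z = r := by
  by_cases h : u 0 = 0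
  · have h1 : u 1 ≠ 0 := fun h1 => hu (by ext i; fin_cases i <;> assumption)
    exact ⟨![-(r / u 1), 0], by simp [det2]; field_simp⟩
  · exact ⟨![0, r / u 0], by simp [det2]; field_simp⟩

theorem exists_mem_open_det2_ne {ι : Type*} [Countable ι] (u : ι → RealN) (r : ι → ℝ)
    (hu : ∀ i, u i ≠ 0) {W : Set RealN} (hW : IsOpen W) (hne : W.Nonempty) :
    ∃ q ∈ W, ∀ i, det2 (u i) q ≠ r i := by
  choose z hz using fun i => exists_det2_eq (hu i) (r i)
  let f (i : ι) : RealN →ₗ[ℝ] ℝ :=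
    { toFun := fun x => det2 (u i) x
      map_add' := fun x y => det2_add_right _ _ _
      map_smul' := fun a x => det2_smul_right _ _ _ }
  have hf : ∀ i, LinearMap.ker (f i) ≠ ⊤ := by
    intro i h
    obtain ⟨x, hx⟩ := exists_det2_eq (hu i) 1
    have h1 : x ∈ LinearMap.ker (f i) := h ▸ Submodule.mem_top
    rw [LinearMap.mem_ker] at h1
    exact one_ne_zero (hx.symm.trans h1)
  obtain ⟨q, hq, hq'⟩ := (dense_compl_iUnion_translates _ hf z).inter_open_nonempty W hW hne
  refine ⟨q, hq, fun i h => hq' i ?_⟩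
  rw [LinearMap.mem_ker]
  change det2 _ _ = 0
  rw [det2_sub_right, h, hz, sub_self]

/-! ### A compact box containing a fundamental domain -/

section Lattice

variable {Λ : Submodule ℤ RealN}

theorem exists_latticeBasis [DiscreteTopology Λ] [IsZLattice ℝ Λ] :
    Nonempty (Module.Basis (Fin 2) ℤ Λ) := by
  have := ZLattice.module_free ℝ Λ
  have := ZLattice.module_finite ℝ Λ
  have h := ZLattice.rank ℝ Λ
  rw [Module.finrank_fintype_fun_eq_card, Fintype.card_fin] at h
  exact ⟨Module.finBasisOfFinrankEq ℤ Λ h⟩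

variable (b : Module.Basis (Fin 2) ℤ Λ)

theorem continuous_crossForm (k : Fin 2) : Continuous (crossForm b k) :=
  LinearMap.continuous_of_finiteDimensional _

theorem exists_lattice_crossInt (m : Fin 2 → ℤ) : ∃ l : Λ, ∀ k, crossInt b k l = m k := by
  obtain ⟨l, hl⟩ := (crossEquiv b).surjective m
  exact ⟨l, fun k => congrFun hl k⟩

variable [DiscreteTopology Λ] [IsZLattice ℝ Λ]

/-- The points with coordinates of absolute value at most `r`. -/
def latticeBox (r : ℝ) : Set RealN := {y | ∀ k, |crossForm b k y| ≤ r}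

theorem isCompact_latticeBox (r : ℝ) : IsCompact (latticeBox b r) := by
  have hcl : IsClosed (latticeBox b r) := by
    have : latticeBox b r = ⋂ k, {y | |crossForm b k y| ≤ r} := by
      ext y; simp [latticeBox]
    rw [this]
    exact isClosed_iInter fun k =>
      isClosed_le ((continuous_crossForm b k).abs) continuous_const
  let h : RealN → RealN := fun c => ((latticeSign b : ℝ) * c 1) • (b 0 : RealN) -
    ((latticeSign b : ℝ) * c 0) • (b 1 : RealN)
  have hh : Continuous h := by fun_prop
  have hK : IsCompact (Set.Icc (fun _ => -r : RealN) fun _ => r) := isCompact_Icc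
  refine (hK.image hh).of_isClosed_subset hcl fun y hy => ?_
  refine ⟨fun k => crossForm b k y, ⟨fun k => (abs_le.1 (hy k)).1, fun k => (abs_le.1 (hy k)).2⟩, ?_⟩
  exact (eq_crossForm b y).symm

theorem finite_lattice_inter_box (r : ℝ) : {l : Λ | (l : RealN) ∈ latticeBox b r}.Finite := by
  have h1 : (Set.pi Set.univ fun _ : Fin 2 => Set.Icc (-⌊r⌋) ⌊r⌋).Finite :=
    Set.Finite.pi fun _ => Set.finite_Icc _ _
  refine h1.of_injOn (f := fun l k => crossInt b k l) ?_ ?_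
  · intro l hl k _
    have := hl k
    rw [crossForm_coe, abs_le, ← neg_le] at this
    refine ⟨?_, Int.le_floor.2 this.2⟩
    rw [neg_le]
    exact Int.le_floor.2 (by push_cast; exact this.1)
  · intro l _ m _ h
    refine Subtype.ext ?_
    rw [eq_crossForm b (l : RealN), eq_crossForm b (m : RealN)]
    have h' : ∀ k, crossInt b k l = crossInt b k m := congrFun h
    simp only [crossForm_coe, h']

theorem exists_lift_mem_latticeBox (y : TropTorus Λ) : ∃ x ∈ latticeBox b 1, toTorus Λ x = y := by
  obtain ⟨x, rfl⟩ := Submodule.Quotient.mk_surjective Λ y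
  obtain ⟨l, hl⟩ := exists_lattice_crossInt b fun k => ⌊crossForm b k x⌋
  refine ⟨x - l, fun k => ?_, ?_⟩
  · rw [map_sub, crossForm_coe, hl, abs_le]
    constructor
    · linarith [Int.floor_le (crossForm b k x)]
    · linarith [Int.lt_floor_add_one (crossForm b k x)]
  · rw [TropCurve.toTorus_eq_iff, sub_sub_cancel_left]
    exact neg_mem l.2

end Lattice

/-! ### Affine pieces of theta functions -/

/-- On the segment from `q` to `z`, the function agrees with its affine piece near `q`; convexity
keeps it above that piece afterwards. -/
theorem ConvexOn.affine_le {θ : RealN → ℝ} (hθ : ConvexOn ℝ Set.univ θ) {a q : RealN} {c : ℝ}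
    (h : ∀ᶠ y in 𝓝 q, θ y = ∑ i, a i * y i + c) (z : RealN) : ∑ i, a i * z i + c ≤ θ z := by
  have h1 : Tendsto (fun t : ℝ => (1 - t) • q + t • z) (𝓝[>] 0) (𝓝 q) := by
    have : Continuous fun t : ℝ => (1 - t) • q + t • z := by fun_prop
    refine (this.tendsto' 0 q ?_).mono_left nhdsWithin_le_nhds
    simp
  obtain ⟨t, h2, h3, h4⟩ := ((h1.eventually h).and
    ((Ioo_mem_nhdsGT (zero_lt_one' ℝ)))).exists
  have h5 := hθ.2 (Set.mem_univ q) (Set.mem_univ z) (sub_nonneg.2 h4.le) h3.le (by ring)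
  rw [h2, h.self_of_nhds] at h5
  simp only [Fin.sum_univ_two, Pi.add_apply, Pi.smul_apply, smul_eq_mul] at h5 ⊢
  nlinarith

/-- An affine piece whose slope is none of the finitely many integral slopes near `q` would agree
with the integral pieces only along finitely many lines, and these do not cover a neighbourhood. -/
theorem PolarizedLineBundle.IsTheta.exists_slope {Λ : Submodule ℤ RealN}
    {L : PolarizedLineBundle Λ} {θ : RealN → ℝ} (hL : L.IsTheta θ) {a q : RealN} {c : ℝ}
    (h : ∀ᶠ y in 𝓝 q, θ y = ∑ i, a i * y i + c) : ∃ m : LatN, a = realify m := by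
  obtain ⟨F, hF⟩ := hL.piecewise_affine q
  obtain ⟨W, hW, hWo, hqW⟩ := eventually_nhds_iff.1 (h.and hF)
  by_contra! hc
  obtain ⟨y, hy, hy'⟩ := exists_mem_open_det2_ne
    (fun f : F => ![a 1 - f.1.1 1, -(a 0 - f.1.1 0)]) (fun f => f.1.2 - c) (fun f hf => by
      refine hc f.1.1 ?_
      have h0 := congrFun hf 0
      have h1 := congrFun hf 1
      simp only [Matrix.cons_val_zero, Matrix.cons_val_one, Pi.zero_apply] at h0 h1
      ext i
      fin_cases i
      · change a 0 = (f.1.1 0 : ℝ)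
        linarith
      · change a 1 = (f.1.1 1 : ℝ)
        linarith) hWo ⟨q, hqW⟩
  obtain ⟨h1, f, hf, h2⟩ := hW y hy
  refine hy' ⟨f, hf⟩ ?_
  rw [h1] at h2
  simp only [det2, Matrix.cons_val_zero, Matrix.cons_val_one]
  simp only [pairing, Fin.sum_univ_two] at h2
  linarith

/-- The slopes of a theta function at a point, evaluated on a period, are bounded. -/
theorem PolarizedLineBundle.IsTheta.slope_le {Λ : Submodule ℤ RealN}
    {L : PolarizedLineBundle Λ} {θ : RealN → ℝ} (hL : L.IsTheta θ) {a q : RealN} {c : ℝ}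
    (h : ∀ᶠ y in 𝓝 q, θ y = ∑ i, a i * y i + c) (l : Λ) :
    ∑ i, a i * (l : RealN) i ≤ pairing (L.chern l) q + L.shift l := by
  have h1 := hL.convex.affine_le h (q + l)
  rw [hL.quasi_periodic, h.self_of_nhds] at h1
  simp only [Pi.add_apply, mul_add, Finset.sum_add_distrib] at h1
  linarith

namespace TropCurve

variable {Λ : Submodule ℤ RealN} {Γ : TropCurve Λ} (b : Module.Basis (Fin 2) ℤ Λ)

/-- It suffices to avoid countably many lines: those of direction `b k` through the lattice
translates of the vertices, and those carrying the translates of the edges. -/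
theorem exists_generic (hΓ : ∀ e, Γ.slope e ≠ 0) {W : Set RealN} (hW : IsOpen W)
    (hne : W.Nonempty) : ∃ q ∈ W, (∀ k, Γ.LoopTransverse q (b k)) ∧
      ∀ e t, Γ.edgePoint e t ≠ toTorus Λ q := by
  choose x hx using fun v => Submodule.Quotient.mk_surjective Λ (Γ.pos v)
  have : Countable Λ := (crossEquiv b).injective.countable
  obtain ⟨q, hq, hq'⟩ := exists_mem_open_det2_ne
    (ι := (Γ.V × Λ × Fin 2) ⊕ (Γ.E × Λ))
    (Sum.elim (fun i => (b i.2.2 : RealN)) fun i => realify (Γ.slope i.1))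
    (Sum.elim (fun i => det2 (b i.2.2 : RealN) (x i.1 + i.2.1))
      fun i => det2 (realify (Γ.slope i.1)) (x (Γ.src i.1) + i.2)) (by
      rintro (⟨v, l, k⟩ | ⟨e, l⟩)
      · exact fun h => b.ne_zero k (Subtype.ext h)
      · exact fun h => hΓ e (realify_eq_zero.1 h)) hW hne
  refine ⟨q, hq, fun k v s _ _ h => ?_, fun e t h => ?_⟩
  · rw [← hx, toTorus_eq_iff] at h
    refine hq' (Sum.inl (v, ⟨_, h⟩, k)) ?_
    change det2 (b k : RealN) q = det2 (b k : RealN) (x v + (q + s • (b k : RealN) - x v))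
    rw [add_sub_cancel, det2_add_right, det2_smul_right, det2_self, mul_zero, add_zero]
  · rw [edgePoint_eq hx, eq_comm, toTorus_eq_iff] at h
    refine hq' (Sum.inr (e, ⟨_, h⟩)) ?_
    change det2 (realify (Γ.slope e)) q = det2 (realify (Γ.slope e))
      (x (Γ.src e) + (q - (x (Γ.src e) + t • realify (Γ.slope e))))
    rw [det2_add_right, det2_sub_right, det2_add_right, det2_smul_right, det2_self]
    ring

end TropCurve

/-! ### Finiteness of the combinatorial data of curves in a linear system -/

/-- The finite set is chosen before the index type, since the crossings that are summed vary with
the curve. -/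
theorem Set.Finite.exists_finite_sums {M : Type*} [AddCommMonoid M] {K : Set M} (hK : K.Finite)
    (m : ℕ) : ∃ K' : Set M, K'.Finite ∧ ∀ (ι : Type) (s : Finset ι) (f : ι → M), s.card ≤ m →
      (∀ i ∈ s, f i ∈ K) → ∑ i ∈ s, f i ∈ K' := by
  classical
  induction m with
  | zero =>
    refine ⟨{0}, Set.finite_singleton 0, fun ι s f hs _ => ?_⟩
    rw [Finset.card_eq_zero.1 (Nat.le_zero.1 hs), Finset.sum_empty]
    rfl
  | succ m ih =>
    obtain ⟨K', hK', h⟩ := ih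
    refine ⟨K' ∪ Set.image2 (· + ·) K K', hK'.union (hK.image2 _ hK'), fun ι s f hs hf => ?_⟩
    rcases s.eq_empty_or_nonempty with rfl | ⟨i, hi⟩
    · exact Or.inl (h ι ∅ f (by simp) (by simp))
    · rw [← Finset.add_sum_erase s f hi]
      refine Or.inr ⟨_, hf i hi, _, h ι _ f ?_ fun j hj => hf j (Finset.mem_of_mem_erase hj), rfl⟩
      rw [Finset.card_erase_of_mem hi]
      omega

theorem abs_le_abs_floor_sub_add_one (α r : ℝ) : |r| ≤ |((⌊α + r⌋ - ⌊α⌋ : ℤ) : ℝ)| + 1 := by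
  have h1 := Int.floor_le (α + r)
  have h2 := Int.lt_floor_add_one (α + r)
  have h3 := Int.floor_le α
  have h4 := Int.lt_floor_add_one α
  push_cast
  have h5 := le_abs_self ((⌊α + r⌋ : ℝ) - ⌊α⌋)
  have h6 := neg_le_abs ((⌊α + r⌋ : ℝ) - ⌊α⌋)
  rw [abs_le]
  constructor <;> linarith

theorem finite_realify_mem {K : Set RealN} (hK : Bornology.IsBounded K) :
    {m : LatN | realify m ∈ K}.Finite := by
  obtain ⟨R, hR⟩ := hK.exists_norm_le
  refine (Set.Finite.pi fun _ : Fin 2 => Set.finite_Icc (-⌊R⌋) ⌊R⌋).subset fun m hm i _ => ?_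
  have h := (norm_le_pi_norm (realify m) i).trans (hR _ hm)
  have h1 : |(m i : ℝ)| ≤ R := h
  rw [abs_le, ← neg_le] at h1
  refine ⟨?_, Int.le_floor.2 h1.2⟩
  rw [neg_le]
  exact Int.le_floor.2 (by push_cast; exact h1.1)

/-- Positivity makes `c` injective. If `c (b 0)` and `c (b 1)` were proportional, integral
combinations of the basis vectors with their coordinates as coefficients would lie in the kernel of
`c`. -/
theorem PolarizedLineBundle.eq_zero_of_pairing {Λ : Submodule ℤ RealN} (L : PolarizedLineBundle Λ)
    (b : Module.Basis (Fin 2) ℤ Λ) {y : RealN} (h : ∀ k, pairing (L.chern (b k)) y = 0) : y = 0 := by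
  set m₀ := L.chern (b 0) with hm₀
  set m₁ := L.chern (b 1) with hm₁
  have hinj : ∀ l, L.chern l = 0 → l = 0 := by
    intro l hl
    by_contra h0
    have := L.chern_pos l h0
    rw [hl] at this
    simp [pairing] at this
  have hdet : det2 m₀ m₁ ≠ 0 := by
    intro h0
    have h1 : ∀ i, m₀ i = 0 := by
      intro i
      have h2 : m₁ i • b 0 - m₀ i • b 1 = 0 := hinj _ (by
        rw [map_sub, map_smul, map_smul, ← hm₀, ← hm₁]
        unfold det2 at h0
        ext j
        fin_cases i <;> fin_cases j <;> simp <;> linarith)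
      have h3 := congrArg (fun l => b.repr l 1) h2
      simpa using h3
    exact b.ne_zero 0 (hinj _ (funext h1))
  refine eq_zero_of_det2_eq_zero (x := ![(m₀ 1 : ℝ), -m₀ 0]) (y := ![(m₁ 1 : ℝ), -m₁ 0]) ?_ ?_ ?_
  · intro h1
    refine hdet ?_
    simp only [det2, Matrix.cons_val_zero, Matrix.cons_val_one] at h1 ⊢
    have : (m₀ 0 : ℝ) * m₁ 1 - m₀ 1 * m₁ 0 = 0 := by linarith
    exact_mod_cast this
  · have := h 0
    simp only [pairing, Fin.sum_univ_two] at this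
    simp only [det2, Matrix.cons_val_zero, Matrix.cons_val_one]
    linarith
  · have := h 1
    simp only [pairing, Fin.sum_univ_two] at this
    simp only [det2, Matrix.cons_val_zero, Matrix.cons_val_one]
    linarith

section Lattice

variable {Λ : Submodule ℤ RealN} [DiscreteTopology Λ] [IsZLattice ℝ Λ]
  (b : Module.Basis (Fin 2) ℤ Λ)

theorem finite_abs_det2_le (C : ℝ) :
    {m : LatN | ∀ k, |det2 (realify m) (b k : RealN)| ≤ C}.Finite := by
  refine (finite_realify_mem (isCompact_latticeBox b (C / |latticeDet b|)).isBounded).subset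
    fun m hm k => ?_
  rw [crossForm_apply, abs_div, abs_abs]
  exact div_le_div_of_nonneg_right (hm k) (abs_nonneg _)

end Lattice

/-! ### Bounds on slopes, crossings and moments -/

namespace TropCurve

variable {Λ : Submodule ℤ RealN} {Γ : TropCurve Λ} {b : Module.Basis (Fin 2) ℤ Λ}

theorem crossSign_mul_det (k : Fin 2) (e : Γ.E) :
    Γ.crossSign (b k) e * det2 (realify (Γ.slope e)) (b k : RealN) =
      |det2 (realify (Γ.slope e)) (b k : RealN)| := by
  unfold crossSign
  split_ifs with h
  · rw [one_mul, abs_of_pos h]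
  · rw [neg_one_mul, abs_of_nonpos (not_lt.1 h)]

/-- The displacement along the edge is parallel to its slope and does not contribute. What remains
is the lattice vector comparing two lifts, hence discrete data. -/
theorem edgeCond_eq_det2_lattice (x : Γ.V → RealN) (e : Γ.E) :
    edgeCond Γ.src Γ.tgt Γ.slope x e = det2 (realify (Γ.slope e))
      (x (Γ.tgt e) - (x (Γ.src e) + Γ.length e • realify (Γ.slope e))) := by
  change det2 _ _ = _
  rw [det2_sub_right, det2_sub_right, det2_add_right, det2_smul_right, det2_self]
  ring

theorem lift_sub_mem_latticeBox {x : Γ.V → RealN} (hbox : ∀ v, x v ∈ latticeBox b 1)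
    {B : ℝ} {e : Γ.E} (hB : ∀ k, Γ.length e * |crossForm b k (realify (Γ.slope e))| ≤ B) :
    x (Γ.tgt e) - (x (Γ.src e) + Γ.length e • realify (Γ.slope e)) ∈ latticeBox b (B + 2) := by
  intro k
  simp only [map_sub, map_add, map_smul, smul_eq_mul]
  have h1 := hbox (Γ.tgt e) k
  have h2 := hbox (Γ.src e) k
  have h3 := hB k
  rw [← abs_of_pos (Γ.length_pos e), ← abs_mul] at h3
  rw [abs_le] at *
  constructor <;> linarith

theorem crossing_sub_mem_latticeBox {x : Γ.V → RealN} (hbox : ∀ v, x v ∈ latticeBox b 1)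
    {q : RealN} (hq : q ∈ latticeBox b 1) {k : Fin 2} {B : ℝ} {e : Γ.E}
    (hB : ∀ j, Γ.length e * |crossForm b j (realify (Γ.slope e))| ≤ B)
    {st : ℝ × ℝ} (hst : st ∈ Γ.crossSet q (b k) e) :
    q + st.1 • (b k : RealN) - (x (Γ.src e) + st.2 • realify (Γ.slope e)) ∈
      latticeBox b (B + 2 + ∑ i, ∑ j, |crossForm b i (b j)|) := by
  intro j
  simp only [map_sub, map_add, map_smul, smul_eq_mul]
  have h1 := hq j
  have h2 := hbox (Γ.src e) j
  have h3 : |st.2 * crossForm b j (realify (Γ.slope e))| ≤ B := by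
    rw [abs_mul, abs_of_pos hst.2.2.1]
    exact (mul_le_mul_of_nonneg_right hst.2.2.2.1.le (abs_nonneg _)).trans (hB j)
  have h4 : |st.1 * crossForm b j (b k)| ≤ ∑ i, ∑ j, |crossForm b i (b j)| := by
    rw [abs_mul, abs_of_nonneg hst.1]
    refine (mul_le_of_le_one_left (abs_nonneg _) hst.2.1.le).trans ?_
    refine (Finset.single_le_sum (f := fun k => |crossForm b j (b k)|)
      (fun _ _ => abs_nonneg _) (Finset.mem_univ k)).trans ?_
    exact Finset.single_le_sum (f := fun j => ∑ k, |crossForm b j (b k)|)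
      (fun _ _ => Finset.sum_nonneg fun _ _ => abs_nonneg _) (Finset.mem_univ j)
  rw [abs_le] at *
  constructor <;> linarith

theorem length_mul_abs_crossForm_le (x : Γ.V → RealN) (q : RealN) (k : Fin 2) (e : Γ.E) :
    Γ.length e * |crossForm b k (realify (Γ.slope e))| ≤
      |(Γ.signedCross (crossForm b k) x q e : ℝ)| + 1 := by
  rw [← abs_of_pos (Γ.length_pos e), ← abs_mul]
  exact abs_le_abs_floor_sub_add_one _ _

variable [DiscreteTopology Λ] [IsZLattice ℝ Λ] {L : PolarizedLineBundle Λ} {θ : RealN → ℝ}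

/-- By `theta_relations` at `y = b k`, the absolute values `|det(s, b k)|` over all crossings add up
to the right-hand side. So it is enough to choose a loop that crosses the edge. -/
theorem abs_det_slope_le (hΓ : Γ.IsImmersion) (hL : L.IsTheta θ) (hθ : Γ.IsLocalEquation θ)
    (k : Fin 2) (e : Γ.E) : |det2 (realify (Γ.slope e)) (b k : RealN)| ≤
      pairing (L.chern (b k)) (b k : RealN) := by
  by_cases hD : det2 (realify (Γ.slope e)) (b k : RealN) = 0
  · rw [hD, abs_zero]
    exact (L.chern_pos _ (b.ne_zero k)).le
  choose x hx using fun v => Submodule.Quotient.mk_surjective Λ (Γ.pos v)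
  set s := realify (Γ.slope e) with hs
  set D := det2 s (b k : RealN) with hDdef
  -- These are the coordinates in `q = x + τ s - σ b_k`: in the open parallelogram below, the loop
  -- based at `q` meets the edge at time `σ`, at the point of parameter `τ`.
  let τ : RealN → ℝ := fun q => det2 (q - x (Γ.src e)) (b k : RealN) / D
  let σ : RealN → ℝ := fun q => det2 (q - x (Γ.src e)) s / D
  have hτ : Continuous τ := by unfold τ det2; fun_prop
  have hσ : Continuous σ := by unfold σ det2; fun_prop
  have hW : IsOpen {q | (0 < τ q ∧ τ q < Γ.length e) ∧ 0 < σ q ∧ σ q < 1} :=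
    ((isOpen_lt continuous_const hτ).inter (isOpen_lt hτ continuous_const)).inter
      ((isOpen_lt continuous_const hσ).inter (isOpen_lt hσ continuous_const))
  obtain ⟨q, ⟨⟨h1, h2⟩, h3, h4⟩, hq, hq0⟩ := exists_generic (Γ := Γ) b hΓ.slope_ne_zero hW (by
    refine ⟨x (Γ.src e) + ((Γ.length e / 2) • s - (1 / 2 : ℝ) • (b k : RealN)), ?_⟩
    have e1 : τ (x (Γ.src e) + ((Γ.length e / 2) • s - (1 / 2 : ℝ) • (b k : RealN))) =
        Γ.length e / 2 := by
      simp only [τ]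
      rw [add_sub_cancel_left, det2_sub_left, det2_smul_left, det2_smul_left, det2_self, ← hDdef]
      field_simp
      ring
    have e2 : σ (x (Γ.src e) + ((Γ.length e / 2) • s - (1 / 2 : ℝ) • (b k : RealN))) = 1 / 2 := by
      simp only [σ]
      rw [add_sub_cancel_left, det2_sub_left, det2_smul_left, det2_smul_left, det2_self,
        det2_comm (b k : RealN), ← hDdef]
      field_simp
      ring
    have := Γ.length_pos e
    simp only [Set.mem_ofPred_eq, e1, e2]
    refine ⟨⟨?_, ?_⟩, ?_, ?_⟩ <;> linarith)
  have hmem : (σ q, τ q) ∈ Γ.crossSet q (b k) e := by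
    refine ⟨h3.le, h4, h1, h2, ?_⟩
    rw [edgePoint_eq hx, ← hs]
    congr 1
    have h5 := det2_cramer (q - x (Γ.src e)) s (b k : RealN)
    have h6 : q - x (Γ.src e) = D⁻¹ • (D • (q - x (Γ.src e))) := by
      rw [smul_smul, inv_mul_cancel₀ hD, one_smul]
    rw [← hDdef] at h5
    rw [h5, smul_sub, smul_smul, smul_smul] at h6
    simp only [τ, σ, div_eq_inv_mul]
    rw [← sub_eq_zero]
    refine Eq.trans ?_ (sub_eq_zero.2 h6)
    abel
  obtain ⟨-, -, -, h5, -⟩ := theta_relations hL hθ (hq k) fun e t _ _ => hq0 e t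
  rw [← h5]
  simp only [crossSign_mul_det]
  have h6 := Finset.single_le_sum (f := fun e => ∑ _st ∈ (crossSet_finite (hq k) e).toFinset,
    |det2 (realify (Γ.slope e)) (b k : RealN)|) (fun _ _ => Finset.sum_nonneg fun _ _ => abs_nonneg _)
    (Finset.mem_univ e)
  refine le_trans ?_ h6
  exact Finset.single_le_sum (f := fun _ => |det2 (realify (Γ.slope e)) (b k : RealN)|)
    (fun _ _ => abs_nonneg _) ((Set.Finite.mem_toFinset _).2 hmem)

theorem crossSign_mul_card {x : Γ.V → RealN} (hx : ∀ v, toTorus Λ (x v) = Γ.pos v)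
    {q : RealN} {k : Fin 2} (hq : Γ.LoopTransverse q (b k)) (e : Γ.E) :
    Γ.crossSign (b k) e * (crossSet_finite hq e).toFinset.card =
      Γ.signedCross (crossForm b k) x q e := by
  have h := crossings_eq_signedCross hx hq e
  rw [crossings_eq, Set.ncard_eq_toFinset_card _ (crossSet_finite hq e)] at h
  unfold crossSign
  split_ifs with h1
  · rw [if_pos h1] at h
    rw [one_mul]
    exact_mod_cast h
  · rw [if_neg h1, eq_neg_iff_add_eq_zero, add_comm, ← eq_neg_iff_add_eq_zero] at h
    rw [neg_one_mul]
    exact_mod_cast h.symm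

theorem card_crossSet {x : Γ.V → RealN} (hx : ∀ v, toTorus Λ (x v) = Γ.pos v)
    {q : RealN} {k : Fin 2} (hq : Γ.LoopTransverse q (b k)) (e : Γ.E) :
    ((crossSet_finite hq e).toFinset.card : ℝ) =
      |(Γ.signedCross (crossForm b k) x q e : ℝ)| := by
  rw [← crossSign_mul_card hx hq, abs_mul, Nat.abs_cast]
  rcases Γ.crossSign_eq (b k) e with h | h <;> simp [h]

theorem sum_signedCross_mul_det {x : Γ.V → RealN} (hx : ∀ v, toTorus Λ (x v) = Γ.pos v)
    {q : RealN} {k : Fin 2} (hq : Γ.LoopTransverse q (b k)) (y : Γ.E → RealN) :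
    ∑ e, ∑ _st ∈ (crossSet_finite hq e).toFinset,
      Γ.crossSign (b k) e * det2 (realify (Γ.slope e)) (y e) =
    ∑ e, Γ.signedCross (crossForm b k) x q e * det2 (realify (Γ.slope e)) (y e) := by
  refine Finset.sum_congr rfl fun e _ => ?_
  rw [Finset.sum_const, nsmul_eq_mul, ← crossSign_mul_card hx hq]
  ring

theorem abs_signedCross_le (hL : L.IsTheta θ) (hθ : Γ.IsLocalEquation θ)
    {x : Γ.V → RealN} (hx : ∀ v, toTorus Λ (x v) = Γ.pos v) {q : RealN} {k : Fin 2}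
    (hq : Γ.LoopTransverse q (b k)) (hq0 : ∀ e t, Γ.edgePoint e t ≠ toTorus Λ q) (e : Γ.E)
    {B : ℝ} (hB : pairing (L.chern (b k)) (b k : RealN) /
      |det2 (realify (Γ.slope e)) (b k : RealN)| ≤ B) :
    |(Γ.signedCross (crossForm b k) x q e : ℝ)| ≤ B := by
  by_cases hD : det2 (realify (Γ.slope e)) (b k : RealN) = 0
  · rw [hD, abs_zero, div_zero] at hB
    have : Γ.signedCross (crossForm b k) x q e = 0 := by
      rw [signedCross, crossForm_apply _ _ (realify (Γ.slope e)), hD, zero_div, mul_zero, add_zero,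
        sub_self]
    rwa [this, Int.cast_zero, abs_zero]
  · obtain ⟨-, -, -, h5, -⟩ := theta_relations hL hθ hq fun e t _ _ => hq0 e t
    refine le_trans ?_ hB
    rw [le_div_iff₀ (abs_pos.2 hD), ← h5, ← card_crossSet hx hq]
    simp only [crossSign_mul_det, Finset.sum_const, nsmul_eq_mul]
    exact Finset.single_le_sum (f := fun e => ((crossSet_finite hq e).toFinset.card : ℝ) *
      |det2 (realify (Γ.slope e)) (b k : RealN)|)
      (fun e _ => mul_nonneg (Nat.cast_nonneg _) (abs_nonneg _)) (Finset.mem_univ e)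

/-- The moments of a curve defined by a theta function are determined, up to integral data, by the
line bundle. -/
theorem momentCond_eq {x : Γ.V → RealN} (hx : ∀ v, toTorus Λ (x v) = Γ.pos v) {q : RealN}
    {k : Fin 2} (hq : Γ.LoopTransverse q (b k)) {N : Fin 2 → Γ.E → ℤ}
    (hN : N k = Γ.signedCross (crossForm b k) x q) {κ : ℝ}
    (h : ∑ e, ∑ st ∈ (crossSet_finite hq e).toFinset,
      Γ.crossSign (b k) e * det2 (realify (Γ.slope e)) (q + st.1 • (b k : RealN)) = κ) :
    momentCond Γ.src Γ.slope N x k = κ - ∑ i ∈ Finset.univ.sigma fun e =>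
      (crossSet_finite hq e).toFinset, Γ.crossSign (b k) i.1 * det2 (realify (Γ.slope i.1))
        (q + i.2.1 • (b k : RealN) - (x (Γ.src i.1) + i.2.2 • realify (Γ.slope i.1))) := by
  change ∑ e, (N k e : ℝ) * _ = _
  rw [hN, ← sum_signedCross_mul_det hx hq, ← h, Finset.sum_sigma, ← Finset.sum_sub_distrib]
  refine Finset.sum_congr rfl fun e _ => ?_
  rw [← Finset.sum_sub_distrib]
  refine Finset.sum_congr rfl fun st _ => ?_
  rw [det2_sub_right _ _ (realify _), det2_add_right (x (Γ.src e)), det2_smul_right st.2, det2_self]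
  ring

/-- The Chern class bounds slopes and crossing numbers, and thereby the increments along edges and
the lattice vectors comparing lifts. Convexity bounds the integral slope of `θ` near `q`. The
moments of the lifted vertices are then a constant of the bundle plus terms from finite sets,
although `θ` itself varies. -/
theorem exists_finite_types (b : Module.Basis (Fin 2) ℤ Λ) (L : PolarizedLineBundle Λ) (m : ℕ) :
    ∃ (S : Set LatN) (Z : Set ℤ) (K : Set ℝ), S.Finite ∧ Z.Finite ∧ K.Finite ∧
      ∀ (Γ : TropCurve Λ) (x : Γ.V → RealN), Γ.IsImmersion → Γ.InLinearSystem L →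
        Fintype.card Γ.E ≤ m → (∀ v, toTorus Λ (x v) = Γ.pos v) → (∀ v, x v ∈ latticeBox b 1) →
        ∃ N : Fin 2 → Γ.E → ℤ, (∀ e, Γ.slope e ∈ S) ∧ (∀ k e, N k e ∈ Z) ∧
          (∀ e, edgeCond Γ.src Γ.tgt Γ.slope x e ∈ K) ∧
          (∀ k, momentCond Γ.src Γ.slope N x k ∈ K) ∧
          (∀ y : RealN, (∀ k, ∑ e, N k e * det2 (realify (Γ.slope e)) y = 0) → y = 0) ∧
          ∀ z : Γ.E → ℤ, Γ.boundary z = 0 → Γ.period z = 0 → ∀ k, ∑ e, N k e * z e = 0 := by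
  let C : Fin 2 → ℝ := fun k => pairing (L.chern (b k)) (b k : RealN)
  have hC : ∀ k, 0 < C k := fun k => L.chern_pos _ (b.ne_zero k)
  let S : Set LatN := {s | ∀ k, |det2 (realify s) (b k : RealN)| ≤ ∑ k, C k}
  have hS : S.Finite := finite_abs_det2_le b _
  let B : ℝ := ∑ s ∈ hS.toFinset, ∑ k, C k / |det2 (realify s) (b k : RealN)|
  have hB : ∀ s ∈ S, ∀ k, C k / |det2 (realify s) (b k : RealN)| ≤ B := by
    intro s hs k
    have h0 : ∀ s k, 0 ≤ C k / |det2 (realify s) (b k : RealN)| := fun s k =>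
      div_nonneg (hC k).le (abs_nonneg _)
    refine (Finset.single_le_sum (f := fun k => C k / |det2 (realify s) (b k : RealN)|)
      (fun k _ => h0 s k) (Finset.mem_univ k)).trans ?_
    exact Finset.single_le_sum (f := fun s => ∑ k, C k / |det2 (realify s) (b k : RealN)|)
      (fun s _ => Finset.sum_nonneg fun k _ => h0 s k) (hS.mem_toFinset.2 hs)
  let R : ℝ := B + 1 + 2 + ∑ i, ∑ j, |crossForm b i (b j)|
  let T : Set Λ := {l | (l : RealN) ∈ latticeBox b R}
  have hT : T.Finite := finite_lattice_inter_box b R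
  let K₁ : Set ℝ := Set.image2 (fun (s : LatN) (l : Λ) => det2 (realify s) (l : RealN)) S T
  have hK₁ : K₁.Finite := hS.image2 _ hT
  -- At most `m` edges are each crossed at most `⌊B⌋` times; both signs of crossing occur.
  obtain ⟨K₂, hK₂, hK₂'⟩ := (hK₁.union (hK₁.image Neg.neg)).exists_finite_sums (m * ⌊B⌋₊)
  have hbd : ∀ l : Λ, ∃ A : ℝ, ∀ q ∈ latticeBox b 1, pairing (L.chern l) q + L.shift l ≤ A := by
    intro l
    have hc : Continuous fun q => pairing (L.chern l) q + L.shift l := by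
      unfold pairing; fun_prop
    obtain ⟨A, hA⟩ := (isCompact_latticeBox b 1).bddAbove_image hc.continuousOn
    exact ⟨A, fun q hq => hA ⟨q, hq, rfl⟩⟩
  choose A hA using hbd
  let A' : ℝ := ∑ k, (|A (b k)| + |A (-b k)|)
  let S' : Set LatN := {s | ∀ k, |det2 (realify s) (b k : RealN)| ≤ A'}
  have hS' : S'.Finite := finite_abs_det2_le b _
  let K₃ : Set ℝ := ⋃ k, Set.image2 (fun (s : LatN) (r : ℝ) =>
    det2 (realify s) (b k : RealN) + C k - L.shift (b k) - r) S' K₂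
  refine ⟨S, {z : ℤ | |(z : ℝ)| ≤ B}, K₁ ∪ K₃, hS, ?_, hK₁.union (Set.finite_iUnion fun k =>
    hS'.image2 _ hK₂), fun Γ x hΓ hLin hm hx hbox => ?_⟩
  · refine (Set.finite_Icc (-⌊B⌋) ⌊B⌋).subset fun z hz => ?_
    have hz' : |(z : ℝ)| ≤ B := hz
    rw [abs_le] at hz'
    rw [← neg_le] at hz'
    refine ⟨?_, Int.le_floor.2 hz'.2⟩
    rw [neg_le]
    exact Int.le_floor.2 (by push_cast; exact hz'.1)
  obtain ⟨θ, hL, hθ⟩ := hLin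
  have hθ : Γ.IsLocalEquation θ := hθ
  have hopen : IsOpen {y | ∀ k, |crossForm b k y| < 1} := by
    rw [Set.ofPred_forall]
    exact isOpen_iInter_of_finite fun k =>
      isOpen_lt (continuous_crossForm b k).abs continuous_const
  obtain ⟨q, hqbox, hq, hq0⟩ := exists_generic (Γ := Γ) b hΓ.slope_ne_zero hopen
    ⟨0, fun k => by rw [map_zero, abs_zero]; exact one_pos⟩
  have hqbox : q ∈ latticeBox b 1 := fun k => (hqbox k).le
  have hslope : ∀ e, Γ.slope e ∈ S := fun e k => (abs_det_slope_le hΓ hL hθ k e).trans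
    (Finset.single_le_sum (f := C) (fun k _ => (hC k).le) (Finset.mem_univ k))
  have hcross : ∀ k e, |(Γ.signedCross (crossForm b k) x q e : ℝ)| ≤ B := fun k e =>
    abs_signedCross_le hL hθ hx (hq k) hq0 e (hB _ (hslope e) k)
  have hlen : ∀ e k, Γ.length e * |crossForm b k (realify (Γ.slope e))| ≤ B + 1 := fun e k =>
    (length_mul_abs_crossForm_le x q k e).trans (by linarith [hcross k e])
  refine ⟨fun k => Γ.signedCross (crossForm b k) x q, hslope, hcross, fun e => Or.inl ?_,
    fun k => Or.inr ?_, ?_, ?_⟩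
  · rw [edgeCond_eq_det2_lattice]
    refine ⟨_, hslope e, ⟨_, lift_tgt_sub_mem hx e⟩, fun k => ?_, rfl⟩
    refine (lift_sub_mem_latticeBox hbox (hlen e) k).trans ?_
    exact le_add_of_nonneg_right (Finset.sum_nonneg fun _ _ => Finset.sum_nonneg fun _ _ =>
      abs_nonneg _)
  · obtain ⟨a, c, h1, -, h2⟩ := theta_relations hL hθ (hq k) fun e t _ _ => hq0 e t
    obtain ⟨s, rfl⟩ := hL.exists_slope h1
    rw [momentCond_eq hx (hq k) rfl h2]
    -- A quarter turn writes the pairing with the slope of `θ` as a determinant, so that the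
    -- finiteness of `S'` applies; the bounds come from `slope_le` for `b j` and `-b j`.
    have hdet : ∀ j, det2 (realify ![s 1, -s 0]) (b j : RealN) = ∑ i, realify s i * (b j : RealN) i := by
      intro j
      simp [det2, realify]
      ring
    have key : ∀ r ∈ K₂, ∑ i, realify s i * (b k : RealN) i +
        pairing (L.chern (b k)) (b k : RealN) - L.shift (b k) - r ∈ K₃ := by
      intro r hr
      refine Set.mem_iUnion.2 ⟨k, ![s 1, -s 0], fun j => ?_, r, hr, ?_⟩
      · rw [hdet]
        have e1 := (hL.slope_le h1 (b j)).trans (hA _ q hqbox)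
        have e2 := (hL.slope_le h1 (-b j)).trans (hA _ q hqbox)
        have e3 : |A (b j)| + |A (-b j)| ≤ A' :=
          Finset.single_le_sum (f := fun k => |A (b k)| + |A (-b k)|)
            (fun _ _ => add_nonneg (abs_nonneg _) (abs_nonneg _)) (Finset.mem_univ j)
        simp only [Submodule.coe_neg, Pi.neg_apply, mul_neg, Finset.sum_neg_distrib] at e2
        rw [abs_le]
        constructor <;> linarith [le_abs_self (A (b j)), le_abs_self (A (-b j)), abs_nonneg (A (b j)),
          abs_nonneg (A (-b j))]
      · simp only [hdet, C]
    refine key _ (hK₂' _ _ _ ?_ ?_)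
    · rw [Finset.card_sigma]
      refine (Finset.sum_le_card_nsmul _ _ ⌊B⌋₊ fun e _ => ?_).trans ?_
      · refine Nat.le_floor ?_
        rw [card_crossSet hx (hq k)]
        exact hcross k e
      · rw [Finset.card_univ, smul_eq_mul]
        exact Nat.mul_le_mul_right _ hm
    · rintro ⟨e, st⟩ hst
      have hst' := (Set.Finite.mem_toFinset _).1 (Finset.mem_sigma.1 hst).2
      have hmem : det2 (realify (Γ.slope e)) (q + st.1 • (b k : RealN) -
          (x (Γ.src e) + st.2 • realify (Γ.slope e))) ∈ K₁ := by
        have hst2 := hst'.2.2.2.2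
        rw [edgePoint_eq hx, toTorus_eq_iff] at hst2
        exact ⟨_, hslope e, ⟨_, hst2⟩, crossing_sub_mem_latticeBox hbox hqbox (hlen e) hst', rfl⟩
      rcases Γ.crossSign_eq (b k) e with h3 | h3
      · left
        simpa only [h3, one_mul] using hmem
      · right
        refine ⟨_, hmem, ?_⟩
        simp only [h3, neg_one_mul]
  · intro y hy
    refine L.eq_zero_of_pairing b fun k => ?_
    obtain ⟨-, -, -, h1, -⟩ := theta_relations hL hθ (hq k) fun e t _ _ => hq0 e t
    rw [← h1, sum_signedCross_mul_det hx (hq k) fun _ => y]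
    exact hy k
  · intro z hz hz0 k
    have := sum_signedCross (b := b) hx q k hz
    rw [hz0, map_zero] at this
    exact_mod_cast this

end TropCurve

/-! ### Generic configurations -/

section Solutions

variable {V E : Type*} [Fintype E] (src tgt : E → V) (s : E → LatN)
  (N : Fin 2 → E → ℤ) {n : ℕ} (p : Fin n → V)

/-- The positions of the marked points of the curves with given combinatorial data and vertices in
the fundamental box. -/
def markedPositions {Λ : Submodule ℤ RealN} (b : Module.Basis (Fin 2) ℤ Λ) (κ : E → ℝ)
    (μ : Fin 2 → ℝ) : Set (Fin n → RealN) :=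
  {P | ∃ x : V → RealN, (∀ v, x v ∈ latticeBox b 1) ∧ edgeCond src tgt s x = κ ∧
    momentCond src s N x = μ ∧ x ∘ p = P}

theorem isCompact_markedPositions [Finite V] {Λ : Submodule ℤ RealN} [DiscreteTopology Λ] [IsZLattice ℝ Λ]
    (b : Module.Basis (Fin 2) ℤ Λ) (κ : E → ℝ) (μ : Fin 2 → ℝ) :
    IsCompact (markedPositions src tgt s N p b κ μ) := by
  have h1 : IsCompact (Set.pi Set.univ fun _ : V => latticeBox b 1) :=
    isCompact_univ_pi fun _ => isCompact_latticeBox b 1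
  have h2 : IsClosed {x : V → RealN | edgeCond src tgt s x = κ ∧ momentCond src s N x = μ} :=
    (isClosed_eq (LinearMap.continuous_of_finiteDimensional _) continuous_const).inter
      (isClosed_eq (LinearMap.continuous_of_finiteDimensional _) continuous_const)
  have h3 : Continuous fun x : V → RealN => x ∘ p := by fun_prop
  convert (h1.inter_right h2).image h3 using 1
  ext P
  constructor
  · rintro ⟨x, hx, h4, h5, h6⟩
    exact ⟨x, ⟨fun v _ => hx v, h4, h5⟩, h6⟩
  · rintro ⟨x, ⟨hx, h4, h5⟩, h6⟩
    exact ⟨x, fun v => hx v trivial, h4, h5, h6⟩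

variable {src tgt s N p}

/-- Two solutions of the same affine system differ by an infinitesimal deformation, so the positions
of the marks lie in one translate of a space which is proper by non-regularity. -/
theorem exists_submodule_of_not_isRegularMarking (h : ¬IsRegularMarking src tgt s N p)
    {Λ : Submodule ℤ RealN} (b : Module.Basis (Fin 2) ℤ Λ) (κ : E → ℝ) (μ : Fin 2 → ℝ) :
    ∃ (W : Submodule ℝ (Fin n → RealN)) (z : Fin n → RealN), W ≠ ⊤ ∧
      ∀ P ∈ markedPositions src tgt s N p b κ μ, P - z ∈ W := by
  let W : Submodule ℝ (Fin n → RealN) :=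
    (LinearMap.ker (edgeCond src tgt s) ⊓ LinearMap.ker (momentCond src s N)).map
      (LinearMap.funLeft ℝ RealN p)
  have hW : W ≠ ⊤ := by
    intro hW
    refine h fun P => ?_
    obtain ⟨x, ⟨h1, h2⟩, h3⟩ : P ∈ W := hW ▸ Submodule.mem_top
    exact ⟨x, h1, h2, congrFun h3⟩
  rcases (markedPositions src tgt s N p b κ μ).eq_empty_or_nonempty with h0 | ⟨P₀, x₀, -, h1, h2, h3⟩
  · exact ⟨W, 0, hW, by simp [h0]⟩
  · refine ⟨W, P₀, hW, ?_⟩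
    rintro P ⟨x, -, h1', h2', h3'⟩
    refine ⟨x - x₀, ⟨?_, ?_⟩, ?_⟩
    · exact LinearMap.mem_ker.2 (by rw [map_sub, h1, h1', sub_self])
    · exact LinearMap.mem_ker.2 (by rw [map_sub, h2, h2', sub_self])
    · rw [← h3, ← h3']
      rfl

end Solutions

section Reindex

variable {V E V' E' : Type*} (eV : V ≃ V')
  (eE : E ≃ E') {src tgt : E → V} {s : E → LatN} {N : Fin 2 → E → ℤ} {n : ℕ} {p : Fin n → V}

theorem edgeCond_reindex (φ : V' → RealN) (e : E') :
    edgeCond (eV ∘ src ∘ eE.symm) (eV ∘ tgt ∘ eE.symm) (s ∘ eE.symm) φ e =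
      edgeCond src tgt s (φ ∘ eV) (eE.symm e) :=
  rfl

theorem momentCond_reindex [Fintype E] [Fintype E'] (φ : V' → RealN) :
    momentCond (eV ∘ src ∘ eE.symm) (s ∘ eE.symm) (fun k => N k ∘ eE.symm) φ =
      momentCond src s N (φ ∘ eV) :=
  funext fun k => eE.symm.sum_comp fun e => N k e * det2 (realify (s e)) (φ (eV (src e)))

theorem IsRegularMarking.of_reindex [Fintype E] [Fintype E'] (h : IsRegularMarking (eV ∘ src ∘ eE.symm)
    (eV ∘ tgt ∘ eE.symm) (s ∘ eE.symm) (fun k => N k ∘ eE.symm) (eV ∘ p)) :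
    IsRegularMarking src tgt s N p := by
  intro P
  obtain ⟨φ, h1, h2, h3⟩ := h P
  refine ⟨φ ∘ eV, funext fun e => ?_, ?_, h3⟩
  · have := congrFun h1 (eE e)
    rwa [edgeCond_reindex, eE.symm_apply_apply] at this
  · rwa [momentCond_reindex] at h2

end Reindex

/-- Compactness makes the finite union of images closed in the torus. Its preimage consists of
translates of the `K i` by the countable group `Λ^n`, hence lies in countably many proper affine
subspaces. -/
theorem exists_open_dense_compl {Λ : Submodule ℤ RealN} [DiscreteTopology Λ] [IsZLattice ℝ Λ]
    {n : ℕ} {ι : Type*} [Finite ι] (K : ι → Set (Fin n → RealN)) (hK : ∀ i, IsCompact (K i))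
    (hW : ∀ i, ∃ (W : Submodule ℝ (Fin n → RealN)) (z : Fin n → RealN), W ≠ ⊤ ∧
      ∀ P ∈ K i, P - z ∈ W) :
    ∃ U : Set (Fin n → TropTorus Λ), IsOpen U ∧ Dense U ∧
      ∀ i, ∀ P ∈ K i, (fun j => toTorus Λ (P j)) ∉ U := by
  obtain ⟨b⟩ := exists_latticeBasis (Λ := Λ)
  have : Countable Λ := (crossEquiv b).injective.countable
  choose W z hW hz using hW
  let π : (Fin n → RealN) → (Fin n → TropTorus Λ) := fun P j => toTorus Λ (P j)
  have hπ : Continuous π :=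
    continuous_pi fun j => (Submodule.continuous_mkQ Λ).comp (continuous_apply j)
  have hsurj : Function.Surjective π := fun P => by
    choose x hx using fun j => Submodule.Quotient.mk_surjective Λ (P j)
    exact ⟨x, funext hx⟩
  have : IsClosed (Λ : Set RealN) := AddSubgroup.isClosed_of_discrete (H := Λ.toAddSubgroup)
  refine ⟨(⋃ i, π '' K i)ᶜ, ?_, ?_, fun i P hP h => h (Set.mem_iUnion.2 ⟨i, P, hP, rfl⟩)⟩
  · exact (isCompact_iUnion fun i => (hK i).image hπ).isClosed.isOpen_compl
  · have hd := dense_compl_iUnion_translates (ι := ι × (Fin n → Λ)) (fun i => W i.1)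
      (fun i => hW i.1) fun i => z i.1 + fun j => (i.2 j : RealN)
    refine (hsurj.denseRange.dense_image hπ hd).mono ?_
    rintro _ ⟨P, hP, rfl⟩ h
    obtain ⟨i, P', hP', h⟩ := Set.mem_iUnion.1 h
    have hj : ∀ j, P j - P' j ∈ Λ := fun j => TropCurve.toTorus_eq_iff.1 (congrFun h j).symm
    refine hP (i, fun j => ⟨_, hj j⟩) ?_
    convert hz i P' hP' using 1
    ext j : 1
    change P j - (z i j + (P j - P' j)) = P' j - z i j
    abel

theorem exists_generic_configurations {Λ : Submodule ℤ RealN} [DiscreteTopology Λ] [IsZLattice ℝ Λ]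
    (L : PolarizedLineBundle Λ) (n : ℕ) :
    ∃ U : Set (Fin n → TropTorus Λ), IsOpen U ∧ Dense U ∧
      ∀ P ∈ U, ∀ (Γ : TropCurve Λ) (p : Fin n → Γ.V), Γ.IsSimpleMarked p → Γ.genus = n + 2 →
        (∀ i, Γ.pos (p i) = P i) → Γ.InLinearSystem L →
        ∃ N : Fin 2 → Γ.E → ℤ, IsRegularMarking Γ.src Γ.tgt Γ.slope N p ∧
          (∀ y : RealN, (∀ k, ∑ e, N k e * det2 (realify (Γ.slope e)) y = 0) → y = 0) ∧
          ∀ z : Γ.E → ℤ, Γ.boundary z = 0 → Γ.period z = 0 → ∀ k, ∑ e, N k e * z e = 0 := by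
  obtain ⟨b⟩ := exists_latticeBasis (Λ := Λ)
  -- The number of edges is `3 * (n + 2) - 3` plus the number of bivalent vertices, which is at most
  -- `n`.
  obtain ⟨S, Z, K, hS, hZ, hK, key⟩ := TropCurve.exists_finite_types b L (4 * n + 3)
  have := hS.to_subtype
  have := hZ.to_subtype
  have := hK.to_subtype
  -- Graphs are transported to the sets `Fin`, so that the data to be discarded form a finite type
  -- and the excluded compact sets are finitely many.
  let D : Fin (4 * n + 4) × Fin (4 * n + 4) → Type := fun a =>
    (Fin a.2 → Fin a.1) × (Fin a.2 → Fin a.1) × (Fin a.2 → S) × (Fin 2 → Fin a.2 → Z) ×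
      (Fin n → Fin a.1) × (Fin a.2 → K) × (Fin 2 → K)
  let reg : (a : Fin (4 * n + 4) × Fin (4 * n + 4)) → D a → Prop := fun a d =>
    IsRegularMarking d.1 d.2.1 (fun e => (d.2.2.1 e : LatN)) (fun k e => (d.2.2.2.1 k e : ℤ))
      d.2.2.2.2.1
  let ι := Σ a, {d : D a // ¬reg a d}
  have : Finite ι := by
    have : ∀ a, Finite (D a) := fun a => by
      dsimp only [D]; infer_instance
    infer_instance
  obtain ⟨U, hU, hU', hUK⟩ := exists_open_dense_compl (Λ := Λ)
    (fun i : ι => markedPositions i.2.1.1 i.2.1.2.1 (fun e => (i.2.1.2.2.1 e : LatN))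
      (fun k e => (i.2.1.2.2.2.1 k e : ℤ)) i.2.1.2.2.2.2.1 b
      (fun e => (i.2.1.2.2.2.2.2.1 e : ℝ)) fun k => (i.2.1.2.2.2.2.2.2 k : ℝ))
    (fun i => isCompact_markedPositions _ _ _ _ _ _ _ _)
    (fun i => exists_submodule_of_not_isRegularMarking i.2.2 b _ _)
  refine ⟨U, hU, hU', fun P hP Γ p hΓ hg hpos hL => ?_⟩
  have hbiv : Γ.bivalent.card ≤ n := by
    classical
    have hsub : Γ.bivalent ⊆ Finset.univ.image p := by
      intro v hv
      rw [TropCurve.mem_bivalent] at hv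
      rcases hΓ.valence_eq v with h2 | ⟨-, i, rfl⟩
      · omega
      · exact Finset.mem_image_of_mem _ (Finset.mem_univ _)
    exact (Finset.card_le_card hsub).trans (Finset.card_image_le.trans (by simp))
  obtain ⟨hV, hE⟩ := hΓ.card_vertices
  choose x hbox hx using fun v => exists_lift_mem_latticeBox b (Γ.pos v)
  obtain ⟨N, h1, h2, h3, h4, h5, h6⟩ := key Γ x hΓ.immersion hL (by omega) hx hbox
  refine ⟨N, ?_, h5, h6⟩
  by_contra hreg
  let eV := Fintype.equivFin Γ.V
  let eE := Fintype.equivFin Γ.E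
  let a : Fin (4 * n + 4) × Fin (4 * n + 4) :=
    (⟨Fintype.card Γ.V, by omega⟩, ⟨Fintype.card Γ.E, by omega⟩)
  let d : D a := (eV ∘ Γ.src ∘ eE.symm, eV ∘ Γ.tgt ∘ eE.symm, fun e => ⟨_, h1 (eE.symm e)⟩,
    fun k e => ⟨_, h2 k (eE.symm e)⟩, eV ∘ p, fun e => ⟨_, h3 (eE.symm e)⟩, fun k => ⟨_, h4 k⟩)
  have hd : ¬reg a d := fun h => hreg (IsRegularMarking.of_reindex eV eE h)
  refine hUK ⟨a, d, hd⟩ (fun i => x (p i)) ⟨x ∘ eV.symm, fun v => hbox _, ?_, ?_, ?_⟩ ?_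
  · ext e
    change edgeCond (eV ∘ Γ.src ∘ eE.symm) (eV ∘ Γ.tgt ∘ eE.symm) (Γ.slope ∘ eE.symm) _ e = _
    rw [edgeCond_reindex, Function.comp_assoc, eV.symm_comp_self]
    rfl
  · change momentCond (eV ∘ Γ.src ∘ eE.symm) (Γ.slope ∘ eE.symm) (fun k => N k ∘ eE.symm) _ = _
    rw [momentCond_reindex, Function.comp_assoc, eV.symm_comp_self]
    rfl
  · ext i : 1
    change x (eV.symm (eV (p i))) = _
    rw [eV.symm_apply_apply]
  · have : (fun i => toTorus Λ (x (p i))) = P := funext fun i => (hx _).trans (hpos i)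
    rwa [this]

/-! ### The main theorem -/

theorem mainTheorem3 (Λ : Submodule ℤ RealN) [DiscreteTopology Λ] [IsZLattice ℝ Λ]
    (L : PolarizedLineBundle Λ) (g : ℕ) (hg : 2 ≤ g) :
    ∃ U : Set (Fin (g - 2) → TropTorus Λ), IsOpen U ∧ Dense U ∧
      ∀ P ∈ U,
        ∀ (Γ : TropCurve Λ) (p : Fin (g - 2) → Γ.V),
          Γ.IsSimpleMarked p → Γ.genus = g → (∀ i, Γ.pos (p i) = P i) →
          Γ.InLinearSystem L →
            Γ.ComplementConnected p ∧
            (∃ W F, Γ.ComplementRetractsOn p W F) ∧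
            ∀ W F, Γ.ComplementRetractsOn p W F →
              Γ.genusOn F = 2 ∧ Γ.homologyIndex F ≠ 0 ∧
              ∀ (b : Module.Basis (Fin 2) ℤ Λ) (q : Fin 2 → RealN),
                (∀ k, Γ.LoopTransverse (q k) (b k)) →
                  Γ.complexMult p b q = Γ.weightGcd * Γ.homologyIndex F * Γ.usualMult := by
  obtain ⟨b₀⟩ := exists_latticeBasis (Λ := Λ)
  obtain ⟨U, hU, hU', key⟩ := exists_generic_configurations L (g - 2)
  refine ⟨U, hU, hU', fun P hP Γ p hΓ hgen hpos hL => ?_⟩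
  have hgen' : Γ.genus = g - 2 + 2 := by omega
  obtain ⟨N, hreg, hN, hper⟩ := key P hP Γ p hΓ hgen' hpos hL
  obtain ⟨hp, hval, hbiv, hrig⟩ := hΓ.of_isRegularMarking hgen' hN hreg
  have hinj : ∀ z ∈ Γ.H1 (Γ.innerEdges p), Γ.period z = 0 → z = 0 := fun z hz hz0 =>
    hΓ.period_injective hper hrig hz hz0
  obtain ⟨hconn, hgenus, hind⟩ := hΓ.complementConnected b₀ hgen' hp hbiv hinj
  obtain ⟨hV, hE⟩ := hΓ.card_vertices
  have hne : ∃ v, v ∉ Set.range p := by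
    by_contra! h
    have := Fintype.card_le_of_surjective p h
    rw [Fintype.card_fin] at this
    omega
  refine ⟨hconn, hconn.exists_retract hne, fun W F hF => ?_⟩
  have hH := hF.H1_eq
  rw [Γ.genusOn_congr hH, Γ.homologyIndex_congr hH]
  refine ⟨hgenus, hind, fun b q hq => ?_⟩
  refine TropCurve.complexMult_eq hΓ.immersion hp (fun v => ?_) hconn hinj hind
    (Fintype.card_pos_iff.1 (by omega)) hq
  constructor
  · rintro h ⟨i, rfl⟩
    rw [hval i] at h
    omega
  · exact fun h => (hΓ.valence_eq v).resolve_right fun h' => h h'.2
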